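/- **Setting.** Let $\mathcal H$ be a complex Hilbert space, $\mathcal H_n=\mathcal H^{\otimes n}$, $K$ a self-adjoint (possibly unbounded) operator on $\mathcal H$, and $\Phi$ a bounded self-adjoint operator on $\mathcal H_2$ that is invariant under exchange of the two particles. Let $H_n=\sum_{j=1}^nK(j)+\sum_{i<j}\Phi(i,j)$ be the $n$-particle Hamiltonian (the closure of this expression on the linear span of products of vectors of $D(K)$). For $X\subset(1,\dots,s)$ let $\mathcal G_{|X|}(t,X)b=e^{itH_{|X|}(X)}\,b\,e^{-itH_{|X|}(X)}$, acting on bounded operators on $\mathcal H_s$, where $H_{|X|}(X)$ is the Hamiltonian of the particles in $X$; in particular $\mathcal G_s(t)b=e^{itH_s}be^{-itH_s}$. For $0<\gamma<1$ let $\mathfrak L_\gamma$ be the space of sequences $b=(b_0,b_1,\dots)$ of bounded self-adjoint permutation-symmetric operators $b_n$ on $\mathcal H_n$ with $\|b\|_\gamma=\sup_n\frac{\gamma^n}{n!}\|b_n\|<\infty$. The Cauchy problem for the dual BBGKY hierarchy is, for $s\ge 0$, $$\tfrac{d}{dt}B_s(t)=-i\,(B_s(t)H_s-H_sB_s(t))+\sum_{j_1\ne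 j_2=1}^s\mathcal N_{\rm int}(j_1,j_2)\,B_{s-1}\big(t,(1,\dots,s)\setminus j_1\big)\otimes\mathbb 1_{(j_1)},\qquad B(0)=b\in\mathfrak L_\gamma ,$$ with $\mathcal N_{\rm int}(i,j)g=-i(g\,\Phi(i,j)-\Phi(i,j)g)$. A (global, generalized) solution is a map $\mathbb R\to\mathfrak L_\gamma$, $t\mapsto B(t)$, with $B(0)=b$, every $t\mapsto\langle\varphi,B_s(t)\psi\rangle$ continuous, and the equation satisfied in the form $\langle\varphi,\cdot\,\psi\rangle$ for all $\varphi,\psi\in D(H_s)$ and all $t$. A family $\mathfrak A$ of generating operators assigns to $t\in\mathbb R$ and to a set of $m$ clusters $Z_1,\dots,Z_m$ of particles among $(1,\dots,s)$ a linear map $\mathfrak A_m(t,Z_1,\dots,Z_m)$ of the bounded operators on $\mathcal H_s$. Below, the cluster sets are those of the form $(\{X\},j_1,\dots,j_n)$: the set $X$ counts as one cluster and $j_1,\dots,j_n\notin X$ as one-particle clusters. The expansion with generating operators $\mathfrak A$ and initial data $b$ is $$B_s(t)=\sum_{n=0}^s\frac1{n!}\sum_{j_1\ne\dots\ne j_n=1}^s\mathfrak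 A_{1+n}\big(t,\{(1,\dots,s)\setminus(j_1,\dots,j_n)\},j_1,\dots,j_n\big)\,b_{s-n}\big((1,\dots,s)\setminus(j_1,\dots,j_n)\big)\otimes\mathbb 1_{(j_1)}\otimes\dots\otimes\mathbb 1_{(j_n)}.\tag{1}$$ The cluster expansions are the equations, for disjoint $X,\{j_1,\dots,j_n\}\subset(1,\dots,s)$, $$\mathcal G_{|X|+n}(t,X\cup\{j_1,\dots,j_n\})=\sum_{\mathrm P:(\{X\},j_1,\dots,j_n)=\bigcup_iX_i}\ \prod_{X_i\subset\mathrm P}\mathfrak A_{|X_i|}(t,X_i),\tag{2}$$ and the cumulants are $$\mathfrak A_{1+n}(t,\{X\},j_1,\dots,j_n)=\sum_{\mathrm P:(\{X\},j_1,\dots,j_n)=\bigcup_iX_i}(-1)^{|\mathrm P|-1}(|\mathrm P|-1)!\prod_{X_i\subset\mathrm P}\mathcal G_{|\theta(X_i)|}(t,\theta(X_i)),\tag{3}$$ where the sums are over partitions into nonempty subsets and $\theta(X_i)$ is the set of all particles in the clusters of $X_i$. Say that $\mathfrak A$ *solves the hierarchy* if for every $b\in\mathfrak L_\gamma$ the sequence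 (1) is a solution of the Cauchy problem with initial data $b$. **Theorem.** Let $0<\gamma<1$. 1. Let $\mathfrak A$ be any family of generating operators such that $\mathfrak A_{1+n}(t,\{X\},j_1,\dots,j_n)$ acts only on the particles $X\cup\{j_1,\dots,j_n\}$ (it commutes with left and right multiplication by operators of the other particles) and is compatible with embeddings and renamings of particle labels. Then the following are equivalent: (a) $\mathfrak A$ solves the hierarchy; (b) $\mathfrak A$ solves the cluster expansions on the observables, i.e. for all $b\in\mathfrak L_\gamma$, $t$, $s$, $n$, equation (2) with $X=(1,\dots,s)\setminus(j_1,\dots,j_n)$ holds after both sides are applied to $b_{s-n}(X)\otimes\mathbb 1_{(j_1)}\otimes\dots\otimes\mathbb 1_{(j_n)}$ and summed over $j_1\ne\dots\ne j_n$; (c) for all $b\in\mathfrak L_\gamma$, $t$, $s$, $n$, the $n$-th term of (1) coincides with the one in which $\mathfrak A_{1+n}$ is the cumulant (3). 2. Let $\mathfrak A$ be of the form $\mathfrak A_{1+n}(t,\{X\},j_1,\dots,j_n)=\sum_{\mathrm P}c_{|\mathrm P|}(t)\prod_{X_i\subset\mathrm P}\mathcal G_{|\theta(X_i)|}(t,\theta(X_i))$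 with arbitrary complex coefficients $c_k(t)$. Then $\mathfrak A$ solves the hierarchy if and only if it satisfies the cluster expansions (2) as identities of operators. 3. An arbitrary family $\mathfrak A$ satisfies the cluster expansions (2) if and only if its members are the cumulants (3), and in that case it solves the hierarchy. 4. If an arbitrary family $\mathfrak A$ solves the hierarchy and $\gamma<e^{-1}$, then for all $b\in\mathfrak L_\gamma$ and $t\in\mathbb R$ the sequence (1) satisfies $\|B(t)\|_\gamma\le e^2(1-\gamma e)^{-1}\|b\|_\gamma$. -/

import Mathlib

namespace QuantumHierarchy

open scoped ComplexOrder InnerProductSpace ComplexConjugate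

noncomputable section

/-! ### Hilbert space tensor powers -/

theorem posSemidef_prodGram {α ι H : Type*} [Finite α]
    [NormedAddCommGroup H] [InnerProductSpace ℂ H] (s : Finset ι) (x : α → ι → H) :
    (Matrix.of fun a b => ∏ i ∈ s, ⟪x a i, x b i⟫_ℂ).PosSemidef := by
  classical
  induction s using Finset.induction_on with
  | empty =>
    convert! Matrix.posSemidef_gram ℂ (fun _ : α => (1 : ℂ)) using 1
    ext a b; simp [Matrix.gram]
  | insert i s hi ih =>
    convert! (Matrix.posSemidef_gram ℂ (fun a : α => x a i)).hadamard ih using 1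
    ext a b; simp [Matrix.gram, Finset.prod_insert hi]

theorem prodGram_sum_nonneg {α ι H : Type*} [Fintype ι]
    [NormedAddCommGroup H] [InnerProductSpace ℂ H] (s : Finset α) (c : α → ℂ) (x : α → ι → H) :
    0 ≤ ∑ a ∈ s, ∑ b ∈ s, conj (c a) * c b * ∏ i, ⟪x a i, x b i⟫_ℂ := by
  have h := (posSemidef_prodGram (Finset.univ : Finset ι)
    (fun a : s => x a)).dotProduct_mulVec_nonneg (fun a => c a)
  rw [← Finset.sum_coe_sort s]
  convert! h using 1
  simp only [dotProduct, Matrix.mulVec, Finset.mul_sum, Pi.star_apply, Matrix.of_apply]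
  refine Finset.sum_congr rfl fun a _ => ?_
  rw [← Finset.sum_coe_sort s]
  refine Finset.sum_congr rfl fun b _ => ?_
  simp only [RCLike.star_def]
  ring

/-- The kernel `(x, y) ↦ ∏ i, ⟪x i, y i⟫` on `H ^ ι`. -/
def tensorKernel (ι H : Type*) [Fintype ι] [NormedAddCommGroup H] [InnerProductSpace ℂ H] :
    Matrix (ι → H) (ι → H) (ℂ →L[ℂ] ℂ) :=
  Matrix.of fun x y => (∏ i, ⟪x i, y i⟫_ℂ) • ContinuousLinearMap.id ℂ ℂ

theorem tensorKernel_posSemidef (ι H : Type*) [Fintype ι] [NormedAddCommGroup H]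
    [InnerProductSpace ℂ H] : (tensorKernel ι H).PosSemidef := by
  have key := (RKHS.posSemidef_tfae (K := tensorKernel ι H)).out 0 1
  refine key.mpr ⟨?_, fun f => ?_⟩
  · ext x y
    simp [tensorKernel, ContinuousLinearMap.star_eq_adjoint, ContinuousLinearMap.adjoint_id]
  · have h := prodGram_sum_nonneg f.support (fun p => f p * p.2) (fun p => p.1)
    have h2 := (RCLike.nonneg_iff.mp h).1
    convert! h2 using 2
    simp only [Finsupp.sum]
    refine Finset.sum_congr rfl fun a _ => Finset.sum_congr rfl fun b _ => ?_
    simp [tensorKernel, map_prod]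
    ring

instance tensorKernel_fact (ι H : Type*) [Fintype ι] [NormedAddCommGroup H]
    [InnerProductSpace ℂ H] : Fact (tensorKernel ι H).PosSemidef := ⟨tensorKernel_posSemidef ι H⟩

/-- The Hilbert space tensor power `H^{⊗ι}` over a finite label set `ι`: the Hilbert space generated
by vectors `pureTensor x`, `x : ι → H`, with `⟪pureTensor x, pureTensor y⟫ = ∏ i, ⟪x i, y i⟫`
(see `inner_pureTensor` and `span_pureTensor`). -/
def TensorPow (ι H : Type*) [Fintype ι] [NormedAddCommGroup H] [InnerProductSpace ℂ H] :
    Type _ := RKHS.OfKernel (tensorKernel ι H)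

section
variable (ι H : Type*) [Fintype ι] [NormedAddCommGroup H] [InnerProductSpace ℂ H]
instance : NormedAddCommGroup (TensorPow ι H) :=
  inferInstanceAs (NormedAddCommGroup (RKHS.OfKernel (tensorKernel ι H)))
instance : InnerProductSpace ℂ (TensorPow ι H) :=
  inferInstanceAs (InnerProductSpace ℂ (RKHS.OfKernel (tensorKernel ι H)))
instance : CompleteSpace (TensorPow ι H) :=
  inferInstanceAs (CompleteSpace (RKHS.OfKernel (tensorKernel ι H)))
instance : RKHS ℂ (TensorPow ι H) (ι → H) ℂ :=
  inferInstanceAs (RKHS ℂ (RKHS.OfKernel (tensorKernel ι H)) (ι → H) ℂ)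
theorem kernel_tensorPower : RKHS.kernel (TensorPow ι H) = tensorKernel ι H :=
  RKHS.OfKernel.kernel_ofKernel
end

/-- The product vector `⊗_i x i`. -/
def pureTensor {ι H : Type*} [Fintype ι] [NormedAddCommGroup H] [InnerProductSpace ℂ H] (x : ι → H) :
    TensorPow ι H := RKHS.kerFun (TensorPow ι H) x (1 : ℂ)

theorem inner_pureTensor {ι H : Type*} [Fintype ι] [NormedAddCommGroup H] [InnerProductSpace ℂ H]
    (x y : ι → H) : ⟪pureTensor x, pureTensor y⟫_ℂ = ∏ i, ⟪x i, y i⟫_ℂ := by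
  have h := RKHS.kernel_inner (TensorPow ι H) y x (1 : ℂ) (1 : ℂ)
  rw [kernel_tensorPower] at h
  refine h.symm.trans ?_
  simp [tensorKernel, map_prod]

theorem span_pureTensor (ι H : Type*) [Fintype ι] [NormedAddCommGroup H] [InnerProductSpace ℂ H] :
    (Submodule.span ℂ (Set.range (pureTensor : (ι → H) → TensorPow ι H))).topologicalClosure = ⊤ := by
  rw [eq_top_iff]
  refine (RKHS.kerFun_dense (TensorPow ι H)).ge.trans ?_
  refine Submodule.topologicalClosure_mono (Submodule.span_le.mpr ?_)
  rintro _ ⟨x, v, rfl⟩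
  have : RKHS.kerFun (TensorPow ι H) x v = v • pureTensor x := by
    refine Eq.trans ?_ (map_smul (RKHS.kerFun (TensorPow ι H) x) v (1 : ℂ))
    simp
  rw [this]
  exact Submodule.smul_mem _ _ (Submodule.subset_span ⟨x, rfl⟩)

section
variable {κ ι H : Type*} [Fintype κ] [Fintype ι] [NormedAddCommGroup H] [InnerProductSpace ℂ H]

theorem dense_span_pureTensor :
    Dense ((Submodule.span ℂ (Set.range (pureTensor : (ι → H) → TensorPow ι H)) :
      Submodule ℂ (TensorPow ι H)) : Set (TensorPow ι H)) := by
  rw [Submodule.dense_iff_topologicalClosure_eq_top]; exact span_pureTensor ι H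

theorem eq_of_inner_pureTensor {u v : TensorPow ι H}
    (h : ∀ x : ι → H, ⟪u, pureTensor x⟫_ℂ = ⟪v, pureTensor x⟫_ℂ) : u = v := by
  have : innerSL ℂ u = innerSL ℂ v := by
    refine ContinuousLinearMap.ext_on dense_span_pureTensor ?_
    rintro _ ⟨x, rfl⟩
    simpa using h x
  refine ext_inner_right ℂ fun w => ?_
  simpa using DFunLike.congr_fun this w

theorem exists_clm_of_bound {X E F : Type*} [NormedAddCommGroup E] [InnerProductSpace ℂ E]
    [NormedAddCommGroup F] [InnerProductSpace ℂ F] [CompleteSpace F]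
    (u : X → E) (hu : Dense ((Submodule.span ℂ (Set.range u) : Submodule ℂ E) : Set E))
    (w : X → F) (C : ℝ)
    (h : ∀ c : X →₀ ℂ, ‖Finsupp.linearCombination ℂ w c‖ ≤ C * ‖Finsupp.linearCombination ℂ u c‖) :
    ∃ T : E →L[ℂ] F, ∀ x, T (u x) = w x := by
  set lu := Finsupp.linearCombination ℂ u
  set lw := Finsupp.linearCombination ℂ w
  have hker : LinearMap.ker lu ≤ LinearMap.ker lw := fun c hc => by
    have := h c
    rw [LinearMap.mem_ker.mp hc, norm_zero, mul_zero] at this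
    exact norm_le_zero_iff.mp this
  let g : LinearMap.range lu →ₗ[ℂ] F :=
    (LinearMap.ker lu).liftQ lw hker ∘ₗ lu.quotKerEquivRange.symm.toLinearMap
  have hg : ∀ c, g ⟨lu c, c, rfl⟩ = lw c := fun c => by
    have : lu.quotKerEquivRange.symm ⟨lu c, c, rfl⟩ = Submodule.Quotient.mk c := by
      rw [LinearEquiv.symm_apply_eq]; rfl
    simp [g, this]
  let g' : LinearMap.range lu →L[ℂ] F := g.mkContinuous C (by
    rintro ⟨_, c, rfl⟩
    rw [hg]; exact h c)
  have hd : DenseRange (LinearMap.range lu).subtypeL := by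
    have : ((LinearMap.range lu : Submodule ℂ E) : Set E) = Set.range (LinearMap.range lu).subtypeL := by
      ext; simp
    rw [DenseRange, ← this, Finsupp.range_linearCombination]
    exact hu
  refine ⟨g'.extend (LinearMap.range lu).subtypeL, fun x => ?_⟩
  have hx : u x = lu (Finsupp.single x 1) := by simp [lu]
  have := ContinuousLinearMap.extend_eq g' hd
    (isometry_subtype_coe.isUniformInducing) ⟨lu (Finsupp.single x 1), _, rfl⟩
  rw [hx]
  refine this.trans ?_
  change g _ = _
  rw [hg]; simp [lw]

theorem inner_extend (e : κ ↪ ι) (x x' : κ → H) (z z' : ι → H) [DecidablePred (· ∈ Set.range e)] :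
    ∏ i, ⟪Function.extend e x z i, Function.extend e x' z' i⟫_ℂ =
      (∏ k, ⟪x k, x' k⟫_ℂ) * ∏ i : {i // i ∉ Set.range e}, ⟪z i, z' i⟫_ℂ := by
  classical
  rw [← Fintype.prod_subtype_mul_prod_subtype (fun i => i ∈ Set.range e)]
  congr 1
  · symm
    refine Finset.prod_bij (fun k _ => ⟨e k, k, rfl⟩) (by simp) ?_ ?_ ?_
    · intro a _ b _ h
      exact e.injective (congrArg Subtype.val h)
    · rintro ⟨_, k, rfl⟩ _
      exact ⟨k, Finset.mem_univ _, rfl⟩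
    · intro k _
      simp [e.injective.extend_apply]
  · refine Finset.prod_congr rfl fun i _ => ?_
    rw [Function.extend_apply' _ _ _ i.2, Function.extend_apply' _ _ _ i.2]

open Classical in
theorem norm_sq_linearCombination {X E : Type*} [NormedAddCommGroup E] [InnerProductSpace ℂ E]
    (u : X → E) (c : X →₀ ℂ) :
    ((‖Finsupp.linearCombination ℂ u c‖ ^ 2 : ℝ) : ℂ) =
      ∑ a ∈ c.support, ∑ b ∈ c.support, conj (c a) * c b * ⟪u a, u b⟫_ℂ := by
  rw [Complex.ofReal_pow, ← Complex.coe_algebraMap, ← inner_self_eq_norm_sq_to_K (𝕜 := ℂ)]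
  simp only [Finsupp.linearCombination_apply, Finsupp.sum, sum_inner, inner_sum, inner_smul_left,
    inner_smul_right, Finset.mul_sum]
  rw [Finset.sum_comm]
  refine Finset.sum_congr rfl fun a _ => Finset.sum_congr rfl fun b _ => ?_
  ring

theorem exists_insertVec (e : κ ↪ ι) (z : ι → H) :
    ∃ T : TensorPow κ H →L[ℂ] TensorPow ι H, ∀ x, T (pureTensor x) = pureTensor (Function.extend e x z) := by
  classical
  set r := ∏ i : {i // i ∉ Set.range e}, ⟪z i, z i⟫_ℂ
  refine exists_clm_of_bound _ dense_span_pureTensor _ (Real.sqrt ‖r‖) fun c => ?_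
  refine (sq_le_sq₀ (norm_nonneg _) (by positivity)).mp ?_
  rw [mul_pow, Real.sq_sqrt (norm_nonneg _)]
  have h1 := norm_sq_linearCombination (fun x : κ → H => pureTensor (Function.extend e x z)) c
  have h2 := norm_sq_linearCombination (pureTensor : (κ → H) → TensorPow κ H) c
  simp only [inner_pureTensor, inner_extend] at h1 h2
  have h3 : ((‖Finsupp.linearCombination ℂ (fun x : κ → H => pureTensor (Function.extend e x z)) c‖ ^ 2
      : ℝ) : ℂ) = r * ((‖Finsupp.linearCombination ℂ (pureTensor : (κ → H) → TensorPow κ H) c‖ ^ 2 : ℝ) : ℂ) := by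
    rw [h1, h2, Finset.mul_sum]
    refine Finset.sum_congr rfl fun a _ => ?_
    rw [Finset.mul_sum]
    refine Finset.sum_congr rfl fun b _ => ?_
    simp only [r]; ring
  have h4 := congrArg norm h3
  rw [norm_mul] at h4
  simp only [Complex.norm_real, norm_pow, norm_norm] at h4
  exact h4.le

/-- Tensoring with the product vector of the `z i`, `i ∉ range e`, the factors of `TensorPow κ H`
being put at the labels in the range of `e`. -/
def insertVec (e : κ ↪ ι) (z : ι → H) : TensorPow κ H →L[ℂ] TensorPow ι H :=
  (exists_insertVec e z).choose

theorem insertVec_pureTensor (e : κ ↪ ι) (z : ι → H) (x : κ → H) :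
    insertVec e z (pureTensor x) = pureTensor (Function.extend e x z) :=
  (exists_insertVec e z).choose_spec x

open Classical in
theorem inner_insertVec (e : κ ↪ ι) (z z' : ι → H) (v v' : TensorPow κ H) :
    ⟪insertVec e z v, insertVec e z' v'⟫_ℂ =
      (∏ i : {i // i ∉ Set.range e}, ⟪z i, z' i⟫_ℂ) * ⟪v, v'⟫_ℂ := by
  set r := ∏ i : {i // i ∉ Set.range e}, ⟪z i, z' i⟫_ℂ with hr
  have key : (insertVec e z).adjoint ∘L insertVec e z' = r • ContinuousLinearMap.id ℂ _ := by
    refine ContinuousLinearMap.ext_on dense_span_pureTensor ?_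
    rintro _ ⟨x', rfl⟩
    refine eq_of_inner_pureTensor fun x => ?_
    rw [ContinuousLinearMap.comp_apply, ContinuousLinearMap.adjoint_inner_left, insertVec_pureTensor,
      insertVec_pureTensor, inner_pureTensor, inner_extend]
    simp only [_root_.smul_apply, ContinuousLinearMap.id_apply, inner_smul_left,
      inner_pureTensor, hr, map_prod, inner_conj_symm]
    ring
  rw [← ContinuousLinearMap.adjoint_inner_right, ← ContinuousLinearMap.comp_apply, key]
  simp [inner_smul_right]

theorem exists_ampl (e : κ ↪ ι) (b : TensorPow κ H →L[ℂ] TensorPow κ H) :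
    ∃ T : TensorPow ι H →L[ℂ] TensorPow ι H,
      ∀ (z : ι → H) (v : TensorPow κ H), T (insertVec e z v) = insertVec e z (b v) := by
  classical
  have hself : ∀ y : ι → H, Function.extend e (y ∘ e) y = y := by
    intro y; ext i
    by_cases hi : ∃ k, e k = i
    · obtain ⟨k, rfl⟩ := hi; simp [e.injective.extend_apply]
    · rw [Function.extend_apply' _ _ _ hi]
  obtain ⟨T, hT⟩ := exists_clm_of_bound (pureTensor : (ι → H) → TensorPow ι H) dense_span_pureTensor
    (fun y => insertVec e y (b (pureTensor (y ∘ e)))) ‖b‖ (fun c => by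
      refine (sq_le_sq₀ (norm_nonneg _) (by positivity)).mp ?_
      rw [mul_pow]
      have hPSD : (((‖b‖ ^ 2 : ℝ) : ℂ) •
            Matrix.gram ℂ (fun a : c.support => (pureTensor (a.1 ∘ e) : TensorPow κ H))
          - Matrix.gram ℂ (fun a : c.support => b (pureTensor (a.1 ∘ e)))).PosSemidef := by
        refine .of_dotProduct_mulVec_nonneg ?_ fun x => ?_
        · refine Matrix.IsHermitian.sub ?_ (Matrix.isHermitian_gram _ _)
          ext i j
          simp [Matrix.gram_apply]
        · rw [Matrix.sub_mulVec, Matrix.smul_mulVec, dotProduct_sub, dotProduct_smul,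
            Matrix.star_dotProduct_gram_mulVec, Matrix.star_dotProduct_gram_mulVec]
          have hb : ∑ i, x i • b (pureTensor (i.1 ∘ e) : TensorPow κ H) =
              b (∑ i, x i • pureTensor (i.1 ∘ e)) := by simp [map_sum]
          rw [hb, inner_self_eq_norm_sq_to_K, inner_self_eq_norm_sq_to_K, sub_nonneg, smul_eq_mul]
          have := b.le_opNorm (∑ i, x i • pureTensor (i.1 ∘ e))
          have h2 := pow_le_pow_left₀ (norm_nonneg _) this 2
          rw [mul_pow] at h2
          have h3 := Complex.real_le_real.mpr h2
          simpa using h3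
      have hQ := (hPSD.hadamard (posSemidef_prodGram
        (Finset.univ : Finset {i // i ∉ Set.range e})
        (fun (a : c.support) i => a.1 i))).dotProduct_mulVec_nonneg (fun a => c a)
      have h1 := norm_sq_linearCombination
        (fun y : ι → H => insertVec e y (b (pureTensor (y ∘ e)))) c
      have h2 := norm_sq_linearCombination (pureTensor : (ι → H) → TensorPow ι H) c
      have h3 : ∀ y y' : ι → H, ⟪(pureTensor y : TensorPow ι H), pureTensor y'⟫_ℂ =
          (∏ i : {i // i ∉ Set.range e}, ⟪y i, y' i⟫_ℂ) *
            ⟪(pureTensor (y ∘ e) : TensorPow κ H), pureTensor (y' ∘ e)⟫_ℂ := by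
        intro y y'
        rw [← inner_insertVec, insertVec_pureTensor, insertVec_pureTensor, hself, hself]
      simp only [inner_insertVec] at h1
      simp only [h3] at h2
      have h4 : (0 : ℂ) ≤ ((‖b‖ ^ 2 *
          ‖Finsupp.linearCombination ℂ (pureTensor : (ι → H) → TensorPow ι H) c‖ ^ 2 -
          ‖Finsupp.linearCombination ℂ
            (fun y : ι → H => insertVec e y (b (pureTensor (y ∘ e)))) c‖ ^ 2 : ℝ) : ℂ) := by
        rw [Complex.ofReal_sub, Complex.ofReal_mul, h1, h2]
        convert! hQ using 1
        rw [Finset.mul_sum, ← Finset.sum_sub_distrib, ← Finset.sum_coe_sort c.support]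
        simp only [dotProduct, Matrix.mulVec, Finset.mul_sum, Pi.star_apply]
        refine Finset.sum_congr rfl fun a _ => ?_
        rw [← Finset.sum_sub_distrib, ← Finset.sum_coe_sort c.support]
        refine Finset.sum_congr rfl fun d _ => ?_
        simp only [RCLike.star_def, Matrix.hadamard_apply, Matrix.sub_apply, Matrix.smul_apply,
          Matrix.gram_apply, Matrix.of_apply, smul_eq_mul]
        ring
      have h5 := Complex.zero_le_real.mp h4
      linarith)
  refine ⟨T, fun z v => ?_⟩
  have : T ∘L insertVec e z = insertVec e z ∘L b := by
    refine ContinuousLinearMap.ext_on dense_span_pureTensor ?_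
    rintro _ ⟨x, rfl⟩
    have hx : Function.extend e x z ∘ e = x := by ext k; simp [e.injective.extend_apply]
    have hz : insertVec e (Function.extend e x z) =
        (insertVec e z : TensorPow κ H →L[ℂ] TensorPow ι H) := by
      refine ContinuousLinearMap.ext_on dense_span_pureTensor ?_
      rintro _ ⟨x', rfl⟩
      rw [insertVec_pureTensor, insertVec_pureTensor]
      congr 1
      ext i
      by_cases hi : ∃ k, e k = i
      · obtain ⟨k, rfl⟩ := hi; simp [e.injective.extend_apply]
      · simp [Function.extend_apply' _ _ _ hi]
    simp only [ContinuousLinearMap.comp_apply, insertVec_pureTensor, hT, hx, hz]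
  exact DFunLike.congr_fun this v

/-- `b ⊗ 𝟙`: the operator `b` acting on the tensor factors with labels in the range of `e`, the
identity acting on all the others. -/
def ampl (e : κ ↪ ι) (b : TensorPow κ H →L[ℂ] TensorPow κ H) : TensorPow ι H →L[ℂ] TensorPow ι H :=
  (exists_ampl e b).choose

theorem ampl_insertVec (e : κ ↪ ι) (b : TensorPow κ H →L[ℂ] TensorPow κ H) (z : ι → H)
    (v : TensorPow κ H) : ampl e b (insertVec e z v) = insertVec e z (b v) :=
  (exists_ampl e b).choose_spec z v

/-- `ampl_insertVec` characterises `ampl e b`. -/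
theorem ampl_unique (e : κ ↪ ι) (b : TensorPow κ H →L[ℂ] TensorPow κ H)
    (T : TensorPow ι H →L[ℂ] TensorPow ι H)
    (hT : ∀ (z : ι → H) (v : TensorPow κ H), T (insertVec e z v) = insertVec e z (b v)) :
    T = ampl e b := by
  refine ContinuousLinearMap.ext_on dense_span_pureTensor ?_
  rintro _ ⟨y, rfl⟩
  have hy : Function.extend e (y ∘ e) y = y := by
    ext i
    by_cases hi : ∃ k, e k = i
    · obtain ⟨k, rfl⟩ := hi; simp [e.injective.extend_apply]
    · rw [Function.extend_apply' _ _ _ hi]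
  have := (hT y (pureTensor (y ∘ e))).trans (ampl_insertVec e b y (pureTensor (y ∘ e))).symm
  rwa [insertVec_pureTensor, hy] at this

end

/-! ### Unitary groups -/

/-- `U` is the strongly continuous unitary group `t ↦ e^{itA}`: its infinitesimal generator,
with its natural domain, is `i A`. -/
structure IsUnitaryGroupOf {E : Type*} [NormedAddCommGroup E] [InnerProductSpace ℂ E]
    [CompleteSpace E] (A : E →ₗ.[ℂ] E) (U : ℝ → E →L[ℂ] E) : Prop where
  map_zero : U 0 = 1
  map_add : ∀ s t, U (s + t) = U s * U t
  unitary : ∀ t, U t ∈ unitary (E →L[ℂ] E)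
  strongly_continuous : ∀ x, Continuous fun t => U t x
  generator : ∀ x y, HasDerivAt (fun t => U t x) (Complex.I • y) 0 ↔ (x, y) ∈ A.graph

open Classical in
/-- `e^{itA}` for a self-adjoint operator `A` (and the identity if `iA` generates no unitary
group, that is, if `A` is not self-adjoint). -/
def expI {E : Type*} [NormedAddCommGroup E] [InnerProductSpace ℂ E] [CompleteSpace E]
    (A : E →ₗ.[ℂ] E) : ℝ → E →L[ℂ] E :=
  if h : ∃ U, IsUnitaryGroupOf A U then h.choose else fun _ => 1

/-! ### Observables -/

section
variable (n : ℕ) (H : Type*) [NormedAddCommGroup H] [InnerProductSpace ℂ H]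

/-- Bounded operators on the `n`-particle space `H_n = H^{⊗n}`. -/
abbrev Op : Type _ := TensorPow (Fin n) H →L[ℂ] TensorPow (Fin n) H

/-- Linear maps of the space of bounded operators on `H_n` into itself. -/
abbrev SuperOp : Type _ := Module.End ℂ (Op n H)

/-- Sequences `b = (b_0, b_1(1), …, b_n(1,…,n), …)` of bounded operators. -/
abbrev Obs : Type _ := (n : ℕ) → Op n H

/-- Families of generating operators: for a set `Q = {Z_1, …, Z_m}` of clusters of particles out of
`s` particles and for `t : ℝ`, the operator `𝔄_m(t, Z_1, …, Z_m)` acting on the bounded operators on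
`H_s`. -/
abbrev GenOps : Type _ := (s : ℕ) → ℝ → Finset (Finset (Fin s)) → SuperOp s H

end

section
variable {H : Type*} [NormedAddCommGroup H] [InnerProductSpace ℂ H]

/-- The symmetry condition `b_n(1,…,n) = b_n(i_1,…,i_n)`. -/
def IsSymm {n : ℕ} (b : Op n H) : Prop := ∀ σ : Equiv.Perm (Fin n), ampl σ.toEmbedding b = b

/-- `b(X) ⊗ 𝟙`: the operator `b` of `|X|` particles, acting on the particles in `X` (in increasing
order) out of `s` particles. -/
def place {s : ℕ} (X : Finset (Fin s)) (b : Op X.card H) : Op s H :=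
  ampl (X.orderEmbOfFin rfl).toEmbedding b

/-- The space `𝔏_γ` of sequences of symmetric bounded self-adjoint operators with
`sup_n γ^n / n! ‖b_n‖ < ∞`. -/
def obsSpace (H : Type*) [NormedAddCommGroup H] [InnerProductSpace ℂ H] (γ : ℝ) : Set (Obs H) :=
  {b | (∀ n, IsSelfAdjoint (b n)) ∧ (∀ n, IsSymm (b n)) ∧
    BddAbove (Set.range fun n : ℕ => γ ^ n / (n.factorial : ℝ) * ‖b n‖)}

/-- The norm of `𝔏_γ`. -/
def obsNorm (γ : ℝ) (b : Obs H) : ℝ := ⨆ n : ℕ, γ ^ n / (n.factorial : ℝ) * ‖b n‖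

/-! ### The Hamiltonians and the Heisenberg groups -/

/-- The labels `i ≠ j` as an ordered pair. -/
def pairEmb {n : ℕ} (i j : Fin n) (h : i ≠ j) : Fin 2 ↪ Fin n where
  toFun := ![i, j]
  inj' := by
    intro a b
    fin_cases a <;> fin_cases b <;> simp [h, h.symm]

/-- `Φ(i, j)` as an operator on `H_n`, for `i ≠ j`. -/
def pairOp (Φ : Op 2 H) {n : ℕ} (i j : Fin n) : Op n H :=
  if h : i ≠ j then ampl (pairEmb i j h) Φ else 0

/-- The graph of `H_n = ∑_j K(j) + ∑_{i<j} Φ(i,j)`: the closure of the graph of the operator defined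
by this formula on the linear span of the product vectors of elements of the domain of `K`. -/
def hamGraph (K : H →ₗ.[ℂ] H) (Φ : Op 2 H) (n : ℕ) :
    Submodule ℂ (TensorPow (Fin n) H × TensorPow (Fin n) H) :=
  (Submodule.span ℂ (Set.range fun x : Fin n → K.domain =>
    (pureTensor (fun i => (x i : H)),
      ∑ j, pureTensor (Function.update (fun i => (x i : H)) j (K (x j))) +
        ∑ i, ∑ j ∈ Finset.univ.filter (fun j => i < j),
          pairOp Φ i j (pureTensor (fun i => (x i : H)))))).topologicalClosure

/-- The Hamiltonian `H_n` of `n` particles. -/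
def ham (K : H →ₗ.[ℂ] H) (Φ : Op 2 H) (n : ℕ) : TensorPow (Fin n) H →ₗ.[ℂ] TensorPow (Fin n) H :=
  (hamGraph K Φ n).toLinearPMap

/-- The group `𝒢_{|X|}(t, X) b = e^{itH_{|X|}(X)} b e^{-itH_{|X|}(X)}` of the particles in `X`, acting
on the bounded operators on `H_s`. For `X` the set of all particles this is `𝒢_s(t)`. -/
def heis (K : H →ₗ.[ℂ] H) (Φ : Op 2 H) (s : ℕ) (t : ℝ) (X : Finset (Fin s)) : SuperOp s H :=
  LinearMap.mulLeft ℂ (place X (expI (ham K Φ X.card) t)) ∘ₗ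
    LinearMap.mulRight ℂ (place X (expI (ham K Φ X.card) (-t)))

/-! ### Clusters, cluster expansions and cumulants -/

/-- The set `({X}, j_1, …, j_n)` of `1 + n` clusters, where `J = {j_1, …, j_n}`: the cluster `X` is one
element and each particle of `J` is one element. -/
def clusters {s : ℕ} (X J : Finset (Fin s)) : Finset (Finset (Fin s)) :=
  insert X (J.image fun j => {j})

/-- `∑_P ∏_{X_i ∈ P} 𝔄_{|X_i|}(t, X_i)`, the sum over all the partitions `P` of the set `Q` of clusters
into nonempty subsets. (The factors belong to disjoint sets of particles; the composition is taken
in some fixed order.) -/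
def clusterSum (𝔄 : GenOps H) (s : ℕ) (t : ℝ) (Q : Finset (Finset (Fin s))) : SuperOp s H :=
  ∑ P : Finpartition Q, (P.parts.toList.map fun C => 𝔄 s t C).prod

/-- The cluster expansions
`𝒢_{|X ∪ J|}(t, X ∪ J) = ∑_P ∏_{X_i ∈ P} 𝔄_{|X_i|}(t, X_i)`, `P` a partition of `({X}, j_1, …, j_n)`. -/
def SolvesClusterExpansions (K : H →ₗ.[ℂ] H) (Φ : Op 2 H) (𝔄 : GenOps H) : Prop :=
  ∀ (s : ℕ) (t : ℝ) (X J : Finset (Fin s)), Disjoint X J →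
    heis K Φ s t (X ∪ J) = clusterSum 𝔄 s t (clusters X J)

/-- Expansions over the groups `𝒢` with coefficients depending on the number of blocks:
`∑_P c_{|P|}(t) ∏_{X_i ∈ P} 𝒢_{|θ(X_i)|}(t, θ(X_i))`; the declustering map `θ` takes a set of clusters to
their union. -/
def groupExpansion (K : H →ₗ.[ℂ] H) (Φ : Op 2 H) (c : ℝ → ℕ → ℂ) : GenOps H := fun s t Q =>
  ∑ P : Finpartition Q,
    c t P.parts.card • (P.parts.toList.map fun C => heis K Φ s t (C.sup id)).prod

/-- The cumulants of the groups `𝒢`: the coefficients are `(-1)^{|P|-1} (|P|-1)!`. -/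
def cumulant (K : H →ₗ.[ℂ] H) (Φ : Op 2 H) : GenOps H :=
  groupExpansion K Φ fun _ k => (-1) ^ (k - 1) * ((k - 1).factorial : ℂ)

/-- `𝔄_{1+n}(t, {X}, j_1, …, j_n)` acts only on the particles in `X ∪ {j_1, …, j_n}`, and depends on the
labels of the particles only through their renaming. -/
structure IsGeneratingFamily (𝔄 : GenOps H) : Prop where
  relabel : ∀ (r s : ℕ) (e : Fin r ↪ Fin s) (t : ℝ) (X J : Finset (Fin r)), Disjoint X J →
    ∀ b : Op r H, 𝔄 s t (clusters (X.map e) (J.map e)) (ampl e b) = ampl e (𝔄 r t (clusters X J) b)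
  local_left : ∀ (s : ℕ) (t : ℝ) (X J Y : Finset (Fin s)), Disjoint X J → Disjoint (X ∪ J) Y →
    ∀ (c : Op Y.card H) (b : Op s H),
      𝔄 s t (clusters X J) (place Y c * b) = place Y c * 𝔄 s t (clusters X J) b
  local_right : ∀ (s : ℕ) (t : ℝ) (X J Y : Finset (Fin s)), Disjoint X J → Disjoint (X ∪ J) Y →
    ∀ (c : Op Y.card H) (b : Op s H),
      𝔄 s t (clusters X J) (b * place Y c) = 𝔄 s t (clusters X J) b * place Y c

/-! ### Expansions of reduced observables -/

/-- The sum `∑_{j_1 ≠ … ≠ j_n = 1}^s 𝔗((1,…,s)∖(j_1,…,j_n); j_1,…,j_n) b_{s-n}((1,…,s)∖(j_1,…,j_n)) ⊗ 𝟙`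
over all the ordered `n`-tuples of distinct labels, where `𝔗 X J` acts on the bounded operators on
`H_s`. -/
def tupleSum {s : ℕ} (n : ℕ) (𝔗 : Finset (Fin s) → Finset (Fin s) → SuperOp s H) (b : Obs H) :
    Op s H :=
  ∑ j : Fin n ↪ Fin s, 𝔗 (Finset.univ.map j)ᶜ (Finset.univ.map j)
    (place (Finset.univ.map j)ᶜ (b (Finset.univ.map j)ᶜ.card))

/-- The expansion of reduced observables with the generating operators `𝔄` and the initial data `b`:
`B_s(t) = ∑_{n=0}^s 1/n! ∑_{j_1 ≠ … ≠ j_n} 𝔄_{1+n}(t, {(1,…,s)∖(j_1,…,j_n)}, j_1,…,j_n) b_{s-n} ⊗ 𝟙`. -/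
def expansion (𝔄 : GenOps H) (b : Obs H) (t : ℝ) : Obs H := fun s =>
  ∑ n ∈ Finset.range (s + 1),
    ((n.factorial : ℂ))⁻¹ • tupleSum n (fun X J => 𝔄 s t (clusters X J)) b

/-- The cluster expansions hold for the terms of the expansion of reduced observables, that is,
after application to `b_{s-n} ⊗ 𝟙` and summation over `j_1, …, j_n`. -/
def SolvesClusterExpansionsOnObs (K : H →ₗ.[ℂ] H) (Φ : Op 2 H) (γ : ℝ) (𝔄 : GenOps H) : Prop :=
  ∀ b ∈ obsSpace H γ, ∀ (t : ℝ) (s n : ℕ),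
    tupleSum n (fun X J => heis K Φ s t (X ∪ J)) b =
      tupleSum n (fun X J => clusterSum 𝔄 s t (clusters X J)) b

/-- The generating operators `𝔄` and `𝔅` give the same terms in the expansions of reduced
observables. -/
def EqOnObs (γ : ℝ) (𝔄 𝔅 : GenOps H) : Prop :=
  ∀ b ∈ obsSpace H γ, ∀ (t : ℝ) (s n : ℕ),
    tupleSum n (fun X J => 𝔄 s t (clusters X J)) b =
      tupleSum n (fun X J => 𝔅 s t (clusters X J)) b

/-! ### The dual BBGKY hierarchy -/

/-- `𝒩_int(i, j) b = -i (b Φ(i,j) - Φ(i,j) b)`. -/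
def nInt (Φ : Op 2 H) {s : ℕ} (i j : Fin s) (b : Op s H) : Op s H :=
  -Complex.I • (b * pairOp Φ i j - pairOp Φ i j * b)

/-- `([𝒩, 𝔞⁺] b)_s = ∑_{j_1 ≠ j_2} 𝒩_int(j_1, j_2) b_{s-1}((1,…,s)∖j_1) ⊗ 𝟙_{(j_1)}`. -/
def nCreationComm (Φ : Op 2 H) (b : Obs H) : Obs H := fun s =>
  ∑ j₁ : Fin s, ∑ j₂ ∈ Finset.univ.filter (fun j => j₁ ≠ j),
    nInt Φ j₁ j₂ (place {j₁}ᶜ (b ({j₁}ᶜ : Finset (Fin s)).card))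

/-- `B` is a (global, generalized) solution in `𝔏_γ` of the Cauchy problem
`d/dt B(t) = 𝒩 B(t) + [𝒩, 𝔞⁺] B(t)`, `B(0) = b`, where `𝒩_s b = -i (b H_s - H_s b)`. Both sides are
tested against the rank one operators of vectors in the domain of `H_s`. -/
structure IsSolution (K : H →ₗ.[ℂ] H) (Φ : Op 2 H) (γ : ℝ) (b : Obs H) (B : ℝ → Obs H) : Prop where
  mem : ∀ t, B t ∈ obsSpace H γ
  continuous : ∀ (s : ℕ) (φ ψ : TensorPow (Fin s) H), Continuous fun t => ⟪φ, B t s ψ⟫_ℂ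
  equation : ∀ (s : ℕ) (φ ψ : (ham K Φ s).domain) (t : ℝ),
    HasDerivAt (fun τ => ⟪(φ : TensorPow (Fin s) H), B τ s ψ⟫_ℂ)
      (-Complex.I * (⟪(φ : TensorPow (Fin s) H), B t s (ham K Φ s ψ)⟫_ℂ - ⟪ham K Φ s φ, B t s ψ⟫_ℂ) +
        ⟪(φ : TensorPow (Fin s) H), nCreationComm Φ (B t) s ψ⟫_ℂ) t
  initial : B 0 = b

/-- For all initial data in `𝔏_γ` the expansion with the generating operators `𝔄` solves the Cauchy
problem for the dual BBGKY hierarchy. -/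
def ExpansionSolves (K : H →ₗ.[ℂ] H) (Φ : Op 2 H) (γ : ℝ) (𝔄 : GenOps H) : Prop :=
  ∀ b ∈ obsSpace H γ, IsSolution K Φ γ b (expansion 𝔄 b)

end

end

end QuantumHierarchy

open QuantumHierarchy

set_option linter.unusedSectionVars false

/-! The hierarchy decouples under a change of variables. Let `zeta b` be the sequence whose
`s`-particle term is the sum of `b(Y) ⊗ 𝟙` over all sets `Y` of the `s` particles;
inclusion-exclusion over subsets gives the inverse `moebius`. The commutator of `b(Y) ⊗ 𝟙` with
`H_s` consists of the embedded commutator with the Hamiltonian of `Y` and of commutators with those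
`Φ(i,j)` whose labels do not both lie in `Y`. The kinetic energy of the other particles drops out.
In an alternating sum over `Y` the extra commutators add up to the source term of the hierarchy
(`nCreationComm_moebius`). Hence evolving `zeta b` by the Heisenberg groups and applying `moebius`
gives a solution (`isSolution_moebius_evol_zeta`).

This solution is unique. The source in the `s`-th equation involves only `B_{s-1}`, so by induction
on `s` the difference of two solutions satisfies the homogeneous Heisenberg equation, and
conjugation with `e^{itH_s}` shows that it vanishes (`WeakSol.eq_zero`, `IsSolution.unique`).

The cumulant expansion is this solution (`expansion_cumulant`). A cumulant of two or more clusters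
annihilates the identity. In a partition applied to `b(X) ⊗ 𝟙`, every block without `X` must
therefore be a singleton, and the cluster expansion reduces to a sum over the subsets `J'` of `J` of
the terms with clusters `(X, J')`. Möbius inversion turns this into an alternating sum of groups.
Solving the hierarchy is therefore the same as having the cumulant expansion on observables
(`expansionSolves_iff`); truncating the initial data separates the terms. For a general generating
family the same reduction identifies `zeta` of its expansion with its cluster sums
(`zeta_expansion`), once the family is known to treat the identity as cumulants do; either condition
on observables implies this when tested on `b_1 = 𝟙`.

For coefficients `c_k`, the data `b_0 = 1` give equations on sums over partitions that determine the
`c_k` one after another (`coeff_eq_cumCoeff`). The operator form of the cluster expansions is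
inverted by the recursion `cum_recursion`. The bound comes from counting chains `X ⊆ Y` of subsets
of `(1,…,s)`, which gives the constant `e^{2γ}`.

All this rests on `H_n` generating a unitary group (`exists_group_ham`): Stone's theorem through
resolvents, density of the range for the free Hamiltonian by means of the product group, and a
contraction argument for the bounded interaction. -/

namespace QuantumHierarchy
open scoped ComplexOrder InnerProductSpace ComplexConjugate
open Filter Topology
noncomputable section

/-! ### Stone's theorem from resolvent bounds. -/

section Stone
variable {E : Type*} [NormedAddCommGroup E] [InnerProductSpace ℂ E] [CompleteSpace E]

/-- `A - iμ` is bounded below by `|μ|` for symmetric `A`. -/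
theorem norm_sub_smul_ge {A : E →ₗ.[ℂ] E} (hs : ∀ x y : A.domain, ⟪A x, (y : E)⟫_ℂ = ⟪(x : E), A y⟫_ℂ)
    (μ : ℝ) (x : A.domain) : |μ| * ‖(x : E)‖ ≤ ‖A x - (Complex.I * μ) • (x : E)‖ := by
  have h1 : ‖A x - (Complex.I * μ) • (x : E)‖ ^ 2 = ‖A x‖ ^ 2 + (|μ| * ‖(x : E)‖) ^ 2 := by
    rw [norm_sub_sq (𝕜 := ℂ), norm_smul, inner_smul_right]
    have h2 : (⟪A x, (x : E)⟫_ℂ).im = 0 := by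
      have := hs x x
      rw [← inner_conj_symm] at this
      have := congrArg Complex.im this
      simp only [Complex.conj_im] at this
      rw [hs x x]
      linarith
    simp [h2]
  have h3 := sq_nonneg ‖A x‖
  exact le_of_sq_le_sq (by linarith) (norm_nonneg _)

/-- The lower bound `norm_sub_smul_ge` gives injectivity and, read backwards, the norm estimate for
the inverse. -/
theorem exists_resolvent {A : E →ₗ.[ℂ] E}
    (hs : ∀ x y : A.domain, ⟪A x, (y : E)⟫_ℂ = ⟪(x : E), A y⟫_ℂ) (μ : ℝ) (hμ : μ ≠ 0)
    (hr : ∀ z : E, ∃ x : A.domain, A x - (Complex.I * μ) • (x : E) = z) :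
    ∃ R : E →L[ℂ] E, (∀ z, ∃ h : R z ∈ A.domain, A ⟨R z, h⟩ - (Complex.I * μ) • R z = z) ∧
      (∀ x : A.domain, R (A x - (Complex.I * μ) • (x : E)) = x) ∧ ∀ z, ‖R z‖ ≤ |μ|⁻¹ * ‖z‖ := by
  let L : A.domain →ₗ[ℂ] E := A.toFun - (Complex.I * μ) • A.domain.subtype
  have hL : ∀ x, L x = A x - (Complex.I * μ) • (x : E) := fun x => rfl
  have hinj : Function.Injective L := by
    rw [← LinearMap.ker_eq_bot, LinearMap.ker_eq_bot']
    intro x hx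
    have := norm_sub_smul_ge hs μ x
    rw [← hL, hx, norm_zero] at this
    have h0 : 0 < |μ| := abs_pos.mpr hμ
    have h1 : ‖(x : E)‖ ≤ 0 := by
      by_contra h
      push Not at h
      nlinarith [mul_pos h0 h]
    exact Subtype.ext (norm_le_zero_iff.mp h1)
  let e := LinearEquiv.ofBijective L ⟨hinj, fun z => by simpa [hL] using hr z⟩
  have hb : ∀ z, ‖(A.domain.subtype ∘ₗ e.symm.toLinearMap) z‖ ≤ |μ|⁻¹ * ‖z‖ := fun z => by
    have := norm_sub_smul_ge hs μ (e.symm z)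
    rw [← hL] at this
    change _ ≤ ‖e (e.symm z)‖ at this
    rw [e.apply_symm_apply] at this
    rw [le_inv_mul_iff₀ (abs_pos.mpr hμ)]
    exact this
  refine ⟨(A.domain.subtype ∘ₗ e.symm.toLinearMap).mkContinuous _ hb, fun z => ⟨(e.symm z).2, ?_⟩,
    fun x => ?_, hb⟩
  · exact e.apply_symm_apply z
  · rw [← hL]
    exact congrArg Subtype.val (e.symm_apply_apply x)

/-- If the vectors `V n x` converge for `x` in a dense set and the `V n` are contractions, they
converge everywhere. -/
theorem exists_tendsto_of_dense {V : ℕ → E →L[ℂ] E} (hV : ∀ n x, ‖V n x‖ ≤ ‖x‖) {D : Set E}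
    (hD : Dense D) (h : ∀ x ∈ D, CauchySeq fun n => V n x) (x : E) :
    ∃ y, Tendsto (fun n => V n x) atTop (𝓝 y) := by
  refine cauchySeq_tendsto_of_complete (Metric.cauchySeq_iff.mpr fun ε hε => ?_)
  obtain ⟨y, hy, hxy⟩ := Metric.dense_iff.mp hD x (ε / 3) (by positivity)
  obtain ⟨N, hN⟩ := Metric.cauchySeq_iff.mp (h y hxy) (ε / 3) (by positivity)
  refine ⟨N, fun m hm n hn => ?_⟩
  have h1 := hN m hm n hn
  have h2 : ‖V m x - V m y‖ ≤ ‖x - y‖ := by rw [← map_sub]; exact hV _ _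
  have h3 : ‖V n y - V n x‖ ≤ ‖x - y‖ := by rw [← map_sub, norm_sub_rev x]; exact hV _ _
  rw [Metric.mem_ball, dist_comm, dist_eq_norm] at hy
  rw [dist_eq_norm] at h1 ⊢
  calc ‖V m x - V n x‖ = ‖(V m x - V m y) + (V m y - V n y) + (V n y - V n x)‖ := by
        congr 1; abel
    _ ≤ _ := norm_add₃_le
    _ < ε := by linarith

theorem tendstoUniformlyOn_of_dense {V : ℕ → ℝ → E →L[ℂ] E} {U : ℝ → E →L[ℂ] E} {S : Set ℝ}
    (hV : ∀ n t x, ‖V n t x‖ ≤ ‖x‖) (hU : ∀ t x, ‖U t x‖ ≤ ‖x‖) {D : Set E} (hD : Dense D)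
    (h : ∀ x ∈ D, TendstoUniformlyOn (fun n t => V n t x) (fun t => U t x) atTop S) (x : E) :
    TendstoUniformlyOn (fun n t => V n t x) (fun t => U t x) atTop S := by
  rw [Metric.tendstoUniformlyOn_iff]
  intro ε hε
  obtain ⟨y, hy, hxy⟩ := Metric.dense_iff.mp hD x (ε / 3) (by positivity)
  filter_upwards [Metric.tendstoUniformlyOn_iff.mp (h y hxy) (ε / 3) (by positivity)] with n hn t ht
  have h1 := hn t ht
  have h2 : ‖U t x - U t y‖ ≤ ‖x - y‖ := by rw [← map_sub]; exact hU _ _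
  have h3 : ‖V n t y - V n t x‖ ≤ ‖x - y‖ := by rw [← map_sub, norm_sub_rev x]; exact hV _ _ _
  rw [Metric.mem_ball, dist_comm, dist_eq_norm] at hy
  rw [dist_eq_norm] at h1 ⊢
  calc ‖U t x - V n t x‖ = ‖(U t x - U t y) + (U t y - V n t y) + (V n t y - V n t x)‖ := by
        congr 1; abel
    _ ≤ _ := norm_add₃_le
    _ < ε := by linarith

/-! #### Groups generated by bounded operators -/

theorem hasDerivAt_exp_smul_apply (X : E →L[ℂ] E) (x : E) (t : ℝ) :
    HasDerivAt (fun t : ℝ => NormedSpace.exp (t • X) x) (NormedSpace.exp (t • X) (X x)) t := by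
  have h := hasDerivAt_exp_smul_const (𝕂 := ℝ) X t
  exact (((ContinuousLinearMap.apply ℂ E x).restrictScalars ℝ).hasFDerivAt.comp_hasDerivAt t h)

theorem norm_exp_smul_apply {X : E →L[ℂ] E} (hX : star X = -X) (t : ℝ) (x : E) :
    ‖NormedSpace.exp (t • X) x‖ = ‖x‖ := by
  let _ : NormedAlgebra ℚ (E →L[ℂ] E) := NormedAlgebra.restrictScalars ℚ ℂ _
  have h : star (NormedSpace.exp (t • X)) * NormedSpace.exp (t • X) = 1 := by
    have : NormedSpace.exp (t • X) ∈ unitary (E →L[ℂ] E) :=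
      NormedSpace.exp_mem_unitary_of_mem_skewAdjoint (by
        rw [skewAdjoint.mem_iff, star_smul, hX]; simp)
    exact (Unitary.mem_iff.mp this).1
  rw [ContinuousLinearMap.star_eq_adjoint] at h
  exact (ContinuousLinearMap.norm_map_iff_adjoint_comp_self _).mpr h x

theorem norm_exp_smul_apply_sub_le {X : E →L[ℂ] E} (hX : star X = -X) (t : ℝ) (x : E) :
    ‖NormedSpace.exp (t • X) x - x‖ ≤ ‖X x‖ * |t| := by
  have := (convex_univ (𝕜 := ℝ) (E := ℝ)).norm_image_sub_le_of_norm_hasDerivWithin_le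
    (f := fun t : ℝ => NormedSpace.exp (t • X) x) (C := ‖X x‖) (x := 0) (y := t)
    (fun t _ => (hasDerivAt_exp_smul_apply X x t).hasDerivWithinAt)
    (fun t _ => (norm_exp_smul_apply hX t (X x)).le) trivial trivial
  simpa using this

/-- Commuting generators let the factor `exp(tY)` be split off; it is an isometry, so only the
distance of `exp(t(X - Y)) x` from `x` remains. This makes convergence of generators on a vector
imply convergence of the groups. -/
theorem norm_exp_smul_apply_sub_exp_le {X Y : E →L[ℂ] E} (hX : star X = -X) (hY : star Y = -Y)
    (hXY : Commute X Y) (t : ℝ) (x : E) :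
    ‖NormedSpace.exp (t • X) x - NormedSpace.exp (t • Y) x‖ ≤ ‖X x - Y x‖ * |t| := by
  have h : NormedSpace.exp (t • X) = NormedSpace.exp (t • Y) * NormedSpace.exp (t • (X - Y)) := by
    let _ : NormedAlgebra ℚ (E →L[ℂ] E) := NormedAlgebra.restrictScalars ℚ ℂ _
    rw [← NormedSpace.exp_add_of_commute]
    · congr 1; rw [smul_sub]; abel
    · exact (((hXY.symm.sub_right (Commute.refl Y)).smul_left t).smul_right t)
  rw [h, mul_apply_eq_comp, ← map_sub, norm_exp_smul_apply hY]
  refine (norm_exp_smul_apply_sub_le ?_ t x).trans (le_of_eq ?_)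
  · rw [star_sub, hX, hY]; abel
  · simp

/-- **Stone's theorem**, existence part: a densely defined symmetric operator `A` for which
`A - iμ` is surjective for all large real `|μ|` generates a unitary group. -/
theorem exists_isUnitaryGroupOf {A : E →ₗ.[ℂ] E} (hd : Dense (A.domain : Set E))
    (hs : ∀ x y : A.domain, ⟪A x, (y : E)⟫_ℂ = ⟪(x : E), A y⟫_ℂ) {M : ℝ} (hM : 0 < M)
    (hr : ∀ μ : ℝ, M ≤ |μ| → ∀ z : E, ∃ x : A.domain, A x - (Complex.I * μ) • (x : E) = z) :
    ∃ U, IsUnitaryGroupOf A U := by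
  have hμ0 : ∀ μ : ℝ, M ≤ |μ| → μ ≠ 0 := fun μ h => abs_pos.mp (hM.trans_le h)
  have hR : ∀ μ : ℝ, ∃ R : E →L[ℂ] E, M ≤ |μ| →
      (∀ z, ∃ h : R z ∈ A.domain, A ⟨R z, h⟩ - (Complex.I * μ) • R z = z) ∧
      (∀ x : A.domain, R (A x - (Complex.I * μ) • (x : E)) = x) ∧ ∀ z, ‖R z‖ ≤ |μ|⁻¹ * ‖z‖ := by
    intro μ
    by_cases h : M ≤ |μ|
    · obtain ⟨R, hR⟩ := exists_resolvent hs μ (hμ0 μ h) (hr μ h)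
      exact ⟨R, fun _ => hR⟩
    · exact ⟨0, fun h' => absurd h' h⟩
  choose R hR using hR
  have hstar : ∀ μ, M ≤ |μ| → star (R μ) = R (-μ) := by
    intro μ h
    have h' : M ≤ |-μ| := by rwa [abs_neg]
    symm
    rw [ContinuousLinearMap.star_eq_adjoint, ContinuousLinearMap.eq_adjoint_iff]
    intro y x
    obtain ⟨hu, hu'⟩ := (hR μ h).1 x
    obtain ⟨hv, hv'⟩ := (hR (-μ) h').1 y
    have key := hs ⟨_, hv⟩ ⟨_, hu⟩
    conv_lhs => rw [← hu']
    conv_rhs => rw [← hv']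
    rw [inner_sub_left, inner_sub_right, key, inner_smul_left, inner_smul_right]
    simp
  -- The resolvent identity is antisymmetric in `μ` and `ν`; comparing it with its swapped form
  -- gives commutation.
  have hcomm : ∀ μ ν, M ≤ |μ| → M ≤ |ν| → Commute (R μ) (R ν) := by
    have key : ∀ μ ν, M ≤ |μ| → M ≤ |ν| → R μ - R ν = (Complex.I * (μ - ν)) • (R μ * R ν) := by
      intro μ ν h h'
      ext z
      obtain ⟨hv, hv'⟩ := (hR ν h').1 z
      have h1 := (hR μ h).2.1 ⟨_, hv⟩
      have h2 : A ⟨R ν z, hv⟩ - (Complex.I * μ) • R ν z = z - (Complex.I * (μ - ν)) • R ν z := by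
        conv_rhs => enter [1]; rw [← hv']
        rw [sub_sub, ← add_smul]; congr 2; ring
      rw [h2, map_sub, map_smul] at h1
      simp only [sub_apply, smul_apply, mul_apply_eq_comp]
      rw [sub_eq_iff_eq_add] at h1 ⊢
      rw [h1, add_comm]
    intro μ ν h h'
    rcases eq_or_ne μ ν with rfl | hne
    · exact Commute.refl _
    have hc : Complex.I * ((μ : ℂ) - ν) ≠ 0 :=
      mul_ne_zero Complex.I_ne_zero (sub_ne_zero.mpr (by exact_mod_cast hne))
    have h1 := key μ ν h h'
    have h2 := key ν μ h' h
    have h3 : (Complex.I * ((μ : ℂ) - ν)) • (R μ * R ν) = (Complex.I * ((μ : ℂ) - ν)) • (R ν * R μ) := by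
      rw [← h1, ← neg_sub, h2, ← neg_smul]; congr 1; ring
    exact smul_right_injective _ hc h3
  -- The operators `-iν R(ν)` are contractions, and on the domain their defect `z + iν R(ν) z = R(ν)
  -- A z` is at most `‖A z‖ / |ν|`. The auxiliary parameter of the uniform lemma is a dummy here.
  have hJ : ∀ ν : ℕ → ℝ, (∀ n, M ≤ |ν n|) → Tendsto (fun n => |ν n|) atTop atTop → ∀ z : E,
      Tendsto (fun n => (-(Complex.I * ν n)) • R (ν n) z) atTop (𝓝 z) := by
    intro ν hν hν' z
    have := tendstoUniformlyOn_of_dense (V := fun n _ => (-(Complex.I * ν n)) • R (ν n))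
      (U := fun _ => 1) (S := Set.univ) (D := A.domain) ?_ (fun _ _ => le_rfl) hd ?_ z
    · exact this.tendsto_at (Set.mem_univ 0)
    · intro n _ z
      have h0 : |ν n| ≠ 0 := (hM.trans_le (hν n)).ne'
      rw [smul_apply, norm_smul]
      calc ‖-(Complex.I * (ν n : ℂ))‖ * ‖R (ν n) z‖ ≤ |ν n| * (|ν n|⁻¹ * ‖z‖) := by
            rw [norm_neg, norm_mul, Complex.norm_I, one_mul, Complex.norm_real, Real.norm_eq_abs]
            gcongr
            exact (hR _ (hν n)).2.2 z
        _ = ‖z‖ := by field_simp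
    · intro x hx
      have h1 : Tendsto (fun n => |ν n|⁻¹ * ‖A ⟨x, hx⟩‖) atTop (𝓝 0) := by
        simpa using (tendsto_inv_atTop_zero.comp hν').mul_const ‖A ⟨x, hx⟩‖
      rw [Metric.tendstoUniformlyOn_iff]
      intro ε hε
      filter_upwards [h1.eventually (gt_mem_nhds hε)] with n hn _ _
      refine lt_of_le_of_lt ?_ hn
      have h2 := (hR _ (hν n)).2.1 ⟨x, hx⟩
      rw [map_sub, map_smul] at h2
      have h3 : R (ν n) (A ⟨x, hx⟩) = x - (-(Complex.I * ν n)) • R (ν n) x := by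
        rw [neg_smul, sub_neg_eq_add, ← sub_eq_iff_eq_add]; exact h2
      rw [dist_eq_norm]
      change ‖x - (-(Complex.I * ν n)) • R (ν n) x‖ ≤ _
      rw [← h3]
      exact (hR _ (hν n)).2.2 _
  set μ : ℕ → ℝ := fun n => M + n with hμ
  have hμM : ∀ n, M ≤ |μ n| := fun n => (le_add_of_nonneg_right n.cast_nonneg).trans (le_abs_self _)
  have hμM' : ∀ n, M ≤ |-μ n| := fun n => by rw [abs_neg]; exact hμM n
  have hμt : Tendsto (fun n => |μ n|) atTop atTop :=
    tendsto_abs_atTop_atTop.comp (tendsto_atTop_add_const_left _ _ tendsto_natCast_atTop_atTop)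
  -- This is `i` times the mean of the Yosida approximations of `A` at `μ` and `-μ`. A single
  -- approximation would not be self-adjoint; in the mean, the adjoint exchanges the two resolvents.
  set X : ℕ → E →L[ℂ] E := fun n => (Complex.I * ((μ n : ℂ) ^ 2 / 2)) • (R (μ n) + R (-μ n)) with hX
  have hXs : ∀ n, star (X n) = -X n := by
    intro n
    rw [hX]
    simp only [star_smul, star_add]
    rw [hstar _ (hμM n), hstar _ (hμM' n), neg_neg, add_comm (R (-μ n)), ← neg_smul]
    congr 1
    simp
  have hXc : ∀ n m, Commute (X n) (X m) := fun n m =>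
    ((((hcomm _ _ (hμM n) (hμM m)).add_right (hcomm _ _ (hμM n) (hμM' m))).add_left
      ((hcomm _ _ (hμM' n) (hμM m)).add_right (hcomm _ _ (hμM' n) (hμM' m)))).smul_left _).smul_right _
  have hXt : ∀ x : A.domain, Tendsto (fun n => X n x) atTop (𝓝 (Complex.I • A x)) := by
    intro x
    have h1 := hJ μ hμM hμt (A x)
    have h2 := hJ (fun n => -μ n) hμM' (by simpa using hμt) (A x)
    have h3 := (h1.add h2).const_smul (Complex.I * (1 / 2))
    have e : (Complex.I * (1 / 2)) • (A x + A x) = Complex.I • A x := by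
      rw [← two_smul ℂ, smul_smul]; congr 1; ring
    rw [e] at h3
    refine h3.congr fun n => ?_
    have k1 := (hR _ (hμM n)).2.1 x
    have k2 := (hR _ (hμM' n)).2.1 x
    rw [map_sub, map_smul, sub_eq_iff_eq_add] at k1 k2
    simp only [hX, smul_apply, add_apply]
    rw [k1, k2]
    push_cast
    simp only [smul_add, smul_smul]
    have e1 : Complex.I * (1 / 2) * (-(Complex.I * (μ n : ℂ)) * (Complex.I * (μ n : ℂ))) =
        Complex.I * ((μ n : ℂ) ^ 2 / 2) := by
      linear_combination (-(Complex.I * (μ n : ℂ) ^ 2) / 2) * Complex.I_mul_I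
    have e2 : Complex.I * (1 / 2) * (-(Complex.I * -(μ n : ℂ)) * (Complex.I * -(μ n : ℂ))) =
        Complex.I * ((μ n : ℂ) ^ 2 / 2) := by
      linear_combination (-(Complex.I * (μ n : ℂ) ^ 2) / 2) * Complex.I_mul_I
    rw [e1, e2]
    have e3 : Complex.I * (1 / 2) * -(Complex.I * -(μ n : ℂ)) =
        -(Complex.I * (1 / 2) * -(Complex.I * (μ n : ℂ))) := by ring
    rw [e3, neg_smul]
    abel
  set V : ℕ → ℝ → E →L[ℂ] E := fun n t => NormedSpace.exp (t • X n) with hV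
  have hVn : ∀ n t x, ‖V n t x‖ = ‖x‖ := fun n t x => norm_exp_smul_apply (hXs n) t x
  have hVd : ∀ n m t x, ‖V n t x - V m t x‖ ≤ ‖X n x - X m x‖ * |t| := fun n m t x =>
    norm_exp_smul_apply_sub_exp_le (hXs n) (hXs m) (hXc n m) t x
  have hVlim : ∀ t x, ∃ y, Tendsto (fun n => V n t x) atTop (𝓝 y) := by
    intro t x
    refine exists_tendsto_of_dense (fun n x => (hVn n t x).le) hd (fun x hx => ?_) x
    have h1 := ((hXt ⟨x, hx⟩).const_smul (|t|)).cauchySeq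
    rw [Metric.cauchySeq_iff] at h1 ⊢
    intro ε hε
    obtain ⟨N, hN⟩ := h1 ε hε
    refine ⟨N, fun m hm n hn => lt_of_le_of_lt ?_ (hN m hm n hn)⟩
    rw [dist_eq_norm, dist_eq_norm, ← smul_sub, norm_smul, Real.norm_eq_abs, abs_abs, mul_comm]
    exact hVd m n t x
  choose u hu using hVlim
  set U : ℝ → E →L[ℂ] E := fun t =>
    continuousLinearMapOfTendsto (V · t) (f := u t) (tendsto_pi_nhds.mpr (hu t)) with hUdef
  have hU : ∀ t x, Tendsto (fun n => V n t x) atTop (𝓝 (U t x)) := hu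
  have hUn : ∀ t x, ‖U t x‖ = ‖x‖ := fun t x =>
    tendsto_nhds_unique (hU t x).norm (by simp only [hVn]; exact tendsto_const_nhds)
  have hU0 : U 0 = 1 := by
    ext x
    refine tendsto_nhds_unique (hU 0 x) ?_
    simp [hV, NormedSpace.exp_zero]
  have hUadd : ∀ s t, U (s + t) = U s * U t := by
    intro s t
    ext x
    refine tendsto_nhds_unique (hU _ x) ?_
    have h1 : ∀ n, V n (s + t) x = V n s (V n t x - U t x) + V n s (U t x) := by
      intro n
      let _ : NormedAlgebra ℚ (E →L[ℂ] E) := NormedAlgebra.restrictScalars ℚ ℂ _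
      rw [map_sub, sub_add_cancel]
      have : V n (s + t) = V n s * V n t := by
        rw [hV]
        simp only [add_smul]
        exact NormedSpace.exp_add_of_commute (((Commute.refl _).smul_left s).smul_right t)
      rw [this]; rfl
    simp only [h1]
    have h2 : Tendsto (fun n => V n s (V n t x - U t x)) atTop (𝓝 0) := by
      rw [tendsto_zero_iff_norm_tendsto_zero]
      simp only [hVn]
      exact tendsto_iff_norm_sub_tendsto_zero.mp (hU t x)
    simpa using h2.add (hU s (U t x))
  have hUunif : ∀ x, TendstoUniformlyOn (fun n t => V n t x) (fun t => U t x) atTop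
      (Metric.ball (0 : ℝ) 1) := by
    refine tendstoUniformlyOn_of_dense (fun n t x => (hVn n t x).le) (fun t x => (hUn t x).le) hd ?_
    intro x hx
    rw [Metric.tendstoUniformlyOn_iff]
    intro ε hε
    have h1 := tendsto_iff_norm_sub_tendsto_zero.mp (hXt ⟨x, hx⟩)
    filter_upwards [h1.eventually (gt_mem_nhds hε)] with n hn t ht
    refine lt_of_le_of_lt ?_ hn
    rw [dist_comm, dist_eq_norm]
    -- Letting `m → ∞` in the Cauchy estimate `hVd` yields a rate independent of `t`, since `|t| ≤
    -- 1` on the ball.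
    refine le_of_tendsto_of_tendsto ((hU t x).const_sub (V n t x)).norm
      (((hXt ⟨x, hx⟩).const_sub (X n x)).norm) (Eventually.of_forall fun m => ?_)
    refine (hVd n m t x).trans (mul_le_of_le_one_right (norm_nonneg _) ?_)
    rw [Metric.mem_ball, dist_zero_right, Real.norm_eq_abs] at ht
    exact ht.le
  have hUd : ∀ x : A.domain, HasDerivAt (fun t => U t x) (Complex.I • A x) 0 := by
    intro x
    have h := hasDerivAt_of_tendstoLocallyUniformlyOn (f := fun n t => V n t x)
      (f' := fun n t => V n t (X n x)) (g' := fun t => U t (Complex.I • A x)) (l := atTop) (x := 0)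
      (Metric.isOpen_ball (x := (0 : ℝ)) (ε := 1)) ?_
      (Eventually.of_forall fun n t _ => hasDerivAt_exp_smul_apply (X n) x t)
      (fun t _ => hU t x) (Metric.mem_ball_self one_pos)
    · simpa [hU0] using h
    · refine TendstoUniformlyOn.tendstoLocallyUniformlyOn ?_
      rw [Metric.tendstoUniformlyOn_iff]
      intro ε hε
      have h1 := tendsto_iff_norm_sub_tendsto_zero.mp (hXt x)
      filter_upwards [h1.eventually (gt_mem_nhds (half_pos hε)),
        Metric.tendstoUniformlyOn_iff.mp (hUunif (Complex.I • A x)) _ (half_pos hε)] with n h1 h2 t ht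
      have h3 := h2 t ht
      refine (dist_triangle _ _ _).trans_lt ((add_lt_add_of_lt_of_le h3 ?_).trans_eq (add_halves ε))
      rw [dist_comm, dist_eq_norm, ← map_sub, hVn]
      exact h1.le
  have hUc : ∀ x, Continuous fun t => U t x := by
    intro x
    have h0 : ContinuousAt (fun t => U t x) 0 := by
      refine ((hUunif x).continuousOn (Frequently.of_forall fun n => ?_)).continuousAt
        (Metric.ball_mem_nhds _ one_pos)
      exact fun t _ => (hasDerivAt_exp_smul_apply (X n) x t).continuousAt.continuousWithinAt
    rw [continuous_iff_continuousAt]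
    intro t
    have h1 : (fun s => U s x) = fun s => U t (U (s - t) x) := by
      funext s
      rw [← mul_apply_eq_comp, ← hUadd]; congr 2; ring
    rw [h1]
    refine (U t).continuous.continuousAt.comp ?_
    refine ContinuousAt.comp (g := fun t => U t x) (f := fun s => s - t) (x := t) ?_ (by fun_prop)
    simpa using h0
  have hUneg : ∀ t, U t * U (-t) = 1 := fun t => by rw [← hUadd, add_neg_cancel, hU0]
  have hUun : ∀ t, star (U t) * U t = 1 := fun t => by
    rw [ContinuousLinearMap.star_eq_adjoint]
    exact (ContinuousLinearMap.norm_map_iff_adjoint_comp_self _).mp (hUn t)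
  refine ⟨U, hU0, hUadd, fun t => ?_, hUc, fun x y => ⟨fun h => ?_, fun h => ?_⟩⟩
  · rw [Unitary.mem_iff]
    refine ⟨hUun t, ?_⟩
    have h1 : star (U t) = U (-t) := by
      calc star (U t) = star (U t) * (U t * U (-t)) := by rw [hUneg, mul_one]
        _ = U (-t) := by rw [← mul_assoc, hUun, one_mul]
    rw [h1, hUneg]
  -- The vector `x₀` of the domain is chosen so that `U t (x - x₀)` has derivative `-M (x - x₀)` at
  -- `0`. Since its norm is constant and `M > 0`, this forces `x = x₀`: the generator is no larger
  -- than `iA`.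
  · obtain ⟨x₀, hx₀⟩ := hr M (le_abs_self M) (y - (Complex.I * M) • x)
    have h1 : HasDerivAt (fun t => U t (x - x₀)) (Complex.I • y - Complex.I • A x₀) 0 := by
      simp only [map_sub]
      exact h.sub (hUd x₀)
    have h2 : Complex.I • y - Complex.I • A x₀ = (-(M : ℂ)) • (x - x₀) := by
      have : y - A x₀ = (Complex.I * M) • (x - x₀) := by
        rw [smul_sub, sub_eq_sub_iff_sub_eq_sub, ← hx₀]
      rw [← smul_sub, this, smul_smul, ← mul_assoc, Complex.I_mul_I]; simp
    rw [h2] at h1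
    have h3 : HasDerivAt (fun t => ⟪U t (x - x₀), U t (x - x₀)⟫_ℂ)
        (⟪x - x₀, (-(M : ℂ)) • (x - x₀)⟫_ℂ + ⟪(-(M : ℂ)) • (x - x₀), x - x₀⟫_ℂ) 0 := by
      have := h1.inner ℂ h1
      simp only [hU0, one_apply_eq_self] at this
      exact this
    have h4 : (fun t => ⟪U t (x - x₀), U t (x - x₀)⟫_ℂ) = fun _ => ⟪x - x₀, x - x₀⟫_ℂ := by
      funext t
      rw [inner_self_eq_norm_sq_to_K, inner_self_eq_norm_sq_to_K, hUn]
    rw [h4] at h3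
    have h5 := h3.unique (hasDerivAt_const _ _)
    rw [inner_smul_left, inner_smul_right] at h5
    have h6 : ⟪x - (x₀ : E), x - x₀⟫_ℂ = 0 := by
      have : (2 * (M : ℂ)) * ⟪x - (x₀ : E), x - x₀⟫_ℂ = 0 := by
        simp only [map_neg, Complex.conj_ofReal] at h5
        linear_combination -h5
      refine (mul_eq_zero.mp this).resolve_left ?_
      exact mul_ne_zero two_ne_zero (by exact_mod_cast hM.ne')
    have h7 : x = x₀ := sub_eq_zero.mp (inner_self_eq_zero.mp h6)
    subst h7
    have h8 : A x₀ = y := sub_left_injective hx₀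
    rw [← h8]
    exact A.mem_graph x₀
  · obtain ⟨z, rfl, rfl⟩ := (LinearPMap.mem_graph_iff A).mp h
    exact hUd z

end Stone
end
end QuantumHierarchy

namespace QuantumHierarchy
open scoped ComplexOrder InnerProductSpace ComplexConjugate
open Filter Topology
noncomputable section

/-! ### Functoriality of tensor powers and of `b ⊗ 𝟙`. -/

section Tensor
variable {κ ι H : Type*} [Fintype κ] [Fintype ι] [NormedAddCommGroup H] [InnerProductSpace ℂ H]

theorem clm_ext_pureTensor {F : Type*} [NormedAddCommGroup F] [NormedSpace ℂ F]
    {S T : TensorPow ι H →L[ℂ] F} (h : ∀ x, S (pureTensor x) = T (pureTensor x)) : S = T :=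
  ContinuousLinearMap.ext_on dense_span_pureTensor (by rintro _ ⟨x, rfl⟩; exact h x)

theorem norm_pureTensor (x : ι → H) : ‖(pureTensor x : TensorPow ι H)‖ = ∏ i, ‖x i‖ := by
  have h : ((‖(pureTensor x : TensorPow ι H)‖ : ℂ)) ^ 2 = (((∏ i, ‖x i‖ : ℝ)) : ℂ) ^ 2 := by
    have h1 := inner_pureTensor x x
    simp only [inner_self_eq_norm_sq_to_K, Finset.prod_pow] at h1
    push_cast
    exact h1
  have h2 : ‖(pureTensor x : TensorPow ι H)‖ ^ 2 = (∏ i, ‖x i‖) ^ 2 := by exact_mod_cast h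
  exact (sq_eq_sq₀ (norm_nonneg _) (Finset.prod_nonneg fun _ _ => norm_nonneg _)).mp h2

theorem inner_pureTensor_update [DecidableEq ι] (x y : ι → H) (i : ι) (a : H) :
    ⟪(pureTensor (Function.update x i a) : TensorPow ι H), pureTensor y⟫_ℂ =
      ⟪a, y i⟫_ℂ * ∏ j ∈ Finset.univ \ {i}, ⟪x j, y j⟫_ℂ := by
  rw [inner_pureTensor, ← Finset.prod_update_of_mem (Finset.mem_univ i)]
  refine Finset.prod_congr rfl fun j _ => ?_
  rcases eq_or_ne j i with rfl | h <;> simp [*]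

/-- `pureTensor` as a continuous multilinear map. -/
def pureTensorM (ι H : Type*) [Fintype ι] [NormedAddCommGroup H] [InnerProductSpace ℂ H] :
    ContinuousMultilinearMap ℂ (fun _ : ι => H) (TensorPow ι H) :=
  MultilinearMap.mkContinuous
    { toFun := pureTensor
      map_update_add' := by
        intro _ x i a b
        refine eq_of_inner_pureTensor fun y => ?_
        rw [inner_add_left]
        simp only [inner_pureTensor_update, inner_add_left, add_mul]
      map_update_smul' := by
        intro _ x i c a
        refine eq_of_inner_pureTensor fun y => ?_
        rw [inner_smul_left]
        simp only [inner_pureTensor_update, inner_smul_left, mul_assoc] } 1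
    (fun x => by rw [one_mul]; exact (norm_pureTensor x).le)

@[simp] theorem pureTensorM_apply (x : ι → H) : pureTensorM ι H x = pureTensor x := rfl

theorem continuous_pureTensor : Continuous (pureTensor : (ι → H) → TensorPow ι H) :=
  (pureTensorM ι H).cont

theorem extend_comp_self (e : κ ↪ ι) (y : ι → H) : Function.extend e (y ∘ e) y = y := by
  ext i
  by_cases hi : ∃ k, e k = i
  · obtain ⟨k, rfl⟩ := hi; simp [e.injective.extend_apply]
  · rw [Function.extend_apply' _ _ _ hi]

theorem insertVec_comp_self (e : κ ↪ ι) (y : ι → H) :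
    insertVec e y (pureTensor (y ∘ e)) = pureTensor y := by
  rw [insertVec_pureTensor, extend_comp_self]

theorem ampl_pureTensor (e : κ ↪ ι) (b : TensorPow κ H →L[ℂ] TensorPow κ H) (y : ι → H) :
    ampl e b (pureTensor y) = insertVec e y (b (pureTensor (y ∘ e))) := by
  rw [← ampl_insertVec, insertVec_comp_self]

theorem ampl_one (e : κ ↪ ι) : ampl e (1 : TensorPow κ H →L[ℂ] TensorPow κ H) = 1 :=
  (ampl_unique e 1 1 fun _ _ => rfl).symm

theorem ampl_mul (e : κ ↪ ι) (a b : TensorPow κ H →L[ℂ] TensorPow κ H) :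
    ampl e (a * b) = ampl e a * ampl e b :=
  (ampl_unique e _ _ fun z v => by
    rw [mul_apply_eq_comp, ampl_insertVec, ampl_insertVec, mul_apply_eq_comp]).symm

theorem ampl_star (e : κ ↪ ι) (b : TensorPow κ H →L[ℂ] TensorPow κ H) :
    ampl e (star b) = star (ampl e b) := by
  refine clm_ext_pureTensor fun x => eq_of_inner_pureTensor fun y => ?_
  rw [ContinuousLinearMap.star_eq_adjoint, ContinuousLinearMap.star_eq_adjoint,
    ContinuousLinearMap.adjoint_inner_left, ampl_pureTensor, ampl_pureTensor]
  conv_lhs => rw [← insertVec_comp_self e y]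
  conv_rhs => rw [← insertVec_comp_self e x]
  rw [inner_insertVec, inner_insertVec, ContinuousLinearMap.adjoint_inner_left]

/-- `ampl e` as a homomorphism of C⋆-algebras. -/
def amplHom (e : κ ↪ ι) :
    (TensorPow κ H →L[ℂ] TensorPow κ H) →⋆ₐ[ℂ] (TensorPow ι H →L[ℂ] TensorPow ι H) where
  toFun := ampl e
  map_one' := ampl_one e
  map_mul' := ampl_mul e
  map_zero' := (ampl_unique e 0 0 fun _ _ => by simp).symm
  map_add' a b := (ampl_unique e _ _ fun z v => by
    rw [add_apply, ampl_insertVec, ampl_insertVec, add_apply, map_add]).symm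
  commutes' c := (ampl_unique e _ _ fun z v => by
    simp [Algebra.algebraMap_eq_smul_one]).symm
  map_star' := ampl_star e

theorem norm_ampl_le (e : κ ↪ ι) (b : TensorPow κ H →L[ℂ] TensorPow κ H) : ‖ampl e b‖ ≤ ‖b‖ :=
  NonUnitalStarAlgHom.norm_apply_le (amplHom e) b

theorem ampl_zero (e : κ ↪ ι) : ampl e (0 : TensorPow κ H →L[ℂ] TensorPow κ H) = 0 :=
  map_zero (amplHom e)

theorem ampl_smul (e : κ ↪ ι) (c : ℂ) (b : TensorPow κ H →L[ℂ] TensorPow κ H) :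
    ampl e (c • b) = c • ampl e b := map_smul (amplHom e) c b

theorem ampl_sum {α : Type*} (e : κ ↪ ι) (t : Finset α) (b : α → TensorPow κ H →L[ℂ] TensorPow κ H) :
    ampl e (∑ i ∈ t, b i) = ∑ i ∈ t, ampl e (b i) := map_sum (amplHom e) b t

variable {l : Type*} [Fintype l]

theorem extend_extend (f : l ↪ κ) (e : κ ↪ ι) (z : ι → H) (x : l → H) :
    Function.extend e (Function.extend f x (z ∘ e)) z = Function.extend (f.trans e) x z := by
  ext i
  by_cases hi : ∃ k, e k = i
  · obtain ⟨k, rfl⟩ := hi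
    rw [e.injective.extend_apply]
    by_cases hk : ∃ j, f j = k
    · obtain ⟨j, rfl⟩ := hk
      rw [f.injective.extend_apply]
      exact ((f.trans e).injective.extend_apply x z j).symm
    · rw [Function.extend_apply' _ _ _ hk, Function.extend_apply']
      · rfl
      · rintro ⟨j, hj⟩
        exact hk ⟨j, e.injective hj⟩
  · rw [Function.extend_apply' _ _ _ hi, Function.extend_apply']
    rintro ⟨j, rfl⟩
    exact hi ⟨f j, rfl⟩

theorem insertVec_insertVec (f : l ↪ κ) (e : κ ↪ ι) (z : ι → H) (v : TensorPow l H) :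
    insertVec e z (insertVec f (z ∘ e) v) = insertVec (f.trans e) z v := by
  have : insertVec e z ∘L insertVec f (z ∘ e) = insertVec (f.trans e) z :=
    clm_ext_pureTensor fun x => by
      rw [ContinuousLinearMap.comp_apply, insertVec_pureTensor, insertVec_pureTensor,
        insertVec_pureTensor, extend_extend]
  exact DFunLike.congr_fun this v

theorem ampl_ampl (f : l ↪ κ) (e : κ ↪ ι) (b : TensorPow l H →L[ℂ] TensorPow l H) :
    ampl e (ampl f b) = ampl (f.trans e) b :=
  ampl_unique _ _ _ fun z v => by
    rw [← insertVec_insertVec, ampl_insertVec, ampl_insertVec, insertVec_insertVec]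

theorem ampl_refl (b : TensorPow ι H →L[ℂ] TensorPow ι H) : ampl (Function.Embedding.refl ι) b = b := by
  refine (ampl_unique _ _ _ fun z v => ?_).symm
  have : (insertVec (Function.Embedding.refl ι) z : TensorPow ι H →L[ℂ] TensorPow ι H) = 1 :=
    clm_ext_pureTensor fun x => by
      rw [insertVec_pureTensor]
      congr 1
      ext i
      exact (Function.Embedding.refl ι).injective.extend_apply x z i
  rw [this]; rfl

open Classical in
-- The inner product factorises over three groups of labels: those of `e`, those of `f`, and the
-- rest. At the labels of `e` the right vector has its background `y`, and at those of `f` the left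
-- vector has its background `y'`. Density of product vectors extends this from pure `v` and `w`,
-- one argument at a time.
theorem inner_insertVec_of_disjoint (e : κ ↪ ι) (f : l ↪ ι) (hef : ∀ k j, e k ≠ f j)
    (y' y : ι → H) (v : TensorPow κ H) (w : TensorPow l H) :
    ⟪insertVec e y' v, insertVec f y w⟫_ℂ =
      (∏ i ∈ Finset.univ.filter (fun i => i ∉ Set.range e ∧ i ∉ Set.range f), ⟪y' i, y i⟫_ℂ) *
        ⟪v, pureTensor (y ∘ e)⟫_ℂ * ⟪pureTensor (y' ∘ f), w⟫_ℂ := by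
  set c := ∏ i ∈ Finset.univ.filter (fun i => i ∉ Set.range e ∧ i ∉ Set.range f), ⟪y' i, y i⟫_ℂ
  have h1 : ∀ (x : κ → H) (w : TensorPow l H),
      ⟪insertVec e y' (pureTensor x), insertVec f y w⟫_ℂ =
        c * ⟪pureTensor x, pureTensor (y ∘ e)⟫_ℂ * ⟪pureTensor (y' ∘ f), w⟫_ℂ := by
    intro x w
    have : (innerSL ℂ (insertVec e y' (pureTensor x))) ∘L insertVec f y =
        (c * ⟪pureTensor x, pureTensor (y ∘ e)⟫_ℂ) • innerSL ℂ (pureTensor (y' ∘ f)) := by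
      refine clm_ext_pureTensor fun u => ?_
      simp only [ContinuousLinearMap.comp_apply, innerSL_apply_apply, smul_apply,
        insertVec_pureTensor, inner_pureTensor, smul_eq_mul]
      rw [← Finset.prod_filter_mul_prod_filter_not Finset.univ (fun i => i ∈ Set.range e),
        ← Finset.prod_filter_mul_prod_filter_not
          (Finset.univ.filter fun i => i ∉ Set.range e) (fun i => i ∈ Set.range f)]
      have e1 : ∏ i ∈ Finset.univ.filter (fun i => i ∈ Set.range e),
          ⟪Function.extend e x y' i, Function.extend f u y i⟫_ℂ = ∏ k, ⟪x k, (y ∘ e) k⟫_ℂ := by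
        have : Finset.univ.filter (fun i => i ∈ Set.range e) = Finset.univ.map e := by
          ext; simp
        rw [this, Finset.prod_map]
        refine Finset.prod_congr rfl fun k _ => ?_
        rw [e.injective.extend_apply, Function.extend_apply' _ _ _ (by
          rintro ⟨j, hj⟩; exact hef k j hj.symm)]
        rfl
      have e2 : ∏ i ∈ (Finset.univ.filter fun i => i ∉ Set.range e).filter (fun i => i ∈ Set.range f),
          ⟪Function.extend e x y' i, Function.extend f u y i⟫_ℂ = ∏ k, ⟪(y' ∘ f) k, u k⟫_ℂ := by
        have : (Finset.univ.filter fun i => i ∉ Set.range e).filter (fun i => i ∈ Set.range f) =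
            Finset.univ.map f := by
          ext i
          simp only [Finset.mem_filter, Finset.mem_univ, true_and, Set.mem_range, Finset.mem_map]
          constructor
          · exact fun h => h.2
          · rintro ⟨j, rfl⟩
            exact ⟨by rintro ⟨k, hk⟩; exact hef k j hk, j, rfl⟩
        rw [this, Finset.prod_map]
        refine Finset.prod_congr rfl fun k _ => ?_
        rw [f.injective.extend_apply, Function.extend_apply' _ _ _ (by
          rintro ⟨j, hj⟩; exact hef j k hj)]
        rfl
      have e3 : ∏ i ∈ (Finset.univ.filter fun i => i ∉ Set.range e).filter (fun i => ¬ i ∈ Set.range f),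
          ⟪Function.extend e x y' i, Function.extend f u y i⟫_ℂ = c := by
        rw [Finset.filter_filter]
        refine Finset.prod_congr rfl fun i hi => ?_
        rw [Finset.mem_filter] at hi
        rw [Function.extend_apply' _ _ _ hi.2.1, Function.extend_apply' _ _ _ hi.2.2]
      rw [e1, e2, e3]
      ring
    simpa using DFunLike.congr_fun this w
  have : (innerSL ℂ (insertVec f y w)) ∘L insertVec e y' =
      conj (c * ⟪pureTensor (y' ∘ f), w⟫_ℂ) • innerSL ℂ (pureTensor (y ∘ e)) := by
    refine clm_ext_pureTensor fun x => ?_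
    simp only [ContinuousLinearMap.comp_apply, innerSL_apply_apply, smul_apply, smul_eq_mul]
    rw [← inner_conj_symm, h1, ← inner_conj_symm (pureTensor (y ∘ e)), ← map_mul]
    congr 1; ring
  have h2 := DFunLike.congr_fun this v
  simp only [ContinuousLinearMap.comp_apply, innerSL_apply_apply, smul_apply, smul_eq_mul] at h2
  rw [← inner_conj_symm, h2, map_mul, Complex.conj_conj, inner_conj_symm]
  ring

theorem inner_ampl_mul_ampl (e : κ ↪ ι) (f : l ↪ ι) (a : TensorPow κ H →L[ℂ] TensorPow κ H)
    (b : TensorPow l H →L[ℂ] TensorPow l H) (y' y : ι → H) :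
    ⟪(pureTensor y' : TensorPow ι H), (ampl e a * ampl f b) (pureTensor y)⟫_ℂ =
      ⟪insertVec e y' (star a (pureTensor (y' ∘ e))), insertVec f y (b (pureTensor (y ∘ f)))⟫_ℂ := by
  rw [mul_apply_eq_comp, ← ContinuousLinearMap.adjoint_inner_left,
    ← ContinuousLinearMap.star_eq_adjoint, ← ampl_star, ampl_pureTensor, ampl_pureTensor]

/-- By `inner_insertVec_of_disjoint` the matrix elements between product vectors, in either order,
are the same product of a matrix element of `a`, one of `b` and the overlaps at the other labels. -/
theorem ampl_commute (e : κ ↪ ι) (f : l ↪ ι) (hef : ∀ k j, e k ≠ f j)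
    (a : TensorPow κ H →L[ℂ] TensorPow κ H) (b : TensorPow l H →L[ℂ] TensorPow l H) :
    Commute (ampl e a) (ampl f b) := by
  refine clm_ext_pureTensor fun y => eq_of_inner_pureTensor fun y' => ?_
  rw [← inner_conj_symm, ← inner_conj_symm ((ampl f b * ampl e a) (pureTensor y)),
    inner_ampl_mul_ampl, inner_ampl_mul_ampl, inner_insertVec_of_disjoint e f hef,
    inner_insertVec_of_disjoint f e (fun j k => (hef k j).symm),
    ContinuousLinearMap.star_eq_adjoint, ContinuousLinearMap.star_eq_adjoint,
    ContinuousLinearMap.adjoint_inner_left, ContinuousLinearMap.adjoint_inner_left]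
  rw [mul_right_comm]
  congr 4
  ext i
  simp only [Finset.mem_filter, and_comm]

end Tensor

/-! ### Placing symmetric observables on sets of particles. -/

section Place
variable {H : Type*} [NormedAddCommGroup H] [InnerProductSpace ℂ H]

/-- Two embeddings with the same range differ by a permutation of the source, which the symmetry of
`b` absorbs. -/
theorem ampl_eq_of_range_eq {n : ℕ} {ι : Type*} [Fintype ι] {b : Op n H} (hb : IsSymm b)
    {e e' : Fin n ↪ ι} (h : Set.range e = Set.range e') : ampl e b = ampl e' b := by
  let σ : Equiv.Perm (Fin n) :=
    ((Equiv.ofInjective e' e'.injective).trans (Equiv.setCongr h.symm)).trans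
      (Equiv.ofInjective e e.injective).symm
  have : e' = σ.toEmbedding.trans e := by
    ext k
    have h1 : (Equiv.ofInjective e e.injective) (σ k) = ⟨e' k, h ▸ ⟨k, rfl⟩⟩ := by
      simp [σ]
    exact (congrArg Subtype.val h1).symm
  rw [this, ← ampl_ampl, hb σ]

variable {s : ℕ}

/-- Using a whole sequence `b` instead of one operator allows `X.card` to be replaced by an equal
number without casts. -/
theorem place_eq_ampl {m : ℕ} (X : Finset (Fin s)) (h : X.card = m) (b : Obs H) :
    place X (b X.card) = ampl (X.orderEmbOfFin h).toEmbedding (b m) := by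
  subst h; rfl

theorem place_place (Y : Finset (Fin s)) (X : Finset (Fin Y.card)) (b : Obs H) :
    place Y (place X (b X.card)) =
      place (X.map (Y.orderEmbOfFin rfl).toEmbedding)
        (b (X.map (Y.orderEmbOfFin rfl).toEmbedding).card) := by
  rw [place_eq_ampl (X.map _) (Finset.card_map _), place, place, ampl_ampl]
  congr 1
  have := Finset.orderEmbOfFin_unique' (s := X.map (Y.orderEmbOfFin rfl).toEmbedding)
    (Finset.card_map _) (f := (X.orderEmbOfFin rfl).trans (Y.orderEmbOfFin rfl)) (fun x => by simp)
  rw [← this]; rfl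

theorem place_univ (b : Obs H) :
    place (Finset.univ : Finset (Fin s)) (b (Finset.univ : Finset (Fin s)).card) = b s := by
  rw [place_eq_ampl _ (Finset.card_fin s)]
  have := Finset.orderEmbOfFin_unique' (s := (Finset.univ : Finset (Fin s)))
    (Finset.card_fin s) (f := (OrderIso.refl (Fin s)).toOrderEmbedding) (fun x => by simp)
  rw [← this]
  exact ampl_refl _

/-- The composite embedding need not be increasing, whence the symmetry hypothesis; compare
`place_place`, where both embeddings are increasing. -/
theorem ampl_place {r : ℕ} (e : Fin r ↪ Fin s) (X : Finset (Fin r)) {b : Obs H}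
    (hb : ∀ n, IsSymm (b n)) :
    ampl e (place X (b X.card)) = place (X.map e) (b (X.map e).card) := by
  rw [place_eq_ampl (X.map _) (Finset.card_map _), place, ampl_ampl]
  refine ampl_eq_of_range_eq (hb _) ?_
  rw [Function.Embedding.coe_trans, Set.range_comp]
  simp

theorem place_commute {X Y : Finset (Fin s)} (h : Disjoint X Y) (a : Op X.card H) (b : Op Y.card H) :
    Commute (place X a) (place Y b) := by
  refine ampl_commute _ _ (fun k j hkj => ?_) a b
  have h1 := Finset.orderEmbOfFin_mem X rfl k
  have h2 := Finset.orderEmbOfFin_mem Y rfl j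
  change X.orderEmbOfFin rfl k = Y.orderEmbOfFin rfl j at hkj
  rw [hkj] at h1
  exact Finset.disjoint_left.mp h h1 h2

end Place
end
end QuantumHierarchy

namespace QuantumHierarchy
open scoped ComplexOrder InnerProductSpace ComplexConjugate
open Filter Topology
noncomputable section

/-! ### Symmetric graphs, closed ranges and bounded perturbations. -/

section Graphs
variable {E : Type*} [NormedAddCommGroup E] [InnerProductSpace ℂ E]

/-- The graph of a symmetric operator (possibly not densely defined). -/
def IsSymmGraph (G : Set (E × E)) : Prop := ∀ p ∈ G, ∀ q ∈ G, ⟪p.2, q.1⟫_ℂ = ⟪p.1, q.2⟫_ℂ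

theorem IsSymmGraph.span {G : Set (E × E)} (h : IsSymmGraph G) :
    IsSymmGraph (Submodule.span ℂ G : Set (E × E)) := by
  intro p hp q hq
  induction hp using Submodule.span_induction with
  | mem p hp =>
    induction hq using Submodule.span_induction with
    | mem q hq => exact h p hp q hq
    | zero => simp
    | add q q' _ _ h1 h2 => simp [h1, h2]
    | smul c q _ h1 => simp [h1]
  | zero => simp
  | add p p' _ _ h1 h2 => simp [h1, h2]
  | smul c p _ h1 => simp [h1]

theorem IsSymmGraph.closure {G : Set (E × E)} (h : IsSymmGraph G) : IsSymmGraph (closure G) := by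
  have h1 : ∀ p ∈ G, ∀ q ∈ _root_.closure G, ⟪p.2, q.1⟫_ℂ = ⟪p.1, q.2⟫_ℂ := fun p hp =>
    closure_minimal (h p hp) (isClosed_eq (by fun_prop) (by fun_prop))
  intro p hp q hq
  revert p
  exact closure_minimal (fun p hp => h1 p hp q hq) (isClosed_eq (by fun_prop) (by fun_prop))

/-- The cross term vanishes because symmetry makes `⟪p.2, p.1⟫` real. Both bounds that follow are
read off from this identity. -/
theorem IsSymmGraph.norm_sq {G : Set (E × E)} (h : IsSymmGraph G) (μ : ℝ) {p : E × E} (hp : p ∈ G) :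
    ‖p.2 - (Complex.I * μ) • p.1‖ ^ 2 = ‖p.2‖ ^ 2 + (|μ| * ‖p.1‖) ^ 2 := by
  have h2 : (⟪p.2, p.1⟫_ℂ).im = 0 := by
    have := h p hp p hp
    rw [← inner_conj_symm] at this
    have := congrArg Complex.im this
    simp only [Complex.conj_im] at this
    rw [h p hp p hp]
    linarith
  rw [norm_sub_sq (𝕜 := ℂ), norm_smul, inner_smul_right]
  simp [h2]

theorem IsSymmGraph.norm_fst_le {G : Set (E × E)} (h : IsSymmGraph G) (μ : ℝ) {p : E × E}
    (hp : p ∈ G) : |μ| * ‖p.1‖ ≤ ‖p.2 - (Complex.I * μ) • p.1‖ :=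
  le_of_sq_le_sq (by have := h.norm_sq μ hp; have := sq_nonneg ‖p.2‖; linarith) (norm_nonneg _)

theorem IsSymmGraph.norm_snd_le {G : Set (E × E)} (h : IsSymmGraph G) (μ : ℝ) {p : E × E}
    (hp : p ∈ G) : ‖p.2‖ ≤ ‖p.2 - (Complex.I * μ) • p.1‖ :=
  le_of_sq_le_sq (by have := h.norm_sq μ hp; have := sq_nonneg (|μ| * ‖p.1‖); linarith)
    (norm_nonneg _)

/-- This is closability: symmetry makes the second component orthogonal to the dense domain. -/
theorem IsSymmGraph.snd_eq_zero {G : Set (E × E)} (h : IsSymmGraph G) (hd : Dense (Prod.fst '' G))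
    {p : E × E} (hp : p ∈ G) (h0 : p.1 = 0) : p.2 = 0 := by
  refine hd.eq_zero_of_inner_left ℂ fun v hv => ?_
  obtain ⟨q, hq, rfl⟩ := hv
  rw [h p hp q hq, h0, inner_zero_left]

variable [CompleteSpace E]

/-- On a closed graph the map `A - iμ` is bounded below in the graph norm, so its range is closed. A
trivial orthogonal complement then makes it everything. -/
theorem IsSymmGraph.range_eq_top {G : Submodule ℂ (E × E)} (h : IsSymmGraph (G : Set (E × E)))
    (hc : IsClosed (G : Set (E × E))) {μ : ℝ} (hμ : μ ≠ 0)
    (hd : ∀ z, (∀ p ∈ G, ⟪z, p.2 - (Complex.I * μ) • p.1⟫_ℂ = 0) → z = 0) (z : E) :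
    ∃ p ∈ G, p.2 - (Complex.I * μ) • p.1 = z := by
  let T : G →L[ℂ] E := (ContinuousLinearMap.snd ℂ E E - (Complex.I * μ) • ContinuousLinearMap.fst ℂ E E) ∘L
    G.subtypeL
  have hT : ∀ p : G, T p = p.1.2 - (Complex.I * μ) • p.1.1 := fun p => rfl
  have : CompleteSpace G := hc.completeSpace_coe
  have hμ' : 0 < |μ| := abs_pos.mpr hμ
  have hanti : AntilipschitzWith (1 + |μ|⁻¹).toNNReal T := by
    refine AddMonoidHomClass.antilipschitz_of_bound T fun p => ?_
    rw [Real.coe_toNNReal _ (by positivity)]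
    change ‖(p : E × E)‖ ≤ _ * ‖T p‖
    rw [Prod.norm_def, hT]
    have h1 := h.norm_fst_le μ p.2
    have h2 := h.norm_snd_le μ p.2
    rw [← le_inv_mul_iff₀ hμ'] at h1
    have h4 : 0 ≤ |μ|⁻¹ * ‖p.1.2 - (Complex.I * μ) • p.1.1‖ := by positivity
    rw [add_mul, one_mul]
    exact max_le (by linarith [norm_nonneg (p.1.2 - (Complex.I * μ) • p.1.1)]) (by linarith)
  have hcl : IsClosed (Set.range T) := hanti.isClosed_range T.uniformContinuous
  have htop : LinearMap.range T.toLinearMap = ⊤ := by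
    have hcl' : IsClosed ((LinearMap.range T.toLinearMap : Submodule ℂ E) : Set E) := hcl
    have : CompleteSpace (LinearMap.range T.toLinearMap) := hcl'.completeSpace_coe
    rw [← Submodule.orthogonal_eq_bot_iff, Submodule.eq_bot_iff]
    intro z hz
    refine hd z fun p hp => ?_
    rw [Submodule.mem_orthogonal'] at hz
    exact hz _ ⟨⟨p, hp⟩, rfl⟩
  have := htop ▸ Submodule.mem_top (x := z)
  obtain ⟨p, hp⟩ := this
  exact ⟨p, p.2, hp⟩

/-- Bounded perturbations keep the ranges of `A - iμ` full, for large `|μ|`. -/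
theorem IsSymmGraph.range_add_bounded {G : Submodule ℂ (E × E)} (h : IsSymmGraph (G : Set (E × E)))
    (B : E →L[ℂ] E) {μ : ℝ} (hμ : ‖B‖ < |μ|)
    (hr : ∀ z, ∃ p ∈ G, p.2 - (Complex.I * μ) • p.1 = z) (z : E) :
    ∃ p ∈ G, p.2 + B p.1 - (Complex.I * μ) • p.1 = z := by
  choose p hpG hp using hr
  have hμ' : 0 < |μ| := (norm_nonneg B).trans_lt hμ
  -- With `R = (A - iμ)⁻¹`, the equation `(A + B - iμ) x = z` says that `x` is a fixed point of `x ↦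
  -- R (z - B x)`, and `‖R‖ ≤ |μ|⁻¹` makes this map a contraction.
  let F : E → E := fun x => (p (z - B x)).1
  have hF : ContractingWith (|μ|⁻¹ * ‖B‖).toNNReal F := by
    constructor
    · rw [← NNReal.coe_lt_coe, Real.coe_toNNReal _ (by positivity), NNReal.coe_one,
        inv_mul_lt_iff₀ hμ', mul_one]
      exact hμ
    · refine LipschitzWith.of_dist_le_mul fun x y => ?_
      rw [Real.coe_toNNReal _ (by positivity), dist_eq_norm, dist_eq_norm]
      have h1 := h.norm_fst_le μ (G.sub_mem (hpG (z - B x)) (hpG (z - B y)))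
      have h2 : (p (z - B x) - p (z - B y)).2 - (Complex.I * μ) • (p (z - B x) - p (z - B y)).1 =
          B (y - x) := by
        rw [Prod.snd_sub, Prod.fst_sub, smul_sub, sub_sub_sub_comm, hp, hp, map_sub]
        abel
      rw [h2] at h1
      have h3 := B.le_opNorm (y - x)
      rw [norm_sub_rev y x] at h3
      rw [mul_assoc, le_inv_mul_iff₀ hμ']
      exact h1.trans h3
  have hx := hF.fixedPoint_isFixedPt
  set x := hF.fixedPoint
  refine ⟨p (z - B x), hpG _, ?_⟩
  have h1 : (p (z - B x)).1 = x := hx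
  have h2 := hp (z - B x)
  rw [h1] at h2 ⊢
  rw [add_sub_right_comm, h2, sub_add_cancel]

end Graphs

/-! ### Invariance and differentiability along a unitary group. -/

section Group
variable {E : Type*} [NormedAddCommGroup E] [InnerProductSpace ℂ E] [CompleteSpace E]
variable {A : E →ₗ.[ℂ] E} {U : ℝ → E →L[ℂ] E}

theorem IsUnitaryGroupOf.mul_neg (hU : IsUnitaryGroupOf A U) (t : ℝ) : U t * U (-t) = 1 := by
  rw [← hU.map_add, add_neg_cancel, hU.map_zero]

theorem IsUnitaryGroupOf.star_eq (hU : IsUnitaryGroupOf A U) (t : ℝ) : star (U t) = U (-t) := by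
  calc star (U t) = star (U t) * (U t * U (-t)) := by rw [hU.mul_neg, mul_one]
    _ = U (-t) := by rw [← mul_assoc, (Unitary.mem_iff.mp (hU.unitary t)).1, one_mul]

theorem IsUnitaryGroupOf.norm_apply (hU : IsUnitaryGroupOf A U) (t : ℝ) (x : E) : ‖U t x‖ = ‖x‖ :=
  (ContinuousLinearMap.norm_map_iff_adjoint_comp_self _).mpr
    (Unitary.mem_iff.mp (hU.unitary t)).1 x

theorem IsUnitaryGroupOf.hasDerivAt (hU : IsUnitaryGroupOf A U) (x : A.domain) (t : ℝ) :
    HasDerivAt (fun t => U t x) (Complex.I • U t (A x)) t := by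
  have h0 := (hU.generator x (A x)).mpr (A.mem_graph x)
  have h1 : HasDerivAt (fun τ => U (τ - t) x) (Complex.I • A x) t := by
    rw [← sub_self t] at h0
    exact HasDerivAt.comp_sub_const t t h0
  have h2 := ((U t).restrictScalars ℝ).hasFDerivAt.comp_hasDerivAt t h1
  have h3 : (((U t).restrictScalars ℝ) ∘ fun τ => U (τ - t) x) = fun τ => U τ x := by
    funext τ
    change (U t * U (τ - t)) x = _
    rw [← hU.map_add, add_sub_cancel]
  rw [h3] at h2
  simpa using h2

/-- The group preserves the domain and commutes with its generator: shifting the time turns the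
derivative at `t` into one at `0`, and the domain of `A` contains every vector whose orbit is
differentiable there. -/
theorem IsUnitaryGroupOf.mem_graph (hU : IsUnitaryGroupOf A U) (x : A.domain) (t : ℝ) :
    (U t x, U t (A x)) ∈ A.graph := by
  refine (hU.generator _ _).mp ?_
  have h0 := hU.hasDerivAt x t
  have h1 : HasDerivAt (fun τ => U (τ + t) x) (Complex.I • U t (A x)) 0 := by
    rw [← zero_add t] at h0
    have := HasDerivAt.comp_add_const 0 t h0
    simpa using this
  refine h1.congr_of_eventuallyEq (Eventually.of_forall fun τ => ?_)
  change (U τ * U t) x = _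
  rw [← hU.map_add]

end Group

/-! ### The unitary group of the one-particle operator. -/

section OneParticle
variable {H : Type*} [NormedAddCommGroup H] [InnerProductSpace ℂ H] [CompleteSpace H]

theorem inner_map_of_isSelfAdjoint {K : H →ₗ.[ℂ] H} (hK : IsSelfAdjoint K) (x y : K.domain) :
    ⟪K x, (y : H)⟫_ℂ = ⟪(x : H), K y⟫_ℂ := by
  have h := LinearPMap.adjoint_isFormalAdjoint hK.dense_domain
  rw [LinearPMap.isSelfAdjoint_def.mp hK] at h
  exact h x y

theorem isSymmGraph_of_isSelfAdjoint {K : H →ₗ.[ℂ] H} (hK : IsSelfAdjoint K) :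
    IsSymmGraph (K.graph : Set (H × H)) := by
  intro p hp q hq
  obtain ⟨x, hx, hx'⟩ := (LinearPMap.mem_graph_iff K).mp hp
  obtain ⟨y, hy, hy'⟩ := (LinearPMap.mem_graph_iff K).mp hq
  rw [← hx, ← hx', ← hy, ← hy']
  exact inner_map_of_isSelfAdjoint hK x y

/-- A vector orthogonal to the range of `K - iμ` lies in the domain of the adjoint, that is of `K`,
and is an eigenvector of `K` with eigenvalue `-iμ`. The lower bound for a symmetric operator
excludes this. -/
theorem exists_group_of_isSelfAdjoint {K : H →ₗ.[ℂ] H} (hK : IsSelfAdjoint K) :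
    ∃ V, IsUnitaryGroupOf K V := by
  refine exists_isUnitaryGroupOf hK.dense_domain (inner_map_of_isSelfAdjoint hK) one_pos
    fun μ hμ z => ?_
  have hμ0 : μ ≠ 0 := abs_pos.mp (one_pos.trans_le hμ)
  obtain ⟨p, hp, hpz⟩ := (isSymmGraph_of_isSelfAdjoint hK).range_eq_top hK.isClosed hμ0 (fun z hz => by
    have hz' : ∀ x : K.domain, ⟪(-(Complex.I * μ)) • z, (x : H)⟫_ℂ = ⟪z, K x⟫_ℂ := fun x => by
      have := hz _ (K.mem_graph x)
      rw [inner_sub_right, sub_eq_zero, inner_smul_right] at this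
      rw [this, inner_smul_left]
      simp
    have hmem : z ∈ K.adjoint.domain :=
      LinearPMap.mem_adjoint_domain_of_exists _ ⟨_, hz'⟩
    have hval := LinearPMap.adjoint_apply_eq hK.dense_domain ⟨z, hmem⟩ hz'
    have hgr : (z, (-(Complex.I * μ)) • z) ∈ K.graph := by
      have := K.adjoint.mem_graph ⟨z, hmem⟩
      rw [hval] at this
      change (z, _) ∈ _ at this
      rwa [LinearPMap.isSelfAdjoint_def.mp hK] at this
    have h1 := (isSymmGraph_of_isSelfAdjoint hK).norm_fst_le (-μ) hgr
    simp only [Complex.ofReal_neg, mul_neg, sub_self, norm_zero, abs_neg] at h1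
    by_contra h
    exact absurd h1 (not_le.mpr (mul_pos (abs_pos.mpr hμ0) (norm_pos_iff.mpr h)))) z
  obtain ⟨x, hx, hx'⟩ := (LinearPMap.mem_graph_iff K).mp hp
  exact ⟨x, by rw [hx', hx]; exact hpz⟩

end OneParticle

/-! ### The `n`-particle Hamiltonian generates a unitary group. -/

section Hamiltonian
variable {H : Type*} [NormedAddCommGroup H] [InnerProductSpace ℂ H]

/-- The kinetic energy `∑_j K(j)` on the product vector of the `x j`. -/
def kinetic {n : ℕ} (K : H →ₗ.[ℂ] H) (x : Fin n → K.domain) : TensorPow (Fin n) H :=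
  ∑ j, pureTensor (Function.update (fun i => (x i : H)) j (K (x j)))

/-- The interaction energy `∑_{i<j} Φ(i,j)`. -/
def potential (Φ : Op 2 H) (n : ℕ) : Op n H :=
  ∑ i, ∑ j ∈ Finset.univ.filter (fun j => i < j), pairOp Φ i j

/-- The product vectors of elements of the domain of `K`, paired with their images under
`∑_j K(j) + B`. -/
def coreGraph {n : ℕ} (K : H →ₗ.[ℂ] H) (B : Op n H) :
    Set (TensorPow (Fin n) H × TensorPow (Fin n) H) :=
  Set.range fun x : Fin n → K.domain =>
    (pureTensor (fun i => (x i : H)), kinetic K x + B (pureTensor (fun i => (x i : H))))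

theorem hamGraph_eq (K : H →ₗ.[ℂ] H) (Φ : Op 2 H) (n : ℕ) :
    hamGraph K Φ n = (Submodule.span ℂ (coreGraph K (potential Φ n))).topologicalClosure := by
  simp only [hamGraph, coreGraph, kinetic, potential, sum_apply]

theorem isSelfAdjoint_pairOp {Φ : Op 2 H} (hΦ : IsSelfAdjoint Φ) {n : ℕ} (i j : Fin n) :
    IsSelfAdjoint (pairOp Φ i j) := by
  rw [pairOp]
  split_ifs
  · rw [isSelfAdjoint_iff, ← ampl_star, hΦ.star_eq]
  · exact IsSelfAdjoint.zero _

theorem isSelfAdjoint_potential {Φ : Op 2 H} (hΦ : IsSelfAdjoint Φ) (n : ℕ) :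
    IsSelfAdjoint (potential Φ n) :=
  isSelfAdjoint_sum _ fun i _ => isSelfAdjoint_sum _ fun j _ => isSelfAdjoint_pairOp hΦ i j

variable [CompleteSpace H]

/-- Each summand changes a single factor of the product of inner products, and there the symmetry of
`K` applies. -/
theorem inner_kinetic {K : H →ₗ.[ℂ] H} (hK : IsSelfAdjoint K) {n : ℕ} (x y : Fin n → K.domain) :
    ⟪kinetic K x, pureTensor (fun i => (y i : H))⟫_ℂ =
      ⟪pureTensor (fun i => (x i : H)), kinetic K y⟫_ℂ := by
  rw [← inner_conj_symm (pureTensor _)]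
  simp only [kinetic, sum_inner, inner_pureTensor_update, map_sum, map_mul, inner_conj_symm, map_prod]
  refine Finset.sum_congr rfl fun j _ => ?_
  rw [inner_map_of_isSelfAdjoint hK]

theorem isSymmGraph_coreGraph {K : H →ₗ.[ℂ] H} (hK : IsSelfAdjoint K) {n : ℕ} {B : Op n H}
    (hB : IsSelfAdjoint B) : IsSymmGraph (coreGraph K B) := by
  rintro _ ⟨x, rfl⟩ _ ⟨y, rfl⟩
  simp only [inner_add_left, inner_add_right, inner_kinetic hK]
  congr 1
  conv_lhs => rw [← hB.star_eq]
  rw [ContinuousLinearMap.star_eq_adjoint, ContinuousLinearMap.adjoint_inner_left]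

theorem isSymmGraph_core_closure {K : H →ₗ.[ℂ] H} (hK : IsSelfAdjoint K) {n : ℕ} {B : Op n H}
    (hB : IsSelfAdjoint B) :
    IsSymmGraph ((Submodule.span ℂ (coreGraph K B)).topologicalClosure :
      Set (TensorPow (Fin n) H × TensorPow (Fin n) H)) :=
  (isSymmGraph_coreGraph hK hB).span.closure

theorem eq_zero_of_inner_pureTensor_domain {K : H →ₗ.[ℂ] H} (hK : IsSelfAdjoint K) {n : ℕ}
    {z : TensorPow (Fin n) H}
    (h : ∀ x : Fin n → K.domain, ⟪z, pureTensor (fun i => (x i : H))⟫_ℂ = 0) : z = 0 := by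
  refine eq_of_inner_pureTensor fun x => ?_
  rw [inner_zero_left]
  have hd : Dense (Set.univ.pi fun _ : Fin n => (K.domain : Set H)) :=
    dense_pi _ fun _ _ => hK.dense_domain
  have hc : IsClosed {x : Fin n → H | ⟪z, pureTensor x⟫_ℂ = 0} :=
    isClosed_eq (Continuous.inner continuous_const continuous_pureTensor) continuous_const
  have : closure (Set.univ.pi fun _ : Fin n => (K.domain : Set H)) ⊆ {x | ⟪z, pureTensor x⟫_ℂ = 0} :=
    closure_minimal (fun x hx => h fun i => ⟨x i, hx i trivial⟩) hc
  exact this (hd x)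

theorem hasDerivAt_pureTensor {n : ℕ} {f : Fin n → ℝ → H} {f' : Fin n → H} {t : ℝ}
    (h : ∀ i, HasDerivAt (f i) (f' i) t) :
    HasDerivAt (fun t => (pureTensor (fun i => f i t) : TensorPow (Fin n) H))
      (∑ j, pureTensor (Function.update (fun i => f i t) j (f' j))) t := by
  have h1 := ((pureTensorM (Fin n) H).hasFDerivAt (fun i => f i t)).restrictScalars ℝ
  have h2 := h1.comp_hasDerivAt t (hasDerivAt_pi.mpr h)
  convert! h2 using 1
  simp [ContinuousMultilinearMap.linearDeriv_apply]

/-- The product vectors over the domain of `K` are invariant under `V t ⊗ ⋯ ⊗ V t`. If `z` is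
orthogonal to the range on this core, then `f t`, the inner product of `z` with the moving product
vector, satisfies `f' = -μ f`. It is also bounded on the whole line, so it vanishes. -/
theorem free_dense_range {K : H →ₗ.[ℂ] H} (hK : IsSelfAdjoint K) {n : ℕ} {μ : ℝ} (hμ : μ ≠ 0)
    {z : TensorPow (Fin n) H}
    (hz : ∀ p ∈ coreGraph K (0 : Op n H), ⟪z, p.2 - (Complex.I * μ) • p.1⟫_ℂ = 0) : z = 0 := by
  obtain ⟨V, hV⟩ := exists_group_of_isSelfAdjoint hK
  refine eq_zero_of_inner_pureTensor_domain hK fun x => ?_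
  have hdom : ∀ t i, V t (x i) ∈ K.domain := fun t i =>
    LinearPMap.mem_domain_of_mem_graph (hV.mem_graph (x i) t)
  have hKV : ∀ t i, K ⟨V t (x i), hdom t i⟩ = V t (K (x i)) := fun t i => by
    obtain ⟨y, hy, hy'⟩ := (LinearPMap.mem_graph_iff K).mp (hV.mem_graph (x i) t)
    exact (congrArg K (Subtype.ext hy.symm)).trans hy'
  set f : ℝ → ℂ := fun t => ⟪z, pureTensor (fun i => V t (x i))⟫_ℂ with hf
  have hfd : ∀ t, HasDerivAt f (-(μ : ℂ) * f t) t := by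
    intro t
    have h1 := (hasDerivAt_pureTensor (fun i => hV.hasDerivAt (x i) t))
    have h2 := ((innerSL ℂ z).restrictScalars ℝ).hasFDerivAt.comp_hasDerivAt t h1
    convert! h2 using 1
    have h3 := hz _ ⟨fun i => ⟨V t (x i), hdom t i⟩, rfl⟩
    simp only [zero_apply, add_zero, inner_sub_right, inner_smul_right, sub_eq_zero, kinetic, hKV] at h3
    have h4 : ∀ j, (pureTensor (Function.update (fun i => V t (x i)) j (Complex.I • V t (K (x j)))) :
        TensorPow (Fin n) H) = Complex.I • pureTensor (Function.update (fun i => V t (x i)) j (V t (K (x j)))) :=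
      fun j => (pureTensorM (Fin n) H).map_update_smul _ j _ _
    simp only [h4, ← Finset.smul_sum]
    simp only [map_smul, ContinuousLinearMap.coe_restrictScalars', innerSL_apply_apply, smul_eq_mul]
    rw [h3, ← mul_assoc, ← mul_assoc, Complex.I_mul_I, neg_one_mul]
  have hconst : ∀ t, f t * Complex.exp (μ * t) = f 0 := by
    intro t
    have hd : ∀ t : ℝ, HasDerivAt (fun t : ℝ => f t * Complex.exp (μ * t)) 0 t := by
      intro t
      have h1 : HasDerivAt (fun t : ℝ => Complex.exp (μ * t)) (Complex.exp (μ * t) * μ) t := by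
        have := ((hasDerivAt_id (t : ℂ)).const_mul (μ : ℂ)).cexp.comp_ofReal
        simpa using this
      convert! (hfd t).mul h1 using 1
      ring
    have := is_const_of_deriv_eq_zero (fun t => (hd t).differentiableAt) (fun t => (hd t).deriv) t 0
    simpa using this
  have hbound : ∀ t, ‖f t‖ ≤ ‖z‖ * ∏ i, ‖(x i : H)‖ := by
    intro t
    refine (norm_inner_le_norm _ _).trans ?_
    rw [norm_pureTensor]
    simp only [hV.norm_apply]
    exact le_rfl
  have hf0 : f 0 = 0 := by
    by_contra hne
    have hpos := norm_pos_iff.mpr hne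
    set C := ‖z‖ * ∏ i, ‖(x i : H)‖
    -- Evaluation at the time `-τ/μ` makes the exponential factor decay for either sign of `μ`.
    have h1 : ∀ τ : ℝ, ‖f 0‖ ≤ C * Real.exp (-τ) := by
      intro τ
      have h2 : (μ : ℂ) * ((-τ / μ : ℝ) : ℂ) = ((-τ : ℝ) : ℂ) := by
        have : (μ : ℂ) ≠ 0 := by exact_mod_cast hμ
        push_cast; field_simp
      rw [← hconst (-τ / μ), norm_mul, h2, Complex.norm_exp_ofReal]
      exact mul_le_mul_of_nonneg_right (hbound _) (Real.exp_pos _).le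
    have h2 : Tendsto (fun τ : ℝ => C * Real.exp (-τ)) atTop (𝓝 0) := by
      simpa using (Real.tendsto_exp_neg_atTop_nhds_zero).const_mul C
    have h3 := ge_of_tendsto' h2 h1
    linarith
  have : f 0 = ⟪z, pureTensor (fun i => (x i : H))⟫_ℂ := by
    simp only [hf, hV.map_zero, one_apply_eq_self]
  rw [← this, hf0]

theorem dense_domain_core {K : H →ₗ.[ℂ] H} (hK : IsSelfAdjoint K) {n : ℕ} (B : Op n H) :
    Dense (Prod.fst '' ((Submodule.span ℂ (coreGraph K B)).topologicalClosure :
      Set (TensorPow (Fin n) H × TensorPow (Fin n) H))) := by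
  set G := (Submodule.span ℂ (coreGraph K B)).topologicalClosure
  have h1 : Prod.fst '' (G : Set (TensorPow (Fin n) H × TensorPow (Fin n) H)) =
      (G.map (LinearMap.fst ℂ _ _) : Set (TensorPow (Fin n) H)) := by
    simp
  rw [h1, Submodule.dense_iff_topologicalClosure_eq_top, Submodule.topologicalClosure_eq_top_iff,
    Submodule.eq_bot_iff]
  intro z hz
  refine eq_zero_of_inner_pureTensor_domain hK fun x => ?_
  rw [Submodule.mem_orthogonal'] at hz
  refine hz _ ⟨_, Submodule.le_topologicalClosure _ (Submodule.subset_span ⟨x, rfl⟩), rfl⟩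

/-- A submodule is the graph of its `toLinearPMap` only if it is single-valued; symmetry and density
of the domain ensure this. -/
theorem ham_graph {K : H →ₗ.[ℂ] H} (hK : IsSelfAdjoint K) {Φ : Op 2 H} (hΦ : IsSelfAdjoint Φ) (n : ℕ) :
    (ham K Φ n).graph = (Submodule.span ℂ (coreGraph K (potential Φ n))).topologicalClosure := by
  rw [ham, hamGraph_eq]
  refine Submodule.toLinearPMap_graph_eq _ fun p hp h0 => ?_
  exact (isSymmGraph_core_closure hK (isSelfAdjoint_potential hΦ n)).snd_eq_zero
    (dense_domain_core hK _) hp h0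

theorem ham_dense {K : H →ₗ.[ℂ] H} (hK : IsSelfAdjoint K) {Φ : Op 2 H} (hΦ : IsSelfAdjoint Φ) (n : ℕ) :
    Dense ((ham K Φ n).domain : Set (TensorPow (Fin n) H)) := by
  have := dense_domain_core hK (potential Φ n)
  rw [← ham_graph hK hΦ] at this
  refine this.mono ?_
  rintro _ ⟨p, hp, rfl⟩
  exact LinearPMap.mem_domain_of_mem_graph hp

theorem ham_symm {K : H →ₗ.[ℂ] H} (hK : IsSelfAdjoint K) {Φ : Op 2 H} (hΦ : IsSelfAdjoint Φ) {n : ℕ}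
    (x y : (ham K Φ n).domain) :
    ⟪ham K Φ n x, (y : TensorPow (Fin n) H)⟫_ℂ = ⟪(x : TensorPow (Fin n) H), ham K Φ n y⟫_ℂ := by
  have := isSymmGraph_core_closure hK (isSelfAdjoint_potential hΦ n)
  rw [← ham_graph hK hΦ] at this
  exact this _ (LinearPMap.mem_graph _ x) _ (LinearPMap.mem_graph _ y)

/-- The ranges of the free operator minus `iμ` are full by `free_dense_range` and closedness. The
bounded interaction preserves this for `|μ|` above its norm, which is why Stone's theorem is stated
with a threshold `M`. -/
theorem exists_group_ham {K : H →ₗ.[ℂ] H} (hK : IsSelfAdjoint K) {Φ : Op 2 H} (hΦ : IsSelfAdjoint Φ)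
    (n : ℕ) : ∃ U, IsUnitaryGroupOf (ham K Φ n) U := by
  refine exists_isUnitaryGroupOf (M := ‖potential Φ n‖ + 1) (ham_dense hK hΦ n) (ham_symm hK hΦ)
    (by positivity) fun μ hμ z => ?_
  have hμ' : ‖potential Φ n‖ < |μ| := (lt_add_one _).trans_le hμ
  have hμ0 : μ ≠ 0 := abs_pos.mp ((norm_nonneg _).trans_lt hμ')
  obtain ⟨p, hp, hpz⟩ := (isSymmGraph_core_closure hK (IsSelfAdjoint.zero (Op n H))).range_add_bounded
    (potential Φ n) hμ' ((isSymmGraph_core_closure hK (IsSelfAdjoint.zero (Op n H))).range_eq_top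
      (Submodule.isClosed_topologicalClosure _) hμ0 fun z hz => free_dense_range hK hμ0 fun p hp =>
        hz p (Submodule.le_topologicalClosure _ (Submodule.subset_span hp))) z
  have hgr : (p.1, p.2 + potential Φ n p.1) ∈ (ham K Φ n).graph := by
    rw [ham_graph hK hΦ]
    have hcont : Continuous fun p : TensorPow (Fin n) H × TensorPow (Fin n) H =>
        (p.1, p.2 + potential Φ n p.1) := by fun_prop
    -- The shear `(x, y) ↦ (x, y + Bx)` is continuous and maps the free core into the interacting
    -- core, hence also the closures of their spans.
    refine map_mem_closure (f := fun p => (p.1, p.2 + potential Φ n p.1)) hcont hp fun q hq => ?_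
    induction hq using Submodule.span_induction with
    | mem q hq =>
      obtain ⟨x, rfl⟩ := hq
      exact Submodule.subset_span ⟨x, by simp⟩
    | zero => simp [← Prod.zero_eq_mk]
    | add q q' _ _ h1 h2 =>
      have := Submodule.add_mem _ h1 h2
      convert! this using 1
      ext <;> simp
      abel
    | smul c q _ h1 =>
      have := Submodule.smul_mem _ c h1
      convert! this using 1
      ext <;> simp
  obtain ⟨x, hx, hx'⟩ := (LinearPMap.mem_graph_iff _).mp hgr
  exact ⟨x, by rw [hx', hx]; exact hpz⟩

theorem expI_ham {K : H →ₗ.[ℂ] H} (hK : IsSelfAdjoint K) {Φ : Op 2 H} (hΦ : IsSelfAdjoint Φ)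
    (n : ℕ) : IsUnitaryGroupOf (ham K Φ n) (expI (ham K Φ n)) := by
  have h := exists_group_ham hK hΦ n
  rw [expI, dif_pos h]
  exact h.choose_spec

end Hamiltonian
end
end QuantumHierarchy

namespace QuantumHierarchy
open scoped ComplexOrder InnerProductSpace ComplexConjugate
open Filter Topology
noncomputable section

/-! ### Weakly continuous operator families and their product rule. -/

section WeakCalculus
variable {E : Type*} [NormedAddCommGroup E] [InnerProductSpace ℂ E]

/-- Weak continuity of a family of bounded operators. -/
def WeakCont (A : ℝ → E →L[ℂ] E) : Prop := ∀ φ ψ : E, Continuous fun t => ⟪φ, A t ψ⟫_ℂ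

theorem WeakCont.sub {A B : ℝ → E →L[ℂ] E} (hA : WeakCont A) (hB : WeakCont B) :
    WeakCont fun t => A t - B t := fun φ ψ => by
  simp only [sub_apply, inner_sub_right]
  exact (hA φ ψ).sub (hB φ ψ)

theorem WeakCont.smul {A : ℝ → E →L[ℂ] E} (hA : WeakCont A) (c : ℂ) :
    WeakCont fun t => c • A t := fun φ ψ => by
  simp only [smul_apply, inner_smul_right]
  exact (hA φ ψ).const_mul c

theorem WeakCont.sum {α : Type*} (S : Finset α) {A : α → ℝ → E →L[ℂ] E}
    (hA : ∀ a ∈ S, WeakCont (A a)) : WeakCont fun t => ∑ a ∈ S, A a t := fun φ ψ => by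
  simp only [sum_apply, inner_sum]
  exact continuous_finsetSum S fun a ha => hA a ha φ ψ

/-- The common bound `M` makes the matrix elements of approximating vectors converge uniformly in
`t`, so that continuity passes to the limit. -/
theorem WeakCont.of_dense {A : ℝ → E →L[ℂ] E} {M : ℝ} (hM : ∀ t, ‖A t‖ ≤ M) {S : Set E}
    (hS : Dense (Submodule.span ℂ S : Set E)) (h : ∀ x ∈ S, ∀ y ∈ S, Continuous fun t => ⟪x, A t y⟫_ℂ) :
    WeakCont A := by
  have hM0 : 0 ≤ M := (norm_nonneg _).trans (hM 0)
  have hb : ∀ t x y, ‖⟪x, A t y⟫_ℂ‖ ≤ M * ‖x‖ * ‖y‖ := fun t x y => by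
    refine (norm_inner_le_norm _ _).trans ?_
    have := (A t).le_of_opNorm_le (hM t) y
    nlinarith [norm_nonneg x, mul_le_mul_of_nonneg_left this (norm_nonneg x)]
  have hspan : ∀ x ∈ Submodule.span ℂ S, ∀ y ∈ Submodule.span ℂ S,
      Continuous fun t => ⟪x, A t y⟫_ℂ := by
    intro x hx y hy
    induction hx using Submodule.span_induction with
    | mem x hx =>
      induction hy using Submodule.span_induction with
      | mem y hy => exact h x hx y hy
      | zero => simpa using continuous_const
      | add y y' _ _ h1 h2 => simpa using h1.fun_add h2
      | smul c y _ h1 => simpa using h1.const_mul c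
    | zero => simpa using continuous_const
    | add y y' _ _ h1 h2 => simpa using h1.fun_add h2
    | smul c y _ h1 => simpa using h1.mul_const (conj c)
  intro φ ψ
  obtain ⟨x, hx, hxφ⟩ := mem_closure_iff_seq_limit.mp (hS φ)
  obtain ⟨y, hy, hyψ⟩ := mem_closure_iff_seq_limit.mp (hS ψ)
  refine TendstoUniformly.continuous (F := fun n t => ⟪x n, A t (y n)⟫_ℂ) (p := atTop) ?_
    (Frequently.of_forall fun n => hspan _ (hx n) _ (hy n))
  have hlim : Tendsto (fun n => M * ‖φ - x n‖ * ‖y n‖ + M * ‖φ‖ * ‖ψ - y n‖) atTop (𝓝 0) := by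
    have h1 : Tendsto (fun n => ‖φ - x n‖) atTop (𝓝 0) := by
      simpa using (tendsto_const_nhds.sub hxφ : Tendsto (fun n => φ - x n) atTop _).norm
    have h2 : Tendsto (fun n => ‖ψ - y n‖) atTop (𝓝 0) := by
      simpa using (tendsto_const_nhds.sub hyψ : Tendsto (fun n => ψ - y n) atTop _).norm
    simpa using ((h1.const_mul M).mul hyψ.norm).add (h2.const_mul (M * ‖φ‖))
  rw [Metric.tendstoUniformly_iff]
  intro ε hε
  filter_upwards [hlim.eventually (gt_mem_nhds hε)] with n hn t
  refine lt_of_le_of_lt ?_ hn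
  rw [dist_eq_norm]
  have : ⟪φ, A t ψ⟫_ℂ - ⟪x n, A t (y n)⟫_ℂ = ⟪φ - x n, A t (y n)⟫_ℂ + ⟪φ, A t (ψ - y n)⟫_ℂ := by
    rw [inner_sub_left, map_sub, inner_sub_right]; ring
  rw [this]
  exact (norm_add_le _ _).trans (add_le_add (hb _ _ _) (hb _ _ _))

variable [CompleteSpace E]

/-- The uniform boundedness principle is applied twice on a compact interval: first to the
functionals given by `A τ ψ`, then to the operators. -/
theorem WeakCont.locally_bounded {A : ℝ → E →L[ℂ] E} (hA : WeakCont A) (t : ℝ) :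
    ∃ M, ∀ᶠ τ in 𝓝 t, ‖A τ‖ ≤ M := by
  have h1 : ∀ ψ : E, ∃ C, ∀ τ : Set.Icc (t - 1) (t + 1), ‖A τ ψ‖ ≤ C := by
    intro ψ
    obtain ⟨C, hC⟩ := banach_steinhaus (g := fun τ : Set.Icc (t - 1) (t + 1) => innerSL ℂ (A τ ψ))
      (fun φ => by
        obtain ⟨C, hC⟩ := isCompact_Icc.exists_bound_of_continuousOn (s := Set.Icc (t - 1) (t + 1))
          (hA φ ψ).continuousOn
        refine ⟨C, fun τ => ?_⟩
        rw [innerSL_apply_apply, norm_inner_symm]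
        exact hC τ τ.2)
    exact ⟨C, fun τ => by simpa using hC τ⟩
  obtain ⟨M, hM⟩ := banach_steinhaus h1
  refine ⟨M, ?_⟩
  filter_upwards [Icc_mem_nhds (sub_one_lt t) (lt_add_one t)] with τ hτ
  exact hM ⟨τ, hτ⟩

theorem WeakCont.tendsto_inner {A : ℝ → E →L[ℂ] E} (hA : WeakCont A) {t : ℝ} {l : Filter ℝ}
    (hl : l ≤ 𝓝 t) {u v : ℝ → E} {u₀ v₀ : E} (hu : Tendsto u l (𝓝 u₀)) (hv : Tendsto v l (𝓝 v₀)) :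
    Tendsto (fun τ => ⟪u τ, A τ (v τ)⟫_ℂ) l (𝓝 ⟪u₀, A t v₀⟫_ℂ) := by
  obtain ⟨M, hM⟩ := hA.locally_bounded t
  have hM : ∀ᶠ τ in l, ‖A τ‖ ≤ M := hl hM
  have h0 : Tendsto (fun τ => ⟪u₀, A τ v₀⟫_ℂ) l (𝓝 ⟪u₀, A t v₀⟫_ℂ) :=
    ((hA u₀ v₀).tendsto t).mono_left hl
  have h1 : Tendsto (fun τ => ⟪u τ - u₀, A τ (v τ)⟫_ℂ) l (𝓝 0) := by
    have hlim : Tendsto (fun τ => ‖u τ - u₀‖ * (M * ‖v τ‖)) l (𝓝 0) := by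
      simpa using (tendsto_iff_norm_sub_tendsto_zero.mp hu).mul (hv.norm.const_mul M)
    refine squeeze_zero_norm' (hM.mono fun τ hτ => ?_) hlim
    refine (norm_inner_le_norm _ _).trans ?_
    gcongr
    exact (A τ).le_of_opNorm_le hτ _
  have h2 : Tendsto (fun τ => ⟪u₀, A τ (v τ - v₀)⟫_ℂ) l (𝓝 0) := by
    have hlim : Tendsto (fun τ => ‖u₀‖ * (M * ‖v τ - v₀‖)) l (𝓝 0) := by
      simpa using ((tendsto_iff_norm_sub_tendsto_zero.mp hv).const_mul M).const_mul ‖u₀‖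
    refine squeeze_zero_norm' (hM.mono fun τ hτ => ?_) hlim
    refine (norm_inner_le_norm _ _).trans ?_
    gcongr
    exact (A τ).le_of_opNorm_le hτ _
  have h3 := (h1.add h2).add h0
  rw [zero_add, zero_add] at h3
  refine h3.congr fun τ => ?_
  rw [inner_sub_left, map_sub, inner_sub_right]; ring

/-- The difference quotient splits into three parts. In the first two, vectors converge in norm and
weak continuity with local boundedness suffices; only the third, with frozen vectors, needs
differentiability of `A`. -/
theorem WeakCont.hasDerivAt_inner {A : ℝ → E →L[ℂ] E} (hA : WeakCont A) {x y : ℝ → E} {x' y' : E}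
    {t : ℝ} {d : ℂ} (hx : HasDerivAt x x' t) (hy : HasDerivAt y y' t)
    (h : HasDerivAt (fun τ => ⟪x t, A τ (y t)⟫_ℂ) d t) :
    HasDerivAt (fun τ => ⟪x τ, A τ (y τ)⟫_ℂ) (⟪x', A t (y t)⟫_ℂ + ⟪x t, A t y'⟫_ℂ + d) t := by
  have hyc := hy.continuousAt
  rw [hasDerivAt_iff_tendsto_slope] at hx hy h ⊢
  have hl : 𝓝[≠] t ≤ 𝓝 t := nhdsWithin_le_nhds
  refine (((hA.tendsto_inner hl hx (hyc.tendsto.mono_left hl)).add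
    (hA.tendsto_inner hl tendsto_const_nhds hy)).add h).congr fun τ => ?_
  simp only [slope, vsub_eq_sub]
  rw [← Complex.coe_smul ((τ - t)⁻¹) (x τ - x t), ← Complex.coe_smul ((τ - t)⁻¹) (y τ - y t)]
  simp only [map_smul, map_sub, inner_smul_left, inner_smul_right, inner_sub_left, inner_sub_right,
    Complex.conj_ofReal, Complex.real_smul]
  ring

end WeakCalculus

/-! ### The weak Heisenberg equation: extension from the core, uniqueness, evolution. -/

section Heisenberg
variable {H : Type*} [NormedAddCommGroup H] [InnerProductSpace ℂ H]
variable {K : H →ₗ.[ℂ] H} {Φ : Op 2 H} {n : ℕ}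

/-- `t ↦ A t` satisfies, tested on the domain of `H_n`, the Heisenberg equation with the source `C`. -/
def WeakSol (K : H →ₗ.[ℂ] H) (Φ : Op 2 H) {n : ℕ} (A C : ℝ → Op n H) : Prop :=
  ∀ (φ ψ : (ham K Φ n).domain) (t : ℝ),
    HasDerivAt (fun τ => ⟪(φ : TensorPow (Fin n) H), A τ ψ⟫_ℂ)
      (-Complex.I * (⟪(φ : TensorPow (Fin n) H), A t (ham K Φ n ψ)⟫_ℂ - ⟪ham K Φ n φ, A t ψ⟫_ℂ) +
        ⟪(φ : TensorPow (Fin n) H), C t ψ⟫_ℂ) t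

theorem WeakSol.sub {A A' C C' : ℝ → Op n H} (h : WeakSol K Φ A C) (h' : WeakSol K Φ A' C') :
    WeakSol K Φ (fun t => A t - A' t) (fun t => C t - C' t) := fun φ ψ t => by
  simp only [sub_apply, inner_sub_right]
  convert! (h φ ψ t).sub (h' φ ψ t) using 1
  ring

theorem WeakSol.smul {A C : ℝ → Op n H} (h : WeakSol K Φ A C) (c : ℂ) :
    WeakSol K Φ (fun t => c • A t) (fun t => c • C t) := fun φ ψ t => by
  simp only [smul_apply, inner_smul_right]
  convert! (h φ ψ t).const_mul c using 1
  ring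

theorem WeakSol.sum {α : Type*} (S : Finset α) {A C : α → ℝ → Op n H}
    (h : ∀ a ∈ S, WeakSol K Φ (A a) (C a)) :
    WeakSol K Φ (fun t => ∑ a ∈ S, A a t) (fun t => ∑ a ∈ S, C a t) := fun φ ψ t => by
  simp only [sum_apply, inner_sum]
  convert! HasDerivAt.fun_sum fun a ha => h a ha φ ψ t using 1
  rw [Finset.sum_add_distrib, ← Finset.mul_sum, Finset.sum_sub_distrib]

/-- The equation extends from the product vectors to the domain of the Hamiltonian. -/
theorem WeakSol.of_core [CompleteSpace H] (hK : IsSelfAdjoint K) (hΦ : IsSelfAdjoint Φ)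
    {A C : ℝ → Op n H} {M : ℝ} (hA : ∀ t, ‖A t‖ ≤ M) (hC : ∀ t, ‖C t‖ ≤ M)
    (h : ∀ p ∈ coreGraph K (potential Φ n), ∀ q ∈ coreGraph K (potential Φ n), ∀ t,
      HasDerivAt (fun τ => ⟪p.1, A τ q.1⟫_ℂ)
        (-Complex.I * (⟪p.1, A t q.2⟫_ℂ - ⟪p.2, A t q.1⟫_ℂ) + ⟪p.1, C t q.1⟫_ℂ) t) :
    WeakSol K Φ A C := by
  have hM0 : 0 ≤ M := (norm_nonneg _).trans (hA 0)
  set D : TensorPow (Fin n) H × TensorPow (Fin n) H → TensorPow (Fin n) H × TensorPow (Fin n) H →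
    ℝ → ℂ := fun p q t => -Complex.I * (⟪p.1, A t q.2⟫_ℂ - ⟪p.2, A t q.1⟫_ℂ) + ⟪p.1, C t q.1⟫_ℂ with hD
  set S : TensorPow (Fin n) H × TensorPow (Fin n) H → TensorPow (Fin n) H × TensorPow (Fin n) H →
    Prop := fun p q => ∀ t, HasDerivAt (fun τ => ⟪p.1, A τ q.1⟫_ℂ) (D p q t) t with hS
  have hspan : ∀ p ∈ Submodule.span ℂ (coreGraph K (potential Φ n)),
      ∀ q ∈ Submodule.span ℂ (coreGraph K (potential Φ n)), S p q := by
    intro p hp q hq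
    induction hp using Submodule.span_induction with
    | mem p hp =>
      induction hq using Submodule.span_induction with
      | mem q hq => exact h p hp q hq
      | zero => intro t; simpa [hD] using hasDerivAt_const t (0 : ℂ)
      | add q q' _ _ h1 h2 =>
        intro t
        convert! (h1 t).add (h2 t) using 1
        · funext τ; simp
        · simp only [hD, Prod.fst_add, Prod.snd_add, map_add, inner_add_right]; ring
      | smul c q _ h1 =>
        intro t
        convert! (h1 t).const_mul c using 1
        · funext τ; simp
        · simp only [hD, Prod.smul_fst, Prod.smul_snd, map_smul, inner_smul_right]; ring
    | zero => intro t; simpa [hD] using hasDerivAt_const t (0 : ℂ)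
    | add p p' _ _ h1 h2 =>
      intro t
      convert! (h1 t).add (h2 t) using 1
      · funext τ; simp
      · simp only [hD, Prod.fst_add, Prod.snd_add, inner_add_left]; ring
    | smul c q _ h1 =>
      intro t
      convert! (h1 t).const_mul (conj c) using 1
      · funext τ; simp [mul_comm]
      · simp only [hD, Prod.smul_fst, Prod.smul_snd, inner_smul_left]; ring
  have hbA : ∀ t (x y : TensorPow (Fin n) H), ‖⟪x, A t y⟫_ℂ‖ ≤ M * ‖x‖ * ‖y‖ := fun t x y => by
    refine (norm_inner_le_norm _ _).trans ?_
    have := mul_le_mul_of_nonneg_left ((A t).le_of_opNorm_le (hA t) y) (norm_nonneg x)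
    linarith
  have hbC : ∀ t (x y : TensorPow (Fin n) H), ‖⟪x, C t y⟫_ℂ‖ ≤ M * ‖x‖ * ‖y‖ := fun t x y => by
    refine (norm_inner_le_norm _ _).trans ?_
    have := mul_le_mul_of_nonneg_left ((C t).le_of_opNorm_le (hC t) y) (norm_nonneg x)
    linarith
  -- There are three matrix elements, each bounded by `M` times the graph norms. The bound is
  -- uniform in `t`, so the derivatives converge uniformly along sequences in the graph.
  have hDb : ∀ p q t, ‖D p q t‖ ≤ 3 * M * ‖p‖ * ‖q‖ := by
    intro p q t
    have hh : ∀ (x y : TensorPow (Fin n) H), ‖x‖ ≤ ‖p‖ → ‖y‖ ≤ ‖q‖ → M * ‖x‖ * ‖y‖ ≤ M * ‖p‖ * ‖q‖ :=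
      fun x y hx hy => by gcongr
    have h1 := (hbA t p.1 q.2).trans (hh _ _ (norm_fst_le p) (norm_snd_le q))
    have h2 := (hbA t p.2 q.1).trans (hh _ _ (norm_snd_le p) (norm_fst_le q))
    have h3 := (hbC t p.1 q.1).trans (hh _ _ (norm_fst_le p) (norm_fst_le q))
    refine (norm_add_le _ _).trans ?_
    rw [norm_mul, norm_neg, Complex.norm_I, one_mul]
    have h4 := norm_sub_le (⟪p.1, A t q.2⟫_ℂ) (⟪p.2, A t q.1⟫_ℂ)
    linarith
  have hclosed : ∀ p q, (∃ x y : ℕ → _, (∀ k, S (x k) (y k)) ∧ Tendsto x atTop (𝓝 p) ∧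
      Tendsto y atTop (𝓝 q)) → S p q := by
    rintro p q ⟨x, y, hxy, hx, hy⟩ t
    refine hasDerivAt_of_tendstoUniformly (f := fun k τ => ⟪(x k).1, A τ (y k).1⟫_ℂ)
      (f' := fun k τ => D (x k) (y k) τ) (l := atTop) ?_
      (Eventually.of_forall fun k τ => hxy k τ) (fun τ => ?_) t
    · have hlim : Tendsto (fun k => 3 * M * ‖p - x k‖ * ‖y k‖ + 3 * M * ‖p‖ * ‖q - y k‖) atTop (𝓝 0) := by
        have h1 : Tendsto (fun k => ‖p - x k‖) atTop (𝓝 0) := by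
          simpa using (tendsto_const_nhds.sub hx : Tendsto (fun n => p - x n) atTop _).norm
        have h2 : Tendsto (fun k => ‖q - y k‖) atTop (𝓝 0) := by
          simpa using (tendsto_const_nhds.sub hy : Tendsto (fun n => q - y n) atTop _).norm
        simpa using ((h1.const_mul (3 * M)).mul hy.norm).add (h2.const_mul (3 * M * ‖p‖))
      rw [Metric.tendstoUniformly_iff]
      intro ε hε
      filter_upwards [hlim.eventually (gt_mem_nhds hε)] with k hk τ
      refine lt_of_le_of_lt ?_ hk
      rw [dist_eq_norm]
      have : D p q τ - D (x k) (y k) τ = D (p - x k) (y k) τ + D p (q - y k) τ := by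
        simp only [hD, Prod.fst_sub, Prod.snd_sub, map_sub, inner_sub_left, inner_sub_right]; ring
      rw [this]
      exact (norm_add_le _ _).trans (add_le_add (hDb _ _ _) (hDb _ _ _))
    · have h1 : Tendsto (fun k => (x k).1) atTop (𝓝 p.1) := (continuous_fst.tendsto p).comp hx
      have h2 : Tendsto (fun k => (y k).1) atTop (𝓝 q.1) := (continuous_fst.tendsto q).comp hy
      exact h1.inner (((A τ).continuous.tendsto _).comp h2)
  intro φ ψ t
  have hφ := (ham K Φ n).mem_graph φ
  have hψ := (ham K Φ n).mem_graph ψ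
  rw [ham_graph hK hΦ] at hφ hψ
  obtain ⟨x, hx, hxφ⟩ := mem_closure_iff_seq_limit.mp hφ
  obtain ⟨y, hy, hyψ⟩ := mem_closure_iff_seq_limit.mp hψ
  exact hclosed _ _ ⟨x, y, fun k => hspan _ (hx k) _ (hy k), hxφ, hyψ⟩ t

variable [CompleteSpace H]

/-- Uniqueness for the homogeneous Heisenberg equation. -/
theorem WeakSol.eq_zero (hK : IsSelfAdjoint K) (hΦ : IsSelfAdjoint Φ) {A C : ℝ → Op n H}
    (h : WeakSol K Φ A C) (hC : ∀ t, C t = 0) (hA : WeakCont A) (h0 : A 0 = 0) (t : ℝ) : A t = 0 := by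
  have hU := expI_ham hK hΦ n
  set U := expI (ham K Φ n)
  have hdom : ∀ (x : (ham K Φ n).domain) t, U t x ∈ (ham K Φ n).domain := fun x t =>
    LinearPMap.mem_domain_of_mem_graph (hU.mem_graph x t)
  have hHU : ∀ (x : (ham K Φ n).domain) t, ham K Φ n ⟨U t x, hdom x t⟩ = U t (ham K Φ n x) := by
    intro x t
    obtain ⟨y, hy, hy'⟩ := (LinearPMap.mem_graph_iff _).mp (hU.mem_graph x t)
    exact (congrArg (ham K Φ n) (Subtype.ext hy.symm)).trans hy'
  -- The moving vectors stay in the domain, so the weak equation applies to them at each time; the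
  -- derivatives of the vectors cancel the commutator term.
  have hd : ∀ (φ ψ : (ham K Φ n).domain) t, HasDerivAt (fun τ => ⟪U τ φ, A τ (U τ ψ)⟫_ℂ) 0 t := by
    intro φ ψ t
    have h1 := h ⟨_, hdom φ t⟩ ⟨_, hdom ψ t⟩ t
    have h2 := hA.hasDerivAt_inner (hU.hasDerivAt φ t) (hU.hasDerivAt ψ t) h1
    convert! h2 using 1
    rw [hHU, hHU, hC, zero_apply, inner_zero_right, map_smul, inner_smul_left, inner_smul_right,
      Complex.conj_I]
    ring
  have hz : ∀ (φ ψ : (ham K Φ n).domain) t, ⟪U t φ, A t (U t ψ)⟫_ℂ = 0 := by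
    intro φ ψ t
    have h1 := is_const_of_deriv_eq_zero (fun t => (hd φ ψ t).differentiableAt)
      (fun t => (hd φ ψ t).deriv) t 0
    rw [h0] at h1
    simpa using h1
  have hz' : ∀ (φ ψ : (ham K Φ n).domain), ⟪(φ : TensorPow (Fin n) H), A t ψ⟫_ℂ = 0 := by
    intro φ ψ
    have := hz ⟨_, hdom φ (-t)⟩ ⟨_, hdom ψ (-t)⟩ t
    rwa [← mul_apply_eq_comp (U t), ← mul_apply_eq_comp (U t), hU.mul_neg] at this
  have hdense := ham_dense hK hΦ n
  refine ContinuousLinearMap.ext_on (s := ((ham K Φ n).domain : Set _)) ?_ fun ψ hψ => ?_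
  · rw [Submodule.span_eq]; exact hdense
  · exact hdense.eq_zero_of_inner_right ℂ fun φ hφ => hz' ⟨φ, hφ⟩ ⟨ψ, hψ⟩

/-- The Heisenberg evolution `e^{itH_n} a e^{-itH_n}`. -/
def evol (K : H →ₗ.[ℂ] H) (Φ : Op 2 H) {n : ℕ} (a : Op n H) (t : ℝ) : Op n H :=
  expI (ham K Φ n) t * a * expI (ham K Φ n) (-t)

theorem inner_evol (hK : IsSelfAdjoint K) (hΦ : IsSelfAdjoint Φ) (a : Op n H) (t : ℝ)
    (φ ψ : TensorPow (Fin n) H) :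
    ⟪φ, evol K Φ a t ψ⟫_ℂ = ⟪expI (ham K Φ n) (-t) φ, a (expI (ham K Φ n) (-t) ψ)⟫_ℂ := by
  rw [evol, ← (expI_ham hK hΦ n).star_eq t, ContinuousLinearMap.star_eq_adjoint,
    ContinuousLinearMap.adjoint_inner_left]
  rfl

theorem evol_zero (hK : IsSelfAdjoint K) (hΦ : IsSelfAdjoint Φ) (a : Op n H) : evol K Φ a 0 = a := by
  rw [evol, neg_zero, (expI_ham hK hΦ n).map_zero, one_mul, mul_one]

theorem norm_evol_le (hK : IsSelfAdjoint K) (hΦ : IsSelfAdjoint Φ) (a : Op n H) (t : ℝ) :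
    ‖evol K Φ a t‖ ≤ ‖a‖ := by
  have hU := expI_ham hK hΦ n
  refine ContinuousLinearMap.opNorm_le_bound _ (norm_nonneg _) fun x => ?_
  change ‖expI (ham K Φ n) t (a (expI (ham K Φ n) (-t) x))‖ ≤ _
  rw [hU.norm_apply]
  exact (a.le_opNorm _).trans (by rw [hU.norm_apply])

theorem isSelfAdjoint_evol (hK : IsSelfAdjoint K) (hΦ : IsSelfAdjoint Φ) {a : Op n H}
    (ha : IsSelfAdjoint a) (t : ℝ) : IsSelfAdjoint (evol K Φ a t) := by
  have hU := expI_ham hK hΦ n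
  rw [isSelfAdjoint_iff, evol, star_mul, star_mul, hU.star_eq, hU.star_eq, ha.star_eq, neg_neg,
    mul_assoc]

theorem weakCont_evol (hK : IsSelfAdjoint K) (hΦ : IsSelfAdjoint Φ) (a : Op n H) :
    WeakCont (evol K Φ a) := by
  have hU := expI_ham hK hΦ n
  intro φ ψ
  simp only [inner_evol hK hΦ]
  have h1 : ∀ x, Continuous fun t => expI (ham K Φ n) (-t) x := fun x =>
    (hU.strongly_continuous x).comp continuous_neg
  exact (h1 φ).inner (a.continuous.comp (h1 ψ))

/-- By `inner_evol` the time dependence sits in the two vectors alone, which are differentiable in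
norm when `φ` and `ψ` lie in the domain. -/
theorem weakSol_evol (hK : IsSelfAdjoint K) (hΦ : IsSelfAdjoint Φ) (a : Op n H) :
    WeakSol K Φ (evol K Φ a) 0 := by
  have hU := expI_ham hK hΦ n
  intro φ ψ t
  simp only [inner_evol hK hΦ]
  have h1 : ∀ x : (ham K Φ n).domain, HasDerivAt (fun τ => expI (ham K Φ n) (-τ) x)
      (-(Complex.I • expI (ham K Φ n) (-t) (ham K Φ n x))) t := by
    intro x
    have := (hU.hasDerivAt x (-t)).scomp t (hasDerivAt_neg t)
    simpa [Function.comp_def] using this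
  have h2 := (a.restrictScalars ℝ).hasFDerivAt.comp_hasDerivAt t (h1 ψ)
  have h3 := (h1 φ).inner ℂ h2
  convert! h3 using 1
  simp only [Pi.zero_apply, zero_apply, inner_zero_right, add_zero, ContinuousLinearMap.coe_restrictScalars',
    map_neg, map_smul, inner_neg_left, inner_neg_right, inner_smul_left, inner_smul_right,
    Complex.conj_I, Function.comp_apply]
  ring

end Heisenberg
end
end QuantumHierarchy

namespace QuantumHierarchy
open scoped ComplexOrder InnerProductSpace ComplexConjugate
open Filter Topology
noncomputable section

/-! ### Embedding solutions into systems with more particles. -/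

section Embedding
variable {H : Type*} [NormedAddCommGroup H] [InnerProductSpace ℂ H]
variable {K : H →ₗ.[ℂ] H} {Φ : Op 2 H} {n s : ℕ}

theorem inner_insertVec_insertVec (e : Fin n ↪ Fin s) (x y : Fin s → H)
    (v w : TensorPow (Fin n) H) :
    ⟪insertVec e x v, insertVec e y w⟫_ℂ = (∏ i ∈ (Finset.univ.map e)ᶜ, ⟪x i, y i⟫_ℂ) * ⟪v, w⟫_ℂ := by
  rw [inner_insertVec]
  congr 1
  exact (Finset.prod_subtype _ (fun i => by simp) fun i => ⟪x i, y i⟫_ℂ).symm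

theorem inner_ampl_insertVec (e : Fin n ↪ Fin s) (b : Op n H) (x y : Fin s → H)
    (w : TensorPow (Fin n) H) :
    ⟪(pureTensor x : TensorPow (Fin s) H), ampl e b (insertVec e y w)⟫_ℂ =
      (∏ i ∈ (Finset.univ.map e)ᶜ, ⟪x i, y i⟫_ℂ) * ⟪pureTensor (x ∘ e), b w⟫_ℂ := by
  rw [ampl_insertVec, ← insertVec_comp_self e x, inner_insertVec_insertVec]

theorem inner_ampl_pureTensor (e : Fin n ↪ Fin s) (b : Op n H) (x y : Fin s → H) :
    ⟪(pureTensor x : TensorPow (Fin s) H), ampl e b (pureTensor y)⟫_ℂ =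
      (∏ i ∈ (Finset.univ.map e)ᶜ, ⟪x i, y i⟫_ℂ) *
        ⟪pureTensor (x ∘ e), b (pureTensor (y ∘ e))⟫_ℂ := by
  rw [← insertVec_comp_self e y, inner_ampl_insertVec]

theorem inner_insertVec_ampl (e : Fin n ↪ Fin s) (b : Op n H) (x y : Fin s → H)
    (w : TensorPow (Fin n) H) :
    ⟪insertVec e x w, ampl e b (pureTensor y)⟫_ℂ =
      (∏ i ∈ (Finset.univ.map e)ᶜ, ⟪x i, y i⟫_ℂ) * ⟪w, b (pureTensor (y ∘ e))⟫_ℂ := by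
  rw [ampl_pureTensor, inner_insertVec_insertVec]

theorem insertVec_kinetic (e : Fin n ↪ Fin s) (y : Fin s → K.domain) :
    insertVec e (fun i => (y i : H)) (kinetic K (y ∘ e)) =
      ∑ j ∈ Finset.univ.map e, pureTensor (Function.update (fun i => (y i : H)) j (K (y j))) := by
  rw [kinetic, map_sum, Finset.sum_map]
  refine Finset.sum_congr rfl fun k _ => ?_
  rw [insertVec_pureTensor]
  congr 1
  ext i
  by_cases hi : ∃ k, e k = i
  · obtain ⟨j, rfl⟩ := hi
    rw [e.injective.extend_apply]
    rcases eq_or_ne j k with rfl | h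
    · simp
    · rw [Function.update_of_ne h, Function.update_of_ne (e.injective.ne h)]; rfl
  · rw [Function.extend_apply' _ _ _ hi, Function.update_of_ne]
    rintro rfl; exact hi ⟨k, rfl⟩

/-- The kinetic energy of the particles outside of the range of `e`. -/
def kineticOutside (e : Fin n ↪ Fin s) (y : Fin s → K.domain) : TensorPow (Fin s) H :=
  ∑ j ∈ (Finset.univ.map e)ᶜ, pureTensor (Function.update (fun i => (y i : H)) j (K (y j)))

theorem kinetic_eq (e : Fin n ↪ Fin s) (y : Fin s → K.domain) :
    kinetic K y = insertVec e (fun i => (y i : H)) (kinetic K (y ∘ e)) + kineticOutside e y := by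
  rw [insertVec_kinetic, kineticOutside, Finset.sum_add_sum_compl, kinetic]

variable [CompleteSpace H]

/-- `ampl e b` acts as the identity at a label outside the range of `e`, so its matrix elements
contain the plain factor `⟪x j, y j⟫`, across which the symmetric `K` can be moved. Thus the
unbounded kinetic energy of the other particles makes no contribution to the commutator. -/
theorem inner_ampl_kineticOutside (hK : IsSelfAdjoint K) (e : Fin n ↪ Fin s) (b : Op n H)
    (x y : Fin s → K.domain) :
    ⟪(pureTensor (fun i => (x i : H)) : TensorPow (Fin s) H), ampl e b (kineticOutside e y)⟫_ℂ =
      ⟪kineticOutside e x, ampl e b (pureTensor (fun i => (y i : H)))⟫_ℂ := by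
  classical
  simp only [kineticOutside, map_sum, inner_sum, sum_inner]
  refine Finset.sum_congr rfl fun j hj => ?_
  have hj' : ∀ k, e k ≠ j := by
    intro k hk
    simp only [Finset.mem_compl, Finset.mem_map, Finset.mem_univ, true_and, not_exists] at hj
    exact hj k hk
  rw [inner_ampl_pureTensor, inner_ampl_pureTensor]
  have hu : ∀ (z : Fin s → H) a, Function.update z j a ∘ e = z ∘ e := by
    intro z a; ext k; simp [Function.update_of_ne (hj' k)]
  rw [hu, hu]
  congr 1
  refine Finset.prod_congr rfl fun i _ => ?_
  rcases eq_or_ne i j with h | h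
  · rw [h, Function.update_self, Function.update_self, inner_map_of_isSelfAdjoint hK]
  · rw [Function.update_of_ne h, Function.update_of_ne h]

theorem exists_ham_pureTensor (hK : IsSelfAdjoint K) (hΦ : IsSelfAdjoint Φ) (x : Fin n → K.domain) :
    ∃ φ : (ham K Φ n).domain, (φ : TensorPow (Fin n) H) = pureTensor (fun i => (x i : H)) ∧
      ham K Φ n φ = kinetic K x + potential Φ n (pureTensor (fun i => (x i : H))) := by
  have h : (pureTensor (fun i => (x i : H)),
      kinetic K x + potential Φ n (pureTensor (fun i => (x i : H)))) ∈ (ham K Φ n).graph := by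
    rw [ham_graph hK hΦ]
    exact Submodule.le_topologicalClosure _ (Submodule.subset_span ⟨x, rfl⟩)
  exact (LinearPMap.mem_graph_iff _).mp h

/-- The interactions that do not act inside of the range of `e` only. -/
def restPotential (Φ : Op 2 H) (e : Fin n ↪ Fin s) : Op s H := potential Φ s - ampl e (potential Φ n)

theorem isSelfAdjoint_restPotential (hΦ : IsSelfAdjoint Φ) (e : Fin n ↪ Fin s) :
    IsSelfAdjoint (restPotential Φ e) := by
  refine (isSelfAdjoint_potential hΦ s).sub ?_
  rw [isSelfAdjoint_iff, ← ampl_star, (isSelfAdjoint_potential hΦ n).star_eq]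

/-- A solution of the Heisenberg equation of `n` particles, as an observable of `s` particles. -/
theorem WeakSol.ampl (hK : IsSelfAdjoint K) (hΦ : IsSelfAdjoint Φ) {A : ℝ → Op n H} {M : ℝ}
    (hM : ∀ t, ‖A t‖ ≤ M) (h : WeakSol K Φ A 0) (e : Fin n ↪ Fin s) :
    WeakSol K Φ (fun t => QuantumHierarchy.ampl e (A t)) (fun t =>
      Complex.I • (QuantumHierarchy.ampl e (A t) * restPotential Φ e -
        restPotential Φ e * QuantumHierarchy.ampl e (A t))) := by
  classical
  have hM0 : 0 ≤ M := (norm_nonneg _).trans (hM 0)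
  set P := restPotential Φ e with hP
  have hb : ∀ t, ‖QuantumHierarchy.ampl e (A t)‖ ≤ M := fun t => (norm_ampl_le _ _).trans (hM t)
  -- One constant has to bound both the family and its source.
  refine WeakSol.of_core hK hΦ (M := M + (M * ‖P‖ + ‖P‖ * M))
    (fun t => (hb t).trans (by nlinarith [norm_nonneg P])) (fun t => ?_) ?_
  · rw [norm_smul, Complex.norm_I, one_mul]
    have h1 : ‖QuantumHierarchy.ampl e (A t) * P‖ ≤ M * ‖P‖ :=
      (norm_mul_le _ _).trans (mul_le_mul_of_nonneg_right (hb t) (norm_nonneg _))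
    have h2 : ‖P * QuantumHierarchy.ampl e (A t)‖ ≤ ‖P‖ * M :=
      (norm_mul_le _ _).trans (mul_le_mul_of_nonneg_left (hb t) (norm_nonneg _))
    have := norm_sub_le (QuantumHierarchy.ampl e (A t) * P) (P * QuantumHierarchy.ampl e (A t))
    linarith
  · rintro _ ⟨x, rfl⟩ _ ⟨y, rfl⟩ t
    obtain ⟨φ, hφ, hφ'⟩ := exists_ham_pureTensor hK hΦ (x ∘ e)
    obtain ⟨ψ, hψ, hψ'⟩ := exists_ham_pureTensor hK hΦ (y ∘ e)
    have h1 := (h φ ψ t).const_mul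
      (∏ i ∈ (Finset.univ.map e)ᶜ, ⟪(x i : H), (y i : H)⟫_ℂ)
    rw [hφ, hψ, hφ', hψ'] at h1
    simp only [inner_ampl_pureTensor]
    convert! h1 using 1
    have hPadj : ∀ u v : TensorPow (Fin s) H, ⟪u, P v⟫_ℂ = ⟪P u, v⟫_ℂ := fun u v => by
      conv_lhs => rw [hP, ← (isSelfAdjoint_restPotential hΦ e).star_eq]
      rw [ContinuousLinearMap.star_eq_adjoint, ContinuousLinearMap.adjoint_inner_right]
    have hpot : ∀ y : Fin s → K.domain, potential Φ s (pureTensor (fun i => (y i : H))) =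
        insertVec e (fun i => (y i : H)) (potential Φ n (pureTensor (fun i => ((y ∘ e) i : H)))) +
          P (pureTensor (fun i => (y i : H))) := by
      intro y
      have : potential Φ s = QuantumHierarchy.ampl e (potential Φ n) + P := by
        rw [hP, restPotential]; abel
      rw [this, add_apply, ampl_pureTensor]
      rfl
    rw [hpot x, hpot y, kinetic_eq e x, kinetic_eq e y]
    simp only [map_add, inner_add_left, inner_add_right, inner_ampl_insertVec, inner_insertVec_ampl,
      inner_ampl_kineticOutside hK, smul_apply, sub_apply, mul_apply_eq_comp, inner_smul_right,
      inner_sub_right, hPadj, Pi.zero_apply, zero_apply, inner_zero_right]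
    simp only [Function.comp_def]
    ring

theorem pairOp_self (Φ : Op 2 H) (i : Fin n) : pairOp Φ i i = 0 := by
  rw [pairOp, dif_neg (by simp)]

theorem pairOp_comm (hΦs : IsSymm Φ) (i j : Fin n) : pairOp Φ i j = pairOp Φ j i := by
  by_cases h : i = j
  · rw [h]
  · rw [pairOp, pairOp, dif_pos h, dif_pos (Ne.symm h)]
    refine ampl_eq_of_range_eq hΦs ?_
    change Set.range ![i, j] = Set.range ![j, i]
    simp [Set.pair_comm]

theorem ampl_pairOp (Φ : Op 2 H) (e : Fin n ↪ Fin s) (i j : Fin n) :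
    ampl e (pairOp Φ i j) = pairOp Φ (e i) (e j) := by
  by_cases h : i = j
  · rw [h, pairOp_self, pairOp_self, ampl_zero]
  · rw [pairOp, pairOp, dif_pos h, dif_pos (e.injective.ne h), ampl_ampl]
    congr 1
    ext k
    fin_cases k <;> rfl

/-- An embedding need not preserve the order of labels, so the condition `i < j` behaves badly under
it. Summing over all ordered pairs counts each interaction twice, by exchange symmetry, and is free
of the order. -/
theorem potential_eq (hΦs : IsSymm Φ) (n : ℕ) :
    (2 : ℂ) • potential Φ n = ∑ i : Fin n, ∑ j : Fin n, pairOp Φ i j := by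
  have h1 : ∑ i : Fin n, ∑ j : Fin n, pairOp Φ i j =
      (∑ i : Fin n, ∑ j ∈ Finset.univ.filter (fun j => i < j), pairOp Φ i j) +
        ∑ i : Fin n, ∑ j ∈ Finset.univ.filter (fun j => j < i), pairOp Φ i j := by
    rw [← Finset.sum_add_distrib]
    refine Finset.sum_congr rfl fun i _ => ?_
    rw [Finset.sum_filter, Finset.sum_filter, ← Finset.sum_add_distrib]
    refine Finset.sum_congr rfl fun j _ => ?_
    rcases lt_trichotomy i j with h | h | h
    · simp [h, h.not_gt]
    · simp [h, pairOp_self]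
    · simp [h, h.not_gt]
  have h2 : ∑ i : Fin n, ∑ j ∈ Finset.univ.filter (fun j => j < i), pairOp Φ i j = potential Φ n := by
    rw [potential]
    simp only [Finset.sum_filter]
    rw [Finset.sum_comm]
    simp only [pairOp_comm hΦs]
  rw [h1, h2, two_smul]
  rfl

theorem two_smul_restPotential (hΦs : IsSymm Φ) (e : Fin n ↪ Fin s) :
    (2 : ℂ) • restPotential Φ e = ∑ i : Fin s, ∑ j : Fin s,
      if i ∈ Finset.univ.map e ∧ j ∈ Finset.univ.map e then 0 else pairOp Φ i j := by
  rw [restPotential, smul_sub, ← ampl_smul, potential_eq hΦs, potential_eq hΦs, ampl_sum]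
  simp only [ampl_sum, ampl_pairOp]
  have h1 : ∑ i : Fin n, ∑ j : Fin n, pairOp Φ (e i) (e j) = ∑ i : Fin s, ∑ j : Fin s,
      if i ∈ Finset.univ.map e ∧ j ∈ Finset.univ.map e then pairOp Φ i j else 0 := by
    rw [← Finset.sum_map Finset.univ e (fun i => ∑ j, pairOp Φ i (e j)),
      ← Finset.sum_filter_add_sum_filter_not Finset.univ (fun i => i ∈ Finset.univ.map e)
        (fun i => ∑ j : Fin s, if i ∈ Finset.univ.map e ∧ j ∈ Finset.univ.map e then pairOp Φ i j else 0)]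
    have hz : ∑ i ∈ Finset.univ.filter (fun i => ¬ i ∈ Finset.univ.map e), ∑ j : Fin s,
        (if i ∈ Finset.univ.map e ∧ j ∈ Finset.univ.map e then pairOp Φ i j else 0) = 0 := by
      refine Finset.sum_eq_zero fun i hi => Finset.sum_eq_zero fun j _ => ?_
      rw [if_neg]
      exact fun h => (Finset.mem_filter.mp hi).2 h.1
    rw [hz, add_zero, Finset.filter_mem_eq_inter, Finset.univ_inter]
    refine Finset.sum_congr rfl fun i hi => ?_
    rw [← Finset.sum_map Finset.univ e (fun j => pairOp Φ i j)]
    simp only [hi, true_and]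
    rw [← Finset.sum_filter, Finset.filter_mem_eq_inter, Finset.univ_inter]
  rw [h1, ← Finset.sum_sub_distrib]
  refine Finset.sum_congr rfl fun i _ => ?_
  rw [← Finset.sum_sub_distrib]
  refine Finset.sum_congr rfl fun j _ => ?_
  split_ifs <;> simp

theorem weakCont_ampl {A : ℝ → Op n H} {M : ℝ} (hM : ∀ t, ‖A t‖ ≤ M) (hA : WeakCont A)
    (e : Fin n ↪ Fin s) : WeakCont fun t => ampl e (A t) := by
  classical
  refine WeakCont.of_dense (fun t => (norm_ampl_le e _).trans (hM t)) dense_span_pureTensor ?_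
  rintro _ ⟨x, rfl⟩ _ ⟨y, rfl⟩
  simp only [inner_ampl_pureTensor]
  exact (hA _ _).const_mul _

/-- A permutation leaves no pair outside its range, so the rest potential vanishes. The permuted and
the original evolution then solve the same homogeneous equation with the same initial value. -/
theorem isSymm_evol (hK : IsSelfAdjoint K) (hΦ : IsSelfAdjoint Φ) (hΦs : IsSymm Φ) {a : Op n H}
    (ha : IsSymm a) (t : ℝ) : IsSymm (evol K Φ a t) := by
  intro σ
  have hM := norm_evol_le hK hΦ a
  have hP : restPotential Φ σ.toEmbedding = 0 := by
    have := two_smul_restPotential hΦs σ.toEmbedding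
    simpa using this
  have h1 := (weakSol_evol hK hΦ a).ampl hK hΦ hM σ.toEmbedding
  have h2 := h1.sub (weakSol_evol hK hΦ a)
  have h3 := h2.eq_zero hK hΦ (by simp [hP])
    ((weakCont_ampl hM (weakCont_evol hK hΦ a) _).sub (weakCont_evol hK hΦ a))
    (by simp only [evol_zero hK hΦ, ha σ, sub_self]) t
  exact sub_eq_zero.mp h3

end Embedding
end
end QuantumHierarchy

namespace QuantumHierarchy
noncomputable section

/-! ### Combinatorics of set partitions, cumulants and Möbius inversion. -/

section Partitions
variable {α : Type*} [DecidableEq α]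

/-- The partitions of a finite set, as sets of blocks. -/
def partsOf (Q : Finset α) : Finset (Finset (Finset α)) :=
  (Finset.univ : Finset (Finpartition Q)).image Finpartition.parts

/-- Replacing `Finpartition Q` by plain sets of blocks removes the dependence of the type on `Q`,
which matters when a block is split off. -/
theorem sum_finpartition {M : Type*} [AddCommMonoid M] (Q : Finset α) (F : Finset (Finset α) → M) :
    ∑ P : Finpartition Q, F P.parts = ∑ B ∈ partsOf Q, F B := by
  rw [partsOf, Finset.sum_image]
  intro P _ P' _ h
  exact Finpartition.ext h

theorem mem_partsOf {Q : Finset α} {B : Finset (Finset α)} :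
    B ∈ partsOf Q ↔ ∅ ∉ B ∧ (B : Set (Finset α)).PairwiseDisjoint id ∧ B.sup id = Q := by
  constructor
  · intro h
    obtain ⟨P, _, rfl⟩ := Finset.mem_image.mp h
    exact ⟨P.bot_notMem, P.disjoint, P.sup_parts⟩
  · rintro ⟨h1, h2, h3⟩
    exact Finset.mem_image.mpr
      ⟨⟨B, Finset.supIndep_iff_pairwiseDisjoint.mpr h2, h3, h1⟩, Finset.mem_univ _, rfl⟩

theorem subset_of_mem_partsOf {Q : Finset α} {B : Finset (Finset α)} (h : B ∈ partsOf Q)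
    {C : Finset α} (hC : C ∈ B) : C ⊆ Q := by
  rw [← (mem_partsOf.mp h).2.2]
  exact Finset.le_sup (f := id) hC

theorem nonempty_of_mem_partsOf {Q : Finset α} {B : Finset (Finset α)} (h : B ∈ partsOf Q)
    {C : Finset α} (hC : C ∈ B) : C.Nonempty := by
  rw [Finset.nonempty_iff_ne_empty]
  rintro rfl
  exact (mem_partsOf.mp h).1 hC

theorem disjoint_of_mem_partsOf {Q : Finset α} {B : Finset (Finset α)} (h : B ∈ partsOf Q)
    {C D : Finset α} (hC : C ∈ B) (hD : D ∈ B) (hCD : C ≠ D) : Disjoint C D :=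
  (mem_partsOf.mp h).2.1 hC hD hCD

theorem exists_mem_of_mem_partsOf {Q : Finset α} {B : Finset (Finset α)} (h : B ∈ partsOf Q)
    {a : α} (ha : a ∈ Q) : ∃ C ∈ B, a ∈ C := by
  rw [← (mem_partsOf.mp h).2.2, Finset.mem_sup] at ha
  exact ha

theorem notMem_of_mem_partsOf_sdiff {Q D : Finset α} (hD : D.Nonempty) {B : Finset (Finset α)}
    (h : B ∈ partsOf (Q \ D)) : D ∉ B := fun hmem => by
  have h1 := subset_of_mem_partsOf h hmem
  obtain ⟨x, hx⟩ := hD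
  exact (Finset.mem_sdiff.mp (h1 hx)).2 hx

theorem insert_mem_partsOf {Q D : Finset α} (hDQ : D ⊆ Q) (hD : D.Nonempty) {B : Finset (Finset α)}
    (h : B ∈ partsOf (Q \ D)) : insert D B ∈ partsOf Q := by
  have h' := mem_partsOf.mp h
  refine mem_partsOf.mpr ⟨?_, ?_, ?_⟩
  · rw [Finset.mem_insert, not_or]
    exact ⟨fun h => hD.ne_empty h.symm, h'.1⟩
  · rw [Finset.coe_insert]
    refine h'.2.1.insert fun C hC _ => ?_
    exact Finset.disjoint_sdiff.mono_right (subset_of_mem_partsOf h hC)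
  · rw [Finset.sup_insert, h'.2.2]
    exact Finset.union_sdiff_of_subset hDQ

theorem erase_mem_partsOf {Q D : Finset α} {B : Finset (Finset α)}
    (h : B ∈ partsOf Q) (hD : D ∈ B) : B.erase D ∈ partsOf (Q \ D) := by
  have h' := mem_partsOf.mp h
  refine mem_partsOf.mpr ⟨fun he => h'.1 (Finset.mem_of_mem_erase he), ?_, ?_⟩
  · exact h'.2.1.subset (Finset.coe_subset.mpr (Finset.erase_subset _ _))
  · ext x
    rw [Finset.mem_sup, Finset.mem_sdiff]
    constructor
    · rintro ⟨C, hC, hx⟩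
      refine ⟨subset_of_mem_partsOf h (Finset.mem_of_mem_erase hC) hx, fun hxD => ?_⟩
      exact Finset.disjoint_left.mp
        (disjoint_of_mem_partsOf h (Finset.mem_of_mem_erase hC) hD (Finset.ne_of_mem_erase hC)) hx hxD
    · rintro ⟨hx, hxD⟩
      obtain ⟨C, hC, hxC⟩ := exists_mem_of_mem_partsOf h hx
      exact ⟨C, Finset.mem_erase.mpr ⟨by rintro rfl; exact hxD hxC, hC⟩, hxC⟩

/-- Choosing a partition and one of its blocks amounts to choosing the block and a partition of the
rest. -/
theorem sum_partsOf_block {M : Type*} [AddCommMonoid M] (Q : Finset α)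
    (F : Finset (Finset α) → Finset α → M) :
    ∑ B ∈ partsOf Q, ∑ D ∈ B, F B D =
      ∑ D ∈ Q.powerset.filter (fun D => D.Nonempty), ∑ B ∈ partsOf (Q \ D), F (insert D B) D := by
  rw [Finset.sum_sigma', Finset.sum_sigma']
  refine Finset.sum_bij' (fun x _ => ⟨x.2, x.1.erase x.2⟩) (fun x _ => ⟨insert x.1 x.2, x.1⟩)
    ?_ ?_ ?_ ?_ ?_
  · rintro ⟨B, D⟩ h
    obtain ⟨h1, h2⟩ := Finset.mem_sigma.mp h
    exact Finset.mem_sigma.mpr ⟨Finset.mem_filter.mpr ⟨Finset.mem_powerset.mpr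
      (subset_of_mem_partsOf h1 h2), nonempty_of_mem_partsOf h1 h2⟩, erase_mem_partsOf h1 h2⟩
  · rintro ⟨D, B⟩ h
    obtain ⟨h1, h2⟩ := Finset.mem_sigma.mp h
    obtain ⟨h3, h4⟩ := Finset.mem_filter.mp h1
    exact Finset.mem_sigma.mpr ⟨insert_mem_partsOf (Finset.mem_powerset.mp h3) h4 h2,
      Finset.mem_insert_self _ _⟩
  · rintro ⟨B, D⟩ h
    obtain ⟨h1, h2⟩ := Finset.mem_sigma.mp h
    simp only
    rw [Finset.insert_erase h2]
  · rintro ⟨D, B⟩ h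
    obtain ⟨h1, h2⟩ := Finset.mem_sigma.mp h
    simp only
    rw [Finset.erase_insert (notMem_of_mem_partsOf_sdiff (Finset.mem_filter.mp h1).2 h2)]
  · rintro ⟨B, D⟩ h
    obtain ⟨h1, h2⟩ := Finset.mem_sigma.mp h
    simp only
    rw [Finset.insert_erase h2]

/-- Exactly one block contains `a`. -/
theorem sum_block_of_mem {M : Type*} [AddCommMonoid M] {Q : Finset α} {B : Finset (Finset α)}
    (h : B ∈ partsOf Q) {a : α} (ha : a ∈ Q) (x : M) : ∑ D ∈ B, (if a ∈ D then x else 0) = x := by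
  obtain ⟨C, hC, haC⟩ := exists_mem_of_mem_partsOf h ha
  rw [Finset.sum_eq_single C, if_pos haC]
  · intro D hD hDC
    rw [if_neg]
    exact fun haD => Finset.disjoint_left.mp (disjoint_of_mem_partsOf h hD hC hDC) haD haC
  · exact fun h => absurd hC h

/-- The sum over partitions, organised by the block that contains a given element. -/
theorem sum_partsOf_of_mem {M : Type*} [AddCommMonoid M] {Q : Finset α} {a : α} (ha : a ∈ Q)
    (F : Finset (Finset α) → M) :
    ∑ B ∈ partsOf Q, F B =
      ∑ D ∈ Q.powerset.filter (fun D => a ∈ D), ∑ B ∈ partsOf (Q \ D), F (insert D B) := by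
  have h1 : ∑ B ∈ partsOf Q, F B = ∑ B ∈ partsOf Q, ∑ D ∈ B, (if a ∈ D then F B else 0) :=
    Finset.sum_congr rfl fun B h => (sum_block_of_mem h ha (F B)).symm
  rw [h1, sum_partsOf_block Q fun B D => if a ∈ D then F B else 0, Finset.sum_filter,
    Finset.sum_filter]
  refine Finset.sum_congr rfl fun D _ => ?_
  by_cases haD : a ∈ D
  · simp only [haD, if_true]
    rw [if_pos ⟨a, haD⟩]
  · simp [haD]

theorem partsOf_empty : partsOf (∅ : Finset α) = {∅} := by
  ext B
  rw [mem_partsOf, Finset.mem_singleton]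
  constructor
  · rintro ⟨h1, _, h3⟩
    rw [Finset.eq_empty_iff_forall_notMem]
    intro C hC
    have : C ⊆ B.sup id := Finset.le_sup (f := id) hC
    rw [h3, Finset.subset_empty] at this
    exact h1 (this ▸ hC)
  · rintro rfl
    simp

theorem singleton_mem_partsOf {Q : Finset α} (hQ : Q.Nonempty) : {Q} ∈ partsOf Q :=
  mem_partsOf.mpr ⟨by rw [Finset.mem_singleton]; exact hQ.ne_empty.symm, by simp, by simp⟩

theorem eq_singleton_of_mem_partsOf {Q : Finset α} {B : Finset (Finset α)}
    (h : B ∈ partsOf Q) (hmem : Q ∈ B) : B = {Q} := by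
  refine Finset.eq_singleton_iff_unique_mem.mpr ⟨hmem, fun C hC => ?_⟩
  by_contra hne
  have h1 := disjoint_of_mem_partsOf h hC hmem hne
  have h2 := subset_of_mem_partsOf h hC
  exact (nonempty_of_mem_partsOf h hC).ne_empty (Disjoint.eq_bot_of_le h1 h2)

theorem eq_singleton_of_card_eq_one {Q : Finset α} {B : Finset (Finset α)}
    (h : B ∈ partsOf Q) (h1 : B.card = 1) : B = {Q} := by
  obtain ⟨C, rfl⟩ := Finset.card_eq_one.mp h1
  have := (mem_partsOf.mp h).2.2
  rw [Finset.sup_singleton, id] at this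
  rw [this]

theorem card_pos_of_mem_partsOf {Q : Finset α} (hQ : Q.Nonempty) {B : Finset (Finset α)}
    (h : B ∈ partsOf Q) : 0 < B.card := by
  obtain ⟨a, ha⟩ := hQ
  obtain ⟨C, hC, _⟩ := exists_mem_of_mem_partsOf h ha
  exact Finset.card_pos.mpr ⟨C, hC⟩

theorem card_le_of_mem_partsOf {Q : Finset α} {B : Finset (Finset α)}
    (h : B ∈ partsOf Q) : B.card ≤ Q.card := by
  obtain ⟨P, _, rfl⟩ := Finset.mem_image.mp h
  exact P.card_parts_le_card

theorem bot_mem_partsOf (Q : Finset α) : Q.image (fun a => ({a} : Finset α)) ∈ partsOf Q := by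
  refine mem_partsOf.mpr ⟨by simp, ?_, ?_⟩
  · intro C hC D hD hCD
    simp only [Finset.coe_image, Set.mem_image, Finset.mem_coe] at hC hD
    obtain ⟨x, _, rfl⟩ := hC
    obtain ⟨y, _, rfl⟩ := hD
    simp only [Function.onFun, id, Finset.disjoint_singleton]
    rintro rfl; exact hCD rfl
  · ext x; simp

theorem card_bot (Q : Finset α) : (Q.image (fun a => ({a} : Finset α))).card = Q.card :=
  Finset.card_image_of_injective _ Finset.singleton_injective

theorem eq_bot_of_forall_card_eq_one {Q : Finset α} {B : Finset (Finset α)} (h : B ∈ partsOf Q)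
    (h1 : ∀ C ∈ B, C.card = 1) : B = Q.image (fun a => ({a} : Finset α)) := by
  ext C
  rw [Finset.mem_image]
  constructor
  · intro hC
    obtain ⟨x, rfl⟩ := Finset.card_eq_one.mp (h1 C hC)
    exact ⟨x, subset_of_mem_partsOf h hC (Finset.mem_singleton_self x), rfl⟩
  · rintro ⟨x, hx, rfl⟩
    obtain ⟨C, hC, hxC⟩ := exists_mem_of_mem_partsOf h hx
    obtain ⟨y, rfl⟩ := Finset.card_eq_one.mp (h1 C hC)
    rw [Finset.mem_singleton] at hxC
    rwa [hxC]

theorem sum_partsOf_forall_card_eq_one {M : Type*} [AddCommMonoid M] (Q : Finset α) (x : M) :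
    ∑ B ∈ partsOf Q, (if ∀ C ∈ B, C.card = 1 then x else 0) = x := by
  rw [Finset.sum_eq_single (Q.image fun a => ({a} : Finset α)), if_pos]
  · simp
  · intro B h hne
    rw [if_neg]
    exact fun h1 => hne (eq_bot_of_forall_card_eq_one h h1)
  · exact fun h => absurd (bot_mem_partsOf Q) h

/-- Coefficients that depend on the number of blocks are determined by the sums over all the
partitions. -/
theorem eq_zero_of_sum_partsOf_card {k : ℕ} (hk : 0 < k) {d : ℕ → ℂ}
    (h : ∀ j, 0 < j → j ≤ k → ∃ (β : Type) (_ : DecidableEq β) (Q : Finset β), Q.card = j ∧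
      ∑ B ∈ partsOf Q, d B.card = 0) : d k = 0 := by
  induction k using Nat.strong_induction_on with
  | _ k ih =>
    obtain ⟨β, _, Q, hQ, hsum⟩ := h k hk le_rfl
    have hQn : Q.Nonempty := Finset.card_pos.mp (hQ ▸ hk)
    -- By induction only the partitions with `k = |Q|` blocks survive. The partition into singletons
    -- is one of these, so their number is not zero.
    have h1 : ∑ B ∈ partsOf Q, d B.card = ∑ B ∈ partsOf Q, if B.card = k then d k else 0 := by
      refine Finset.sum_congr rfl fun B hB => ?_
      split_ifs with hc
      · rw [hc]
      · have hlt : B.card < k := lt_of_le_of_ne (hQ ▸ card_le_of_mem_partsOf hB) hc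
        exact ih _ hlt (card_pos_of_mem_partsOf hQn hB) fun j hj hj' => h j hj (hj'.trans hlt.le)
    rw [h1, ← Finset.sum_filter, Finset.sum_const, nsmul_eq_mul, mul_eq_zero] at hsum
    refine hsum.resolve_left ?_
    rw [Nat.cast_eq_zero, Finset.card_eq_zero]
    refine Finset.ne_empty_of_mem (a := Q.image fun a => ({a} : Finset β)) ?_
    exact Finset.mem_filter.mpr ⟨bot_mem_partsOf Q, by rw [card_bot, hQ]⟩

/-! #### Products over blocks -/

variable {R : Type*}

/-- The product of `f` over the blocks, in some fixed order. -/
def blockProd [Monoid R] (f : Finset α → R) (B : Finset (Finset α)) : R := (B.toList.map f).prod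

theorem blockProd_empty [Monoid R] (f : Finset α → R) : blockProd f ∅ = 1 := by simp [blockProd]

theorem blockProd_singleton [Monoid R] (f : Finset α → R) (C : Finset α) :
    blockProd f {C} = f C := by simp [blockProd]

theorem blockProd_congr [Monoid R] {f g : Finset α → R} {B : Finset (Finset α)}
    (h : ∀ C ∈ B, f C = g C) : blockProd f B = blockProd g B := by
  rw [blockProd, blockProd]
  congr 1
  exact List.map_congr_left fun C hC => h C (Finset.mem_toList.mp hC)

/-- The order chosen for the product is uncontrolled; pairwise commuting factors allow the new block
to be moved to the front. -/
theorem blockProd_insert [Monoid R] {f : Finset α → R} {B : Finset (Finset α)} {D : Finset α}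
    (hD : D ∉ B) (hf : ∀ C ∈ insert D B, ∀ C' ∈ insert D B, C ≠ C' → Commute (f C) (f C')) :
    blockProd f (insert D B) = f D * blockProd f B := by
  have hp := (Finset.toList_insert hD).map f
  rw [blockProd, hp.prod_eq', List.map_cons, List.prod_cons, blockProd]
  rw [List.pairwise_map]
  refine List.Nodup.pairwise_of_forall_ne (Finset.nodup_toList _) fun C hC C' hC' hne => ?_
  exact hf C (Finset.mem_toList.mp hC) C' (Finset.mem_toList.mp hC') hne

theorem commute_blockProd [Monoid R] {f : Finset α → R} {B : Finset (Finset α)} {x : R}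
    (h : ∀ C ∈ B, Commute x (f C)) : Commute x (blockProd f B) := by
  refine Commute.list_prod_right _ _ fun y hy => ?_
  obtain ⟨C, hC, rfl⟩ := List.mem_map.mp hy
  exact h C (Finset.mem_toList.mp hC)

variable [Ring R] [Algebra ℂ R]

/-- The coefficients of the cumulants. -/
def cumCoeff (k : ℕ) : ℂ := (-1) ^ (k - 1) * ((k - 1).factorial : ℂ)

/-- The cumulants of a function of finite sets. -/
def cum (m : Finset α → R) (Q : Finset α) : R := ∑ B ∈ partsOf Q, cumCoeff B.card • blockProd m B

theorem commute_cum {m : Finset α → R} {Q : Finset α}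
    (hm : ∀ S ⊆ Q, ∀ S' ⊆ Q, Disjoint S S' → Commute (m S) (m S')) {C D : Finset α} (hC : C ⊆ Q)
    (hD : D ⊆ Q) (hCD : Disjoint C D) : Commute (cum m C) (cum m D) := by
  refine Commute.sum_left _ _ _ fun B hB => Commute.smul_left (Commute.sum_right _ _ _
    fun B' hB' => Commute.smul_right (commute_blockProd fun S' hS' => ?_) _) _
  refine (commute_blockProd fun S hS => ?_).symm
  have h1 := subset_of_mem_partsOf hB hS
  have h2 := subset_of_mem_partsOf hB' hS'
  exact (hm S (h1.trans hC) S' (h2.trans hD) (hCD.mono h1 h2)).symm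

/-- This cancellation drives `cum_recursion`. At `k = 1` the factor `k - 1` vanishes, so the value
of `cumCoeff 0` does not matter. -/
theorem cumCoeff_add {k : ℕ} (hk : 0 < k) :
    cumCoeff k + ((k : ℂ) - 1) * cumCoeff (k - 1) = if k = 1 then 1 else 0 := by
  obtain ⟨k, rfl⟩ : ∃ j, k = j + 1 := ⟨k - 1, by omega⟩
  rcases k with _ | k
  · simp [cumCoeff]
  · rw [if_neg (by omega), cumCoeff, cumCoeff]
    simp only [Nat.add_sub_cancel, Nat.factorial_succ]
    push_cast
    ring

/-- After passing to complements, the sum runs over sets `D` that avoid `a`, and expanding the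
cumulant of `Q \ D` makes a nonempty `D` one more block of a partition of `Q`. A partition with `k`
blocks thus receives `cumCoeff k` from `D = ∅` and `cumCoeff (k - 1)` from each of its `k - 1`
blocks without `a`. By `cumCoeff_add` only `{Q}` remains. -/
theorem cum_recursion {m : Finset α → R} (hm0 : m ∅ = 1) {Q : Finset α}
    (hm : ∀ S ⊆ Q, ∀ S' ⊆ Q, Disjoint S S' → Commute (m S) (m S')) {a : α} (ha : a ∈ Q) :
    ∑ D ∈ Q.powerset.filter (fun D => a ∈ D), cum m D * m (Q \ D) = m Q := by
  have hQ : Q.Nonempty := ⟨a, ha⟩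
  have h1 : ∑ D ∈ Q.powerset.filter (fun D => a ∈ D), cum m D * m (Q \ D) =
      ∑ D ∈ Q.powerset.filter (fun D => a ∉ D), cum m (Q \ D) * m D := by
    refine Finset.sum_bij' (fun D _ => Q \ D) (fun D _ => Q \ D) ?_ ?_ ?_ ?_ ?_
    · intro D hD
      simp only [Finset.mem_filter, Finset.mem_powerset] at hD ⊢
      exact ⟨Finset.sdiff_subset, fun h => (Finset.mem_sdiff.mp h).2 hD.2⟩
    · intro D hD
      simp only [Finset.mem_filter, Finset.mem_powerset] at hD ⊢
      exact ⟨Finset.sdiff_subset, Finset.mem_sdiff.mpr ⟨ha, hD.2⟩⟩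
    · intro D hD
      simp only [Finset.mem_filter, Finset.mem_powerset] at hD
      exact Finset.sdiff_sdiff_eq_self hD.1
    · intro D hD
      simp only [Finset.mem_filter, Finset.mem_powerset] at hD
      exact Finset.sdiff_sdiff_eq_self hD.1
    · intro D hD
      simp only [Finset.mem_filter, Finset.mem_powerset] at hD
      rw [Finset.sdiff_sdiff_eq_self hD.1]
  have h2 : ∑ D ∈ Q.powerset.filter (fun D => a ∉ D), cum m (Q \ D) * m D = cum m Q +
      ∑ D ∈ Q.powerset.filter (fun D => D.Nonempty),
        if a ∈ D then 0 else cum m (Q \ D) * m D := by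
    have : cum m Q = ∑ D ∈ Q.powerset.filter (fun D => ¬ D.Nonempty),
        if a ∈ D then 0 else cum m (Q \ D) * m D := by
      rw [Finset.sum_eq_single ∅]
      · simp [hm0]
      · intro D hD hne
        exact absurd (Finset.nonempty_iff_ne_empty.mpr hne) (Finset.mem_filter.mp hD).2
      · intro h
        exact absurd (Finset.mem_filter.mpr ⟨Finset.empty_mem_powerset Q, by simp⟩) h
    rw [this, add_comm, Finset.sum_filter_add_sum_filter_not, Finset.sum_filter]
    refine Finset.sum_congr rfl fun D _ => ?_
    by_cases h : a ∈ D <;> simp [h]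
  have h3 : ∑ D ∈ Q.powerset.filter (fun D => D.Nonempty),
        (if a ∈ D then 0 else cum m (Q \ D) * m D) =
      ∑ D ∈ Q.powerset.filter (fun D => D.Nonempty), ∑ B ∈ partsOf (Q \ D),
        if a ∈ D then 0 else cumCoeff ((insert D B).card - 1) • blockProd m (insert D B) := by
    refine Finset.sum_congr rfl fun D hD => ?_
    obtain ⟨hDQ, hDn⟩ := Finset.mem_filter.mp hD
    rw [Finset.mem_powerset] at hDQ
    split_ifs with haD
    · simp
    · rw [cum, Finset.sum_mul]
      refine Finset.sum_congr rfl fun B hB => ?_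
      have hnot := notMem_of_mem_partsOf_sdiff hDn hB
      have hins := insert_mem_partsOf hDQ hDn hB
      have hc : ∀ C ∈ insert D B, ∀ C' ∈ insert D B, C ≠ C' → Commute (m C) (m C') :=
        fun C hC C' hC' hne => hm C (subset_of_mem_partsOf hins hC) C' (subset_of_mem_partsOf hins hC')
          (disjoint_of_mem_partsOf hins hC hC' hne)
      rw [Finset.card_insert_of_notMem hnot, Nat.add_sub_cancel, blockProd_insert hnot hc,
        smul_mul_assoc]
      congr 1
      refine (commute_blockProd fun C hC => ?_).symm
      exact hc D (Finset.mem_insert_self _ _) C (Finset.mem_insert_of_mem hC)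
        (by rintro rfl; exact hnot hC)
  rw [h1, h2, h3, ← sum_partsOf_block Q fun B D =>
    if a ∈ D then 0 else cumCoeff (B.card - 1) • blockProd m B, cum, ← Finset.sum_add_distrib]
  have h4 : ∀ B ∈ partsOf Q, cumCoeff B.card • blockProd m B +
      ∑ D ∈ B, (if a ∈ D then 0 else cumCoeff (B.card - 1) • blockProd m B) =
      if B = {Q} then m Q else 0 := by
    intro B hB
    have h5 : ∑ D ∈ B, (if a ∈ D then 0 else cumCoeff (B.card - 1) • blockProd m B) =
        (((B.card : ℂ) - 1) * cumCoeff (B.card - 1)) • blockProd m B := by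
      have h6 := sum_block_of_mem hB ha (cumCoeff (B.card - 1) • blockProd m B)
      have h7 : ∀ D : Finset α, (if a ∈ D then 0 else cumCoeff (B.card - 1) • blockProd m B) =
          cumCoeff (B.card - 1) • blockProd m B -
            (if a ∈ D then cumCoeff (B.card - 1) • blockProd m B else 0) := by
        intro D; split_ifs <;> simp
      simp only [h7, Finset.sum_sub_distrib, h6, Finset.sum_const]
      rw [sub_mul, one_mul, sub_smul, mul_smul]
      congr 1
      exact (Nat.cast_smul_eq_nsmul ℂ _ _).symm
    rw [h5, ← add_smul, cumCoeff_add (card_pos_of_mem_partsOf hQ hB)]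
    by_cases hc : B.card = 1
    · have := eq_singleton_of_card_eq_one hB hc
      rw [if_pos hc, if_pos this, this, one_smul, blockProd_singleton]
    · rw [if_neg hc, if_neg, zero_smul]
      rintro rfl
      exact hc (Finset.card_singleton Q)
  rw [Finset.sum_congr rfl h4, Finset.sum_eq_single {Q}, if_pos rfl]
  · intro B _ hne
    rw [if_neg hne]
  · exact fun h => absurd (singleton_mem_partsOf hQ) h

/-- The cumulants solve the cluster expansions. -/
theorem sum_blockProd_cum {m : Finset α → R} (hm0 : m ∅ = 1) {Q : Finset α}
    (hm : ∀ S ⊆ Q, ∀ S' ⊆ Q, Disjoint S S' → Commute (m S) (m S')) :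
    ∑ B ∈ partsOf Q, blockProd (cum m) B = m Q := by
  induction Q using Finset.strongInduction with
  | H Q ih =>
    rcases Q.eq_empty_or_nonempty with rfl | ⟨a, ha⟩
    · rw [partsOf_empty, Finset.sum_singleton, blockProd_empty, hm0]
    -- Both sides are now sums over the block `D` containing `a`; the induction hypothesis resums
    -- the partitions of the rest.
    · rw [sum_partsOf_of_mem ha, ← cum_recursion hm0 hm ha]
      refine Finset.sum_congr rfl fun D hD => ?_
      obtain ⟨hDQ, haD⟩ := Finset.mem_filter.mp hD
      rw [Finset.mem_powerset] at hDQ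
      have hlt : Q \ D ⊂ Q := Finset.sdiff_ssubset hDQ ⟨a, haD⟩
      rw [← ih _ hlt fun S hS S' hS' => hm S (hS.trans hlt.subset) S' (hS'.trans hlt.subset),
        Finset.mul_sum]
      refine Finset.sum_congr rfl fun B hB => ?_
      have hins := insert_mem_partsOf hDQ ⟨a, haD⟩ hB
      exact blockProd_insert (notMem_of_mem_partsOf_sdiff ⟨a, haD⟩ hB) fun C hC C' hC' hne =>
        commute_cum hm (subset_of_mem_partsOf hins hC) (subset_of_mem_partsOf hins hC')
          (disjoint_of_mem_partsOf hins hC hC' hne)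

/-- The cluster expansions have at most one solution. -/
theorem eq_of_sum_blockProd_eq {f g : Finset α → R} {Q : Finset α} (hQ : Q.Nonempty)
    (h : ∀ S ⊆ Q, S.Nonempty → ∑ B ∈ partsOf S, blockProd f B = ∑ B ∈ partsOf S, blockProd g B) :
    f Q = g Q := by
  induction Q using Finset.strongInduction with
  | H Q ih =>
    have h1 := h Q subset_rfl hQ
    rw [← sub_eq_zero, ← Finset.sum_sub_distrib, Finset.sum_eq_single {Q}, blockProd_singleton,
      blockProd_singleton, sub_eq_zero] at h1
    · exact h1
    · intro B hB hne
      rw [sub_eq_zero]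
      refine blockProd_congr fun C hC => ?_
      have hCQ := subset_of_mem_partsOf hB hC
      refine ih C (Finset.ssubset_iff_subset_ne.mpr ⟨hCQ, ?_⟩) (nonempty_of_mem_partsOf hB hC)
        fun S hS => h S (hS.trans hCQ)
      rintro rfl
      exact hne (eq_singleton_of_mem_partsOf hB hC)
    · exact fun h => absurd (singleton_mem_partsOf hQ) h

/-! #### Vectors on which most of the factors act trivially -/

variable {V : Type*} [AddCommGroup V] [Module ℂ V]

theorem list_prod_apply_of_trivial {f : Finset α → Module.End ℂ V} {v : V} (L : List (Finset α))
    (h : ∀ C ∈ L, f C v = if C.card = 1 then v else 0) :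
    (L.map f).prod v = if ∀ C ∈ L, C.card = 1 then v else 0 := by
  induction L with
  | nil => simp
  | cons C L ih =>
    rw [List.map_cons, List.prod_cons, Module.End.mul_apply, ih fun C' hC' => h C' (by simp [hC'])]
    by_cases hL : ∀ C' ∈ L, C'.card = 1
    · rw [if_pos hL, h C (by simp)]
      by_cases hC : C.card = 1
      · rw [if_pos hC, if_pos (by simpa [hC] using hL)]
      · rw [if_neg hC, if_neg (by simp [hC])]
    · rw [if_neg hL, map_zero, if_neg]
      exact fun h' => hL fun C' hC' => h' C' (by simp [hC'])

theorem blockProd_apply_of_trivial {f : Finset α → Module.End ℂ V} {v : V} {B : Finset (Finset α)}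
    (h : ∀ C ∈ B, f C v = if C.card = 1 then v else 0) :
    blockProd f B v = if ∀ C ∈ B, C.card = 1 then v else 0 := by
  rw [blockProd, list_prod_apply_of_trivial _ fun C hC => h C (Finset.mem_toList.mp hC)]
  simp only [Finset.mem_toList]

/-- The indicator of singletons satisfies the same sum rule, because only the partition into
singletons contributes to it. All partitions other than `{Q}` agree by hypothesis, hence so does the
last term `f Q v`. -/
theorem apply_of_sum_blockProd_apply {f : Finset α → Module.End ℂ V} {v : V} {Q : Finset α}
    (hQ : Q.Nonempty) (hsum : ∑ B ∈ partsOf Q, blockProd f B v = v)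
    (h : ∀ S ⊂ Q, S.Nonempty → f S v = if S.card = 1 then v else 0) :
    f Q v = if Q.card = 1 then v else 0 := by
  have h2 := sum_partsOf_forall_card_eq_one Q v
  have h3 := hsum.trans h2.symm
  rw [← sub_eq_zero, ← Finset.sum_sub_distrib, Finset.sum_eq_single {Q}, blockProd_singleton,
    sub_eq_zero] at h3
  · simpa using h3
  · intro B hB hne
    rw [sub_eq_zero]
    refine blockProd_apply_of_trivial fun C hC => ?_
    refine h C (Finset.ssubset_iff_subset_ne.mpr ⟨subset_of_mem_partsOf hB hC, ?_⟩)
      (nonempty_of_mem_partsOf hB hC)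
    rintro rfl
    exact hne (eq_singleton_of_mem_partsOf hB hC)
  · exact fun h => absurd (singleton_mem_partsOf hQ) h

/-- No commutation is assumed, so `D` sits somewhere inside the product: the factors to its right
act on `v` and those to its left on `f D v`, which is why both hypotheses are needed. -/
theorem blockProd_insert_apply_of_trivial {f : Finset α → Module.End ℂ V} {v : V}
    {B : Finset (Finset α)} {D : Finset α} (hD : D ∉ B)
    (h1 : ∀ C ∈ B, f C v = if C.card = 1 then v else 0)
    (h2 : ∀ C ∈ B, f C (f D v) = if C.card = 1 then f D v else 0) :
    blockProd f (insert D B) v = if ∀ C ∈ B, C.card = 1 then f D v else 0 := by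
  obtain ⟨L₁, L₂, hL⟩ := List.append_of_mem
    (Finset.mem_toList.mpr (Finset.mem_insert_self D B))
  have hnd := Finset.nodup_toList (insert D B)
  have hmem : ∀ C, C ∈ (insert D B).toList ↔ C = D ∨ C ∈ B := fun C => by simp
  rw [hL] at hnd hmem
  have hperm : (L₁ ++ D :: L₂).Perm (D :: (L₁ ++ L₂)) := List.perm_middle
  have hnd' := hperm.nodup_iff.mp hnd
  rw [List.nodup_cons] at hnd'
  have hL1 : ∀ C ∈ L₁, C ∈ B := fun C hC => ((hmem C).mp (by simp [hC])).resolve_left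
    (by rintro rfl; exact hnd'.1 (by simp [hC]))
  have hL2 : ∀ C ∈ L₂, C ∈ B := fun C hC => ((hmem C).mp (by simp [hC])).resolve_left
    (by rintro rfl; exact hnd'.1 (by simp [hC]))
  have hiff : (∀ C ∈ B, C.card = 1) ↔ (∀ C ∈ L₁, C.card = 1) ∧ ∀ C ∈ L₂, C.card = 1 := by
    refine ⟨fun h => ⟨fun C hC => h C (hL1 C hC), fun C hC => h C (hL2 C hC)⟩, fun h C hC => ?_⟩
    have := (hmem C).mpr (Or.inr hC)
    rw [List.mem_append, List.mem_cons] at this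
    rcases this with h' | rfl | h'
    · exact h.1 C h'
    · exact absurd hC hD
    · exact h.2 C h'
  rw [blockProd, hL, List.map_append, List.map_cons, List.prod_append, List.prod_cons,
    Module.End.mul_apply, Module.End.mul_apply,
    list_prod_apply_of_trivial L₂ fun C hC => h1 C (hL2 C hC)]
  by_cases hc2 : ∀ C ∈ L₂, C.card = 1
  · rw [if_pos hc2, list_prod_apply_of_trivial L₁ fun C hC => h2 C (hL1 C hC)]
    by_cases hc1 : ∀ C ∈ L₁, C.card = 1
    · rw [if_pos hc1, if_pos (hiff.mpr ⟨hc1, hc2⟩)]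
    · rw [if_neg hc1, if_neg fun h => hc1 (hiff.mp h).1]
  · rw [if_neg hc2, map_zero, map_zero, if_neg fun h => hc2 (hiff.mp h).2]

/-- Once the block `D` containing `a` is chosen, the remaining elements must all be singleton
blocks, which leaves a single partition for each `D`. -/
theorem sum_blockProd_apply_of_trivial {f : Finset α → Module.End ℂ V} {v : V} {Q : Finset α} {a : α}
    (ha : a ∈ Q) (h1 : ∀ C ⊆ Q, C.Nonempty → a ∉ C → f C v = if C.card = 1 then v else 0)
    (h2 : ∀ C ⊆ Q, C.Nonempty → a ∉ C → ∀ D ⊆ Q, a ∈ D → Disjoint C D →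
      f C (f D v) = if C.card = 1 then f D v else 0) :
    ∑ B ∈ partsOf Q, blockProd f B v = ∑ D ∈ Q.powerset.filter (fun D => a ∈ D), f D v := by
  rw [sum_partsOf_of_mem ha fun B => blockProd f B v]
  refine Finset.sum_congr rfl fun D hD => ?_
  obtain ⟨hDQ, haD⟩ := Finset.mem_filter.mp hD
  rw [Finset.mem_powerset] at hDQ
  rw [← sum_partsOf_forall_card_eq_one (Q \ D) (f D v)]
  refine Finset.sum_congr rfl fun B hB => ?_
  have hsub : ∀ C ∈ B, C ⊆ Q \ D := fun C hC => subset_of_mem_partsOf hB hC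
  have hdis : ∀ C ∈ B, Disjoint C D := fun C hC => Finset.sdiff_disjoint.mono_left (hsub C hC)
  refine blockProd_insert_apply_of_trivial (notMem_of_mem_partsOf_sdiff ⟨a, haD⟩ hB)
    (fun C hC => ?_) (fun C hC => ?_)
  · exact h1 C ((hsub C hC).trans Finset.sdiff_subset) (nonempty_of_mem_partsOf hB hC)
      fun haC => Finset.disjoint_left.mp (hdis C hC) haC haD
  · exact h2 C ((hsub C hC).trans Finset.sdiff_subset) (nonempty_of_mem_partsOf hB hC)
      (fun haC => Finset.disjoint_left.mp (hdis C hC) haC haD) D hDQ haD (hdis C hC)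

/-! #### Möbius inversion over subsets -/

theorem sum_powerset_neg_one_pow {M : Type*} [AddCommGroup M] [Module ℂ M] (g : Finset α → M) (J : Finset α) :
    ∑ S ∈ J.powerset, ((-1 : ℂ) ^ (J \ S).card) • ∑ T ∈ S.powerset, g T = g J := by
  simp only [Finset.smul_sum]
  rw [Finset.sum_comm' (t' := J.powerset) (s' := fun T => J.powerset.filter fun S => T ⊆ S)]
  · rw [Finset.sum_eq_single J]
    · rw [Finset.sum_eq_single J]
      · simp
      · intro S hS hne
        obtain ⟨h1, h2⟩ := Finset.mem_filter.mp hS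
        exact absurd (Finset.Subset.antisymm (Finset.mem_powerset.mp h1) h2) hne
      · intro h
        exact absurd (Finset.mem_filter.mpr ⟨Finset.mem_powerset_self J, subset_rfl⟩) h
    · intro T hT hne
      rw [Finset.mem_powerset] at hT
      rw [← Finset.sum_smul]
      have h1 : ∑ S ∈ J.powerset.filter (fun S => T ⊆ S), (-1 : ℂ) ^ (J \ S).card =
          ∑ L ∈ (J \ T).powerset, (-1 : ℂ) ^ L.card := by
        refine Finset.sum_bij' (fun S _ => J \ S) (fun L _ => J \ L) ?_ ?_ ?_ ?_ ?_
        · intro S hS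
          obtain ⟨h1, h2⟩ := Finset.mem_filter.mp hS
          exact Finset.mem_powerset.mpr (Finset.sdiff_subset_sdiff subset_rfl h2)
        · intro L hL
          rw [Finset.mem_powerset] at hL
          refine Finset.mem_filter.mpr ⟨Finset.mem_powerset.mpr Finset.sdiff_subset, ?_⟩
          exact fun x hx => Finset.mem_sdiff.mpr ⟨hT hx, fun hxL => (Finset.mem_sdiff.mp (hL hxL)).2 hx⟩
        · intro S hS
          exact Finset.sdiff_sdiff_eq_self (Finset.mem_powerset.mp (Finset.mem_filter.mp hS).1)
        · intro L hL
          exact Finset.sdiff_sdiff_eq_self ((Finset.mem_powerset.mp hL).trans Finset.sdiff_subset)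
        · intro S _
          rfl
      have h2 : ∑ L ∈ (J \ T).powerset, (-1 : ℂ) ^ L.card = 0 := by
        have h3 := Finset.sum_powerset_neg_one_pow_card_of_nonempty
          (Finset.sdiff_nonempty.mpr fun h => hne (Finset.Subset.antisymm hT h) : (J \ T).Nonempty)
        exact_mod_cast congrArg (Int.cast : ℤ → ℂ) h3
      rw [h1, h2, zero_smul]
    · exact fun h => absurd (Finset.mem_powerset_self J) h
  · intro S T
    simp only [Finset.mem_powerset, Finset.mem_filter]
    exact ⟨fun h => ⟨⟨h.1, h.2⟩, h.2.trans h.1⟩, fun h => ⟨h.1.1, h.1.2⟩⟩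

/-- This is the inversion in the opposite order, obtained from the previous one: applied to the
alternating sums of `g` it returns them, and since inversion is triangular with unit diagonal,
induction on `J` permits cancelling it. -/
theorem sum_powerset_sum_neg_one_pow {M : Type*} [AddCommGroup M] [Module ℂ M] (g : Finset α → M)
    (J : Finset α) :
    ∑ S ∈ J.powerset, ∑ T ∈ S.powerset, ((-1 : ℂ) ^ (S \ T).card) • g T = g J := by
  induction J using Finset.strongInduction with
  | H J ih =>
    have h1 := sum_powerset_neg_one_pow
      (fun S => ∑ T ∈ S.powerset, ((-1 : ℂ) ^ (S \ T).card) • g T) J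
    rw [← sub_eq_zero, ← Finset.sum_sub_distrib, Finset.sum_eq_single J] at h1
    · simpa [sub_eq_zero] using h1
    · intro S hS hne
      rw [ih S (Finset.ssubset_iff_subset_ne.mpr ⟨Finset.mem_powerset.mp hS, hne⟩), sub_self]
    · exact fun h => absurd (Finset.mem_powerset_self J) h

end Partitions
end
end QuantumHierarchy

namespace QuantumHierarchy
open scoped ComplexOrder InnerProductSpace ComplexConjugate
noncomputable section

/-! ### From tuples of labels to sums over subsets. -/

section Reindexing
variable {M : Type*} [AddCommMonoid M] {s : ℕ}

/-- Each `n`-element set is the range of exactly `n!` embeddings; this is what the prefactor `1/n!`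
of the expansion cancels. -/
theorem sum_embedding_map {n : ℕ} (F : Finset (Fin s) → M) :
    ∑ j : Fin n ↪ Fin s, F (Finset.univ.map j) =
      n.factorial • ∑ J ∈ Finset.powersetCard n Finset.univ, F J := by
  rw [← Finset.sum_fiberwise_of_maps_to (s := Finset.univ) (t := Finset.powersetCard n Finset.univ)
    (g := fun j : Fin n ↪ Fin s => Finset.univ.map j)
    (fun j _ => Finset.mem_powersetCard.mpr ⟨Finset.subset_univ _, by simp⟩), Finset.smul_sum]
  refine Finset.sum_congr rfl fun J hJ => ?_
  have hc : J.card = n := (Finset.mem_powersetCard.mp hJ).2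
  rw [Finset.sum_congr rfl (g := fun _ => F J) fun j hj => by rw [(Finset.mem_filter.mp hj).2],
    Finset.sum_const]
  congr 1
  have h1 : (Finset.univ : Finset (Equiv.Perm (Fin n))).card =
      (Finset.univ.filter fun j : Fin n ↪ Fin s => Finset.univ.map j = J).card := by
    refine Finset.card_bij (fun σ _ => σ.toEmbedding.trans (J.orderEmbOfFin hc).toEmbedding) ?_ ?_ ?_
    · intro σ _
      rw [Finset.mem_filter]
      refine ⟨Finset.mem_univ _, ?_⟩
      rw [← Finset.map_map, Finset.map_univ_equiv, Finset.map_orderEmbOfFin_univ]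
    · intro σ _ τ _ h
      ext k
      have := (J.orderEmbOfFin hc).injective (DFunLike.congr_fun h k)
      exact congrArg Fin.val this
    · intro j hj
      rw [Finset.mem_filter] at hj
      have hmem : ∀ k, ∃ l, J.orderEmbOfFin hc l = j k := fun k => by
        have : j k ∈ Set.range (J.orderEmbOfFin hc) := by
          rw [Finset.range_orderEmbOfFin, ← hj.2]
          simp
        exact this
      choose f hf using hmem
      have hinj : Function.Injective f := fun k l h => j.injective (by rw [← hf, ← hf, h])
      refine ⟨Equiv.ofBijective f hinj.bijective_of_finite, Finset.mem_univ _, ?_⟩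
      ext k
      exact congrArg Fin.val (hf k)
  rw [← h1, Finset.card_univ, Fintype.card_perm, Fintype.card_fin]

theorem sum_compl (F : Finset (Fin s) → M) : ∑ J : Finset (Fin s), F Jᶜ = ∑ X, F X :=
  Equiv.sum_comp (Function.Involutive.toPerm _ (compl_involutive (α := Finset (Fin s)))) F

/-- A pair of disjoint sets `X`, `S` is the same as a chain `X ⊆ Y` with `Y = X ∪ S`. -/
theorem sum_sum_powerset_compl (F : Finset (Fin s) → Finset (Fin s) → M) :
    ∑ X, ∑ S ∈ Xᶜ.powerset, F X S = ∑ Y : Finset (Fin s), ∑ X ∈ Y.powerset, F X (Y \ X) := by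
  rw [Finset.sum_sigma', Finset.sum_sigma']
  refine Finset.sum_bij' (fun x _ => ⟨x.1 ∪ x.2, x.1⟩) (fun x _ => ⟨x.2, x.1 \ x.2⟩) ?_ ?_ ?_ ?_ ?_
  · rintro ⟨X, S⟩ h
    exact Finset.mem_sigma.mpr
      ⟨Finset.mem_univ _, Finset.mem_powerset.mpr Finset.subset_union_left⟩
  · rintro ⟨Y, X⟩ h
    simp only [Finset.mem_sigma, Finset.mem_univ, Finset.mem_powerset, true_and] at h ⊢
    exact fun x hx => Finset.mem_compl.mpr (Finset.mem_sdiff.mp hx).2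
  · rintro ⟨X, S⟩ h
    simp only [Finset.mem_sigma, Finset.mem_univ, Finset.mem_powerset, true_and] at h
    have hd : Disjoint X S := (Finset.subset_compl_iff_disjoint_right.mp h).symm
    simp only [Sigma.mk.injEq, heq_eq_eq, true_and]
    exact Finset.union_sdiff_cancel_left hd
  · rintro ⟨Y, X⟩ h
    simp only [Finset.mem_sigma, Finset.mem_univ, Finset.mem_powerset, true_and] at h
    simp only [Sigma.mk.injEq, heq_eq_eq, and_true]
    exact Finset.union_sdiff_of_subset h
  · rintro ⟨X, S⟩ h
    simp only [Finset.mem_sigma, Finset.mem_univ, Finset.mem_powerset, true_and] at h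
    have hd : Disjoint X S := (Finset.subset_compl_iff_disjoint_right.mp h).symm
    simp only
    rw [Finset.union_sdiff_cancel_left hd]

theorem sum_map_orderEmbOfFin (Y : Finset (Fin s)) (F : Finset (Fin s) → M) :
    ∑ X : Finset (Fin Y.card), F (X.map (Y.orderEmbOfFin rfl).toEmbedding) =
      ∑ X ∈ Y.powerset, F X := by
  refine Finset.sum_bij (fun X _ => X.map (Y.orderEmbOfFin rfl).toEmbedding) ?_ ?_ ?_ ?_
  · intro X _
    rw [Finset.mem_powerset]
    conv_rhs => rw [← Finset.map_orderEmbOfFin_univ Y rfl]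
    exact Finset.map_subset_map.mpr (Finset.subset_univ _)
  · intro X _ X' _ h
    exact Finset.map_injective _ h
  · intro X hX
    rw [Finset.mem_powerset, ← Finset.map_orderEmbOfFin_univ Y rfl, Finset.subset_map_iff] at hX
    obtain ⟨u, _, hu⟩ := hX
    exact ⟨u, Finset.mem_univ _, hu.symm⟩
  · intro X _
    rfl

theorem exists_map_eq_of_subset {X Y : Finset (Fin s)} (h : X ⊆ Y) :
    ∃ X' : Finset (Fin Y.card), X'.map (Y.orderEmbOfFin rfl).toEmbedding = X := by
  rw [← Finset.map_orderEmbOfFin_univ Y rfl, Finset.subset_map_iff] at h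
  obtain ⟨u, _, hu⟩ := h
  exact ⟨u, hu.symm⟩

theorem map_compl_orderEmbOfFin (Y : Finset (Fin s)) (X : Finset (Fin Y.card)) :
    Xᶜ.map (Y.orderEmbOfFin rfl).toEmbedding = Y \ X.map (Y.orderEmbOfFin rfl).toEmbedding := by
  rw [Finset.compl_eq_univ_sdiff, Finset.map_sdiff, Finset.map_orderEmbOfFin_univ]

end Reindexing

/-! ### Truncated observables and the transforms `zeta` and `moebius`. -/

section Obs
variable {H : Type*} [NormedAddCommGroup H] [InnerProductSpace ℂ H] {s : ℕ}

theorem place_sum {α : Type*} (X : Finset (Fin s)) (t : Finset α) (b : α → Op X.card H) :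
    place X (∑ i ∈ t, b i) = ∑ i ∈ t, place X (b i) := ampl_sum _ t b

theorem place_smul (X : Finset (Fin s)) (c : ℂ) (b : Op X.card H) :
    place X (c • b) = c • place X b := ampl_smul _ c b

theorem place_one (X : Finset (Fin s)) : place X (1 : Op X.card H) = 1 := ampl_one _

theorem place_mul (X : Finset (Fin s)) (a b : Op X.card H) :
    place X (a * b) = place X a * place X b := ampl_mul _ a b

theorem norm_place_le (X : Finset (Fin s)) (b : Op X.card H) : ‖place X b‖ ≤ ‖b‖ := norm_ampl_le _ b

/-- The sum of `𝔗 X Xᶜ (b(X) ⊗ 𝟙)` over all the sets `X` of particles. -/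
def obsSum (𝔗 : Finset (Fin s) → Finset (Fin s) → SuperOp s H) (b : Obs H) : Op s H :=
  ∑ X : Finset (Fin s), 𝔗 X Xᶜ (place X (b X.card))

theorem tupleSum_eq (n : ℕ) (𝔗 : Finset (Fin s) → Finset (Fin s) → SuperOp s H) (b : Obs H) :
    tupleSum n 𝔗 b = n.factorial • ∑ J ∈ Finset.powersetCard n Finset.univ,
      𝔗 Jᶜ J (place Jᶜ (b Jᶜ.card)) :=
  sum_embedding_map fun J => 𝔗 Jᶜ J (place Jᶜ (b Jᶜ.card))

theorem sum_tupleSum (𝔗 : Finset (Fin s) → Finset (Fin s) → SuperOp s H) (b : Obs H) :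
    ∑ n ∈ Finset.range (s + 1), ((n.factorial : ℂ))⁻¹ • tupleSum n 𝔗 b = obsSum 𝔗 b := by
  have h1 : ∀ n, ((n.factorial : ℂ))⁻¹ • tupleSum n 𝔗 b =
      ∑ J ∈ Finset.powersetCard n Finset.univ, 𝔗 Jᶜ J (place Jᶜ (b Jᶜ.card)) := fun n => by
    have h0 : (n.factorial : ℂ) ≠ 0 := by exact_mod_cast n.factorial_ne_zero
    rw [tupleSum_eq, ← Nat.cast_smul_eq_nsmul ℂ, smul_smul, inv_mul_cancel₀ h0, one_smul]
  simp only [h1]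
  have h2 := Finset.sum_powerset (Finset.univ : Finset (Fin s))
    (fun J => 𝔗 Jᶜ J (place Jᶜ (b Jᶜ.card)))
  rw [Finset.card_fin] at h2
  rw [← h2, Finset.powerset_univ, obsSum,
    ← sum_compl (fun X => 𝔗 X Xᶜ (place X (b X.card)))]
  refine Finset.sum_congr rfl fun J _ => ?_
  simp only [compl_compl]

theorem expansion_eq_obsSum (𝔄 : GenOps H) (b : Obs H) (t : ℝ) (s : ℕ) :
    expansion 𝔄 b t s = obsSum (fun X J => 𝔄 s t (clusters X J)) b := sum_tupleSum _ b

/-- The sequence with the only nonzero term `b k`. -/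
def trunc (k : ℕ) (b : Obs H) : Obs H := fun n => if n = k then b n else 0

theorem isSymm_zero (n : ℕ) : IsSymm (0 : Op n H) := fun _ => ampl_zero _

theorem trunc_mem (γ : ℝ) (k : ℕ) {b : Obs H} (hb : IsSelfAdjoint (b k)) (hb' : IsSymm (b k)) :
    trunc k b ∈ obsSpace H γ := by
  refine ⟨fun n => ?_, fun n => ?_, ?_⟩
  · rw [trunc]; split_ifs with h
    · subst h; exact hb
    · exact IsSelfAdjoint.zero _
  · rw [trunc]; split_ifs with h
    · subst h; exact hb'
    · exact isSymm_zero n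
  · refine ⟨max (γ ^ k / (k.factorial : ℝ) * ‖b k‖) 0, ?_⟩
    rintro _ ⟨n, rfl⟩
    simp only [trunc]
    split_ifs with h
    · subst h; exact le_max_left _ _
    · simp

theorem tupleSum_trunc (n k : ℕ)
    (𝔗 : Finset (Fin s) → Finset (Fin s) → SuperOp s H) (b : Obs H) :
    tupleSum n 𝔗 (trunc k b) = if s - n = k then tupleSum n 𝔗 b else 0 := by
  have hc : ∀ j : Fin n ↪ Fin s, (Finset.univ.map j)ᶜ.card = s - n := fun j => by
    rw [Finset.card_compl, Finset.card_map, Finset.card_fin, Fintype.card_fin]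
  split_ifs with h
  · refine Finset.sum_congr rfl fun j _ => ?_
    rw [trunc, if_pos ((hc j).trans h)]
  · refine Finset.sum_eq_zero fun j _ => ?_
    rw [trunc, if_neg (by rw [hc j]; exact h)]
    have : place (H := H) (Finset.univ.map j)ᶜ 0 = 0 := ampl_zero _
    rw [this, map_zero]

theorem tupleSum_of_lt {n : ℕ} (hn : s < n)
    (𝔗 : Finset (Fin s) → Finset (Fin s) → SuperOp s H) (b : Obs H) : tupleSum n 𝔗 b = 0 := by
  have : IsEmpty (Fin n ↪ Fin s) := ⟨fun j => by
    have := Fintype.card_le_of_embedding j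
    simp only [Fintype.card_fin] at this
    omega⟩
  exact Finset.sum_of_isEmpty _

/-- The `n`-th term uses `b_{s-n}` only, so truncating the data extracts it from the full sum. -/
theorem obsSum_trunc {n : ℕ} (hn : n ≤ s)
    (𝔗 : Finset (Fin s) → Finset (Fin s) → SuperOp s H) (b : Obs H) :
    obsSum 𝔗 (trunc (s - n) b) = ((n.factorial : ℂ))⁻¹ • tupleSum n 𝔗 b := by
  rw [← sum_tupleSum, Finset.sum_eq_single n]
  · rw [tupleSum_trunc, if_pos rfl]
  · intro m hm hne
    rw [Finset.mem_range] at hm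
    rw [tupleSum_trunc, if_neg (by omega), smul_zero]
  · intro h
    exact absurd (Finset.mem_range.mpr (by omega)) h

/-- The terms of two expansions agree on all observables if the expansions do. -/
theorem tupleSum_eq_iff_obsSum_eq (γ : ℝ)
    (𝔗 𝔗' : (s : ℕ) → ℝ → Finset (Fin s) → Finset (Fin s) → SuperOp s H) :
    (∀ b ∈ obsSpace H γ, ∀ (t : ℝ) (s n : ℕ), tupleSum n (𝔗 s t) b = tupleSum n (𝔗' s t) b) ↔
      ∀ b ∈ obsSpace H γ, ∀ (t : ℝ) (s : ℕ), obsSum (𝔗 s t) b = obsSum (𝔗' s t) b := by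
  constructor
  · intro h b hb t s
    rw [← sum_tupleSum, ← sum_tupleSum]
    exact Finset.sum_congr rfl fun n _ => by rw [h b hb t s n]
  · intro h b hb t s n
    rcases lt_or_ge s n with hn | hn
    · rw [tupleSum_of_lt hn, tupleSum_of_lt hn]
    -- Equality is assumed for all data, so it may be tested on truncated data, where only the
    -- `n`-th term is left.
    · have h1 := h (trunc (s - n) b) (trunc_mem γ _ (hb.1 _) (hb.2.1 _)) t s
      rw [obsSum_trunc hn, obsSum_trunc hn] at h1
      have h0 : ((n.factorial : ℂ))⁻¹ ≠ 0 := inv_ne_zero (by exact_mod_cast n.factorial_ne_zero)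
      exact smul_right_injective _ h0 h1

/-- The observables `∑_Y b(Y)` of all the particles. -/
def zeta (b : Obs H) : Obs H := fun s => ∑ Y : Finset (Fin s), place Y (b Y.card)

/-- The inverse of `zeta`. -/
def moebius (a : Obs H) : Obs H := fun s =>
  ∑ Y : Finset (Fin s), ((-1 : ℂ) ^ Yᶜ.card) • place Y (a Y.card)

theorem place_zeta (b : Obs H) (Y : Finset (Fin s)) :
    place Y (zeta b Y.card) = ∑ X ∈ Y.powerset, place X (b X.card) := by
  rw [zeta, place_sum, ← sum_map_orderEmbOfFin Y]
  exact Finset.sum_congr rfl fun X _ => place_place Y X b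

theorem place_moebius (a : Obs H) (Y : Finset (Fin s)) :
    place Y (moebius a Y.card) = ∑ X ∈ Y.powerset, ((-1 : ℂ) ^ (Y \ X).card) • place X (a X.card) := by
  rw [moebius, place_sum, ← sum_map_orderEmbOfFin Y]
  refine Finset.sum_congr rfl fun X _ => ?_
  have h : (Y \ X.map (Y.orderEmbOfFin rfl).toEmbedding).card = Xᶜ.card := by
    rw [← map_compl_orderEmbOfFin, Finset.card_map]
  rw [place_smul, place_place, h]

theorem zeta_moebius (a : Obs H) : zeta (moebius a) = a := by
  funext s
  have h := sum_powerset_sum_neg_one_pow (fun X : Finset (Fin s) => place X (a X.card)) Finset.univ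
  rw [Finset.powerset_univ, place_univ] at h
  rw [← h, zeta]
  exact Finset.sum_congr rfl fun Y _ => place_moebius a Y

theorem moebius_zeta (b : Obs H) : moebius (zeta b) = b := by
  funext s
  have h := sum_powerset_neg_one_pow (fun X : Finset (Fin s) => place X (b X.card)) Finset.univ
  rw [Finset.powerset_univ, place_univ] at h
  rw [← h, moebius]
  refine Finset.sum_congr rfl fun Y _ => ?_
  rw [place_zeta, Finset.compl_eq_univ_sdiff]

end Obs
end
end QuantumHierarchy

namespace QuantumHierarchy
open scoped ComplexOrder InnerProductSpace ComplexConjugate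
noncomputable section

/-! ### Subsets of the set of clusters. -/

section Clusters
variable {s : ℕ}

theorem mem_clusters {X J Z : Finset (Fin s)} :
    Z ∈ clusters X J ↔ Z = X ∨ ∃ j ∈ J, Z = {j} := by
  simp [clusters, eq_comm]

theorem sup_clusters (X J : Finset (Fin s)) : (clusters X J).sup id = X ∪ J := by
  ext x
  simp [clusters]

theorem clusters_nonempty (X J : Finset (Fin s)) : (clusters X J).Nonempty :=
  ⟨X, Finset.mem_insert_self _ _⟩

theorem singleton_ne_of_disjoint {X J : Finset (Fin s)} (h : Disjoint X J) {j : Fin s} (hj : j ∈ J) :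
    ({j} : Finset (Fin s)) ≠ X := by
  rintro rfl
  exact Finset.disjoint_left.mp h (Finset.mem_singleton_self j) hj

theorem card_clusters {X J : Finset (Fin s)} (h : Disjoint X J) :
    (clusters X J).card = J.card + 1 := by
  rw [clusters, Finset.card_insert_of_notMem, card_bot]
  intro hX
  obtain ⟨j, hj, hjX⟩ := Finset.mem_image.mp hX
  exact singleton_ne_of_disjoint h hj hjX

theorem disjoint_of_mem_clusters {X J : Finset (Fin s)} (h : Disjoint X J) {Z Z' : Finset (Fin s)}
    (hZ : Z ∈ clusters X J) (hZ' : Z' ∈ clusters X J) (hne : Z ≠ Z') : Disjoint Z Z' := by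
  rcases mem_clusters.mp hZ with rfl | ⟨j, hj, rfl⟩
  · rcases mem_clusters.mp hZ' with rfl | ⟨k, hk, rfl⟩
    · exact absurd rfl hne
    · exact h.mono_right (Finset.singleton_subset_iff.mpr hk)
  · rcases mem_clusters.mp hZ' with rfl | ⟨k, hk, rfl⟩
    · exact (h.mono_right (Finset.singleton_subset_iff.mpr hj)).symm
    · rw [Finset.disjoint_singleton]
      rintro rfl
      exact hne rfl

theorem disjoint_sup_of_subset_clusters {X J : Finset (Fin s)} (h : Disjoint X J)
    {S S' : Finset (Finset (Fin s))} (hS : S ⊆ clusters X J) (hS' : S' ⊆ clusters X J)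
    (hd : Disjoint S S') : Disjoint (S.sup id) (S'.sup id) := by
  rw [Finset.disjoint_sup_left]
  intro Z hZ
  rw [Finset.disjoint_sup_right]
  intro Z' hZ'
  refine disjoint_of_mem_clusters h (hS hZ) (hS' hZ') ?_
  rintro rfl
  exact Finset.disjoint_left.mp hd hZ hZ'

theorem clusters_subset_clusters {X J J' : Finset (Fin s)} (h : J' ⊆ J) :
    clusters X J' ⊆ clusters X J :=
  Finset.insert_subset_insert _ (Finset.image_subset_image h)

theorem exists_eq_clusters_of_mem {X J : Finset (Fin s)} {S : Finset (Finset (Fin s))}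
    (hS : S ⊆ clusters X J) (hX : X ∈ S) : ∃ J' ⊆ J, S = clusters X J' := by
  refine ⟨J.filter fun j => {j} ∈ S, Finset.filter_subset _ _, ?_⟩
  ext Z
  rw [mem_clusters]
  constructor
  · intro hZ
    rcases mem_clusters.mp (hS hZ) with rfl | ⟨j, hj, rfl⟩
    · exact Or.inl rfl
    · exact Or.inr ⟨j, Finset.mem_filter.mpr ⟨hj, hZ⟩, rfl⟩
  · rintro (rfl | ⟨j, hj, rfl⟩)
    · exact hX
    · exact (Finset.mem_filter.mp hj).2

/-- A subset without `X` consists of one-particle clusters, and any one of these may play the part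
of the distinguished cluster. -/
theorem exists_eq_clusters_of_notMem {X J : Finset (Fin s)} {S : Finset (Finset (Fin s))}
    (hS : S ⊆ clusters X J) (hX : X ∉ S) (hne : S.Nonempty) :
    ∃ x J', x ∉ J' ∧ insert x J' ⊆ J ∧ S = clusters {x} J' := by
  obtain ⟨Z, hZ⟩ := hne
  obtain ⟨x, hx, rfl⟩ : ∃ x ∈ J, Z = {x} :=
    (mem_clusters.mp (hS hZ)).resolve_left fun h => hX (h ▸ hZ)
  refine ⟨x, (J.filter fun j => {j} ∈ S).erase x, Finset.notMem_erase _ _, ?_, ?_⟩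
  · exact Finset.insert_subset hx ((Finset.erase_subset _ _).trans (Finset.filter_subset _ _))
  · ext Z
    rw [mem_clusters]
    constructor
    · intro hZ'
      rcases mem_clusters.mp (hS hZ') with rfl | ⟨j, hj, rfl⟩
      · exact absurd hZ' hX
      · rcases eq_or_ne j x with rfl | hjx
        · exact Or.inl rfl
        · exact Or.inr ⟨j, Finset.mem_erase.mpr ⟨hjx, Finset.mem_filter.mpr ⟨hj, hZ'⟩⟩, rfl⟩
    · rintro (rfl | ⟨j, hj, rfl⟩)
      · exact hZ
      · exact (Finset.mem_filter.mp (Finset.mem_of_mem_erase hj)).2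

/-- Hypotheses stated only for sets of the form `clusters X J` thereby reach every block of a
partition of such a set. -/
theorem exists_eq_clusters {X J : Finset (Fin s)} (h : Disjoint X J) {S : Finset (Finset (Fin s))}
    (hS : S ⊆ clusters X J) (hne : S.Nonempty) : ∃ X' J', Disjoint X' J' ∧ S = clusters X' J' := by
  by_cases hX : X ∈ S
  · obtain ⟨J', hJ', h'⟩ := exists_eq_clusters_of_mem hS hX
    exact ⟨X, J', h.mono_right hJ', h'⟩
  · obtain ⟨x, J', hx, _, h'⟩ := exists_eq_clusters_of_notMem hS hX hne
    exact ⟨{x}, J', Finset.disjoint_singleton_left.mpr hx, h'⟩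

theorem sum_filter_powerset_clusters {M : Type*} [AddCommMonoid M] {X J : Finset (Fin s)}
    (h : Disjoint X J) (F : Finset (Finset (Fin s)) → M) :
    ∑ D ∈ (clusters X J).powerset.filter (fun D => X ∈ D), F D =
      ∑ J' ∈ J.powerset, F (clusters X J') := by
  symm
  refine Finset.sum_bij (fun J' _ => clusters X J') ?_ ?_ ?_ fun _ _ => rfl
  · intro J' hJ'
    exact Finset.mem_filter.mpr ⟨Finset.mem_powerset.mpr
      (clusters_subset_clusters (Finset.mem_powerset.mp hJ')), Finset.mem_insert_self _ _⟩
  · have key : ∀ J₁ ⊆ J, ∀ J₂ ⊆ J, clusters X J₁ = clusters X J₂ → J₁ ⊆ J₂ := by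
      intro J₁ h₁ J₂ h₂ he j hj
      have : ({j} : Finset (Fin s)) ∈ clusters X J₂ := he ▸ mem_clusters.mpr (Or.inr ⟨j, hj, rfl⟩)
      rcases mem_clusters.mp this with hX | ⟨k, hk, hjk⟩
      · exact absurd hX (singleton_ne_of_disjoint h (h₁ hj))
      · rwa [Finset.singleton_injective hjk]
    intro J₁ h₁ J₂ h₂ he
    rw [Finset.mem_powerset] at h₁ h₂
    exact Finset.Subset.antisymm (key J₁ h₁ J₂ h₂ he) (key J₂ h₂ J₁ h₁ he.symm)
  · intro D hD
    obtain ⟨hD, hX⟩ := Finset.mem_filter.mp hD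
    obtain ⟨J', hJ', rfl⟩ := exists_eq_clusters_of_mem (Finset.mem_powerset.mp hD) hX
    exact ⟨J', Finset.mem_powerset.mpr hJ', rfl⟩

end Clusters

/-! ### The Heisenberg groups of subsets of particles. -/

section Heis
variable {H : Type*} [NormedAddCommGroup H] [InnerProductSpace ℂ H]

theorem exists_obs (m : ℕ) (b : Op m H) : ∃ b' : Obs H, b' m = b :=
  ⟨Function.update 0 m b, Function.update_self _ _ _⟩

theorem exists_place_eq {s : ℕ} {X W : Finset (Fin s)} (h : X ⊆ W) (b : Op X.card H) :
    ∃ c : Op W.card H, place X b = place W c := by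
  obtain ⟨X', rfl⟩ := exists_map_eq_of_subset h
  obtain ⟨b', rfl⟩ := exists_obs _ b
  exact ⟨_, (place_place W X' b').symm⟩

/-- There is just one product vector without factors, so the space of zero particles is
one-dimensional. -/
theorem exists_eq_smul_one (c : Op 0 H) : ∃ z : ℂ, c = z • 1 := by
  set u : TensorPow (Fin 0) H := pureTensor 0 with hu
  refine ⟨⟪u, c u⟫_ℂ, clm_ext_pureTensor fun x => ?_⟩
  rw [Subsingleton.elim x 0]
  refine eq_of_inner_pureTensor fun y => ?_
  rw [Subsingleton.elim y 0, smul_apply, one_apply_eq_self, inner_smul_left, inner_conj_symm, ← hu]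
  have : ⟪u, u⟫_ℂ = 1 := by rw [hu, inner_pureTensor]; simp
  rw [this, mul_one]

variable [CompleteSpace H] {K : H →ₗ.[ℂ] H} {Φ : Op 2 H} {s : ℕ}

theorem heis_apply (t : ℝ) (X : Finset (Fin s)) (a : Op s H) : heis K Φ s t X a =
    place X (expI (ham K Φ X.card) t) * (a * place X (expI (ham K Φ X.card) (-t))) := rfl

theorem heis_place (t : ℝ) (X : Finset (Fin s)) (a : Op X.card H) :
    heis K Φ s t X (place X a) = place X (evol K Φ a t) := by
  rw [heis_apply, ← place_mul, ← place_mul, evol, mul_assoc]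

theorem heis_univ (t : ℝ) (a : Op s H) : heis K Φ s t Finset.univ a = evol K Φ a t := by
  rw [heis_apply, place_univ (fun n => expI (ham K Φ n) t),
    place_univ (fun n => expI (ham K Φ n) (-t)), evol, mul_assoc]

theorem heis_place_mul (t : ℝ) {X Y : Finset (Fin s)} (h : Disjoint X Y) (c : Op Y.card H)
    (b : Op s H) : heis K Φ s t X (place Y c * b) = place Y c * heis K Φ s t X b := by
  rw [heis_apply, heis_apply, mul_assoc (place Y c), ← mul_assoc, (place_commute h _ c).eq, mul_assoc]

theorem heis_mul_place (t : ℝ) {X Y : Finset (Fin s)} (h : Disjoint X Y) (c : Op Y.card H)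
    (b : Op s H) : heis K Φ s t X (b * place Y c) = heis K Φ s t X b * place Y c := by
  rw [heis_apply, heis_apply, mul_assoc b, (place_commute h _ c).symm.eq]
  simp only [mul_assoc]

theorem heis_commute (t : ℝ) {X Y : Finset (Fin s)} (h : Disjoint X Y) :
    Commute (heis K Φ s t X) (heis K Φ s t Y) := by
  refine LinearMap.ext fun b => ?_
  rw [Module.End.mul_apply, Module.End.mul_apply, heis_apply t Y b, heis_place_mul t h,
    heis_mul_place t h, ← heis_apply]

theorem heis_mem_range_place (t : ℝ) {Z W : Finset (Fin s)} (h : Z ⊆ W) (u : Op W.card H) :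
    ∃ v : Op W.card H, heis K Φ s t Z (place W u) = place W v := by
  obtain ⟨p, hp⟩ := exists_place_eq h (expI (ham K Φ Z.card) t)
  obtain ⟨q, hq⟩ := exists_place_eq h (expI (ham K Φ Z.card) (-t))
  exact ⟨p * (u * q), by rw [heis_apply, hp, hq, ← place_mul, ← place_mul]⟩

theorem exists_place_empty (c : Op (∅ : Finset (Fin s)).card H) :
    ∃ z : ℂ, place (∅ : Finset (Fin s)) c = z • 1 := by
  obtain ⟨z, hz⟩ := exists_eq_smul_one (H := H) c
  have h : c = z • 1 := hz
  exact ⟨z, by rw [h, place_smul, place_one]⟩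

theorem heis_one (hK : IsSelfAdjoint K) (hΦ : IsSelfAdjoint Φ) (t : ℝ) (X : Finset (Fin s)) :
    heis K Φ s t X 1 = 1 := by
  rw [heis_apply, one_mul, ← place_mul, (expI_ham hK hΦ _).mul_neg, place_one]

/-- Operators of no particles are scalars, and conjugation by a scalar is trivial. This provides the
normalisation `m ∅ = 1` for the cumulant identities. -/
theorem heis_empty (hK : IsSelfAdjoint K) (hΦ : IsSelfAdjoint Φ) (t : ℝ) :
    heis K Φ s t ∅ = 1 := by
  refine LinearMap.ext fun b => ?_
  obtain ⟨z, hz⟩ := exists_place_empty (expI (ham K Φ (∅ : Finset (Fin s)).card) (-t))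
  have h1 := heis_one hK hΦ t (∅ : Finset (Fin s))
  rw [heis_apply, hz, one_mul, mul_smul_comm, mul_one] at h1
  rw [heis_apply, hz, mul_smul_comm, mul_one, mul_smul_comm, ← smul_mul_assoc, h1, one_mul]
  rfl

end Heis
end
end QuantumHierarchy

namespace QuantumHierarchy
open scoped ComplexOrder InnerProductSpace ComplexConjugate
noncomputable section

/-! ### Cluster expansions as operator identities and on observables. -/

variable {H : Type*} [NormedAddCommGroup H] [InnerProductSpace ℂ H]

section
variable [CompleteSpace H] {K : H →ₗ.[ℂ] H} {Φ : Op 2 H}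

theorem clusterSum_eq (𝔄 : GenOps H) (s : ℕ) (t : ℝ) (Q : Finset (Finset (Fin s))) :
    clusterSum 𝔄 s t Q = ∑ B ∈ partsOf Q, blockProd (𝔄 s t) B :=
  sum_finpartition Q fun B => blockProd (𝔄 s t) B

theorem apply_of_clusterSum_apply {𝔄 : GenOps H} {s : ℕ} {t : ℝ} {Q : Finset (Finset (Fin s))}
    (hQ : Q.Nonempty) {v : Op s H} (hsum : clusterSum 𝔄 s t Q v = v)
    (h : ∀ S ⊂ Q, S.Nonempty → 𝔄 s t S v = if S.card = 1 then v else 0) :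
    𝔄 s t Q v = if Q.card = 1 then v else 0 := by
  refine apply_of_sum_blockProd_apply hQ ?_ h
  rw [← LinearMap.sum_apply, ← clusterSum_eq, hsum]

theorem groupExpansion_eq (c : ℝ → ℕ → ℂ) (s : ℕ) (t : ℝ) (Q : Finset (Finset (Fin s))) :
    groupExpansion K Φ c s t Q = ∑ B ∈ partsOf Q,
      c t B.card • blockProd (fun S : Finset (Finset (Fin s)) => heis K Φ s t (S.sup id)) B :=
  sum_finpartition Q fun B =>
    c t B.card • blockProd (fun S : Finset (Finset (Fin s)) => heis K Φ s t (S.sup id)) B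

theorem cumulant_eq (s : ℕ) (t : ℝ) : cumulant K Φ s t =
    cum fun S : Finset (Finset (Fin s)) => heis K Φ s t (S.sup id) :=
  funext fun Q => groupExpansion_eq _ s t Q

theorem commute_heis_sup {s : ℕ} (t : ℝ) {X J : Finset (Fin s)} (h : Disjoint X J) :
    ∀ S ⊆ clusters X J, ∀ S' ⊆ clusters X J, Disjoint S S' →
      Commute (heis K Φ s t (S.sup id)) (heis K Φ s t (S'.sup id)) := fun _ hS _ hS' hd =>
  heis_commute t (disjoint_sup_of_subset_clusters h hS hS' hd)

theorem clusterSum_cumulant (hK : IsSelfAdjoint K) (hΦ : IsSelfAdjoint Φ) {s : ℕ} (t : ℝ)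
    {X J : Finset (Fin s)} (h : Disjoint X J) :
    clusterSum (cumulant K Φ) s t (clusters X J) = heis K Φ s t (X ∪ J) := by
  rw [clusterSum_eq, cumulant_eq, sum_blockProd_cum
    (m := fun S : Finset (Finset (Fin s)) => heis K Φ s t (S.sup id)) (heis_empty hK hΦ t)
    (commute_heis_sup t h), sup_clusters]

/-- Cumulants satisfy the expansions, and the expansions determine their solution recursively; both
arguments stay among sets of the form `clusters X J`, because every block has that form. -/
theorem solvesClusterExpansions_iff (hK : IsSelfAdjoint K) (hΦ : IsSelfAdjoint Φ) (𝔄 : GenOps H) :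
    SolvesClusterExpansions K Φ 𝔄 ↔ ∀ (s : ℕ) (t : ℝ) (X J : Finset (Fin s)), Disjoint X J →
      𝔄 s t (clusters X J) = cumulant K Φ s t (clusters X J) := by
  constructor
  · intro h s t X J hXJ
    refine eq_of_sum_blockProd_eq (clusters_nonempty X J) fun S hS hne => ?_
    obtain ⟨X', J', hd, rfl⟩ := exists_eq_clusters hXJ hS hne
    rw [← clusterSum_eq, ← clusterSum_eq, clusterSum_cumulant hK hΦ t hd, h s t X' J' hd]
  · intro h s t X J hXJ
    rw [← clusterSum_cumulant hK hΦ t hXJ, clusterSum_eq, clusterSum_eq]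
    refine Finset.sum_congr rfl fun B hB => blockProd_congr fun S hS => ?_
    obtain ⟨X', J', hd, rfl⟩ :=
      exists_eq_clusters hXJ (subset_of_mem_partsOf hB hS) (nonempty_of_mem_partsOf hB hS)
    exact (h s t X' J' hd).symm

end

/-- The properties of generating operators that determine the cluster expansions on observables. -/
structure IsLocal {s : ℕ} (f : Finset (Finset (Fin s)) → SuperOp s H) : Prop where
  left : ∀ X J Y : Finset (Fin s), Disjoint X J → Disjoint (X ∪ J) Y → ∀ (c : Op Y.card H) (b : Op s H),
    f (clusters X J) (place Y c * b) = place Y c * f (clusters X J) b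
  range : ∀ X J : Finset (Fin s), Disjoint X J → ∀ b : Op X.card H, ∃ c : Op (X ∪ J).card H,
    f (clusters X J) (place X b) = place (X ∪ J) c
  one : ∀ (x : Fin s) (J : Finset (Fin s)), x ∉ J →
    f (clusters {x} J) 1 = if (clusters {x} J).card = 1 then 1 else 0

/-- A block without `X` acts on particles where the observable is the identity. By `left` the
observable factors out, and by `one` the block gives zero unless it is a singleton. `range` says
that the block containing `X` keeps its output within its own particles, so the argument also
applies after that block has acted. -/
theorem IsLocal.sum_blockProd_apply {s : ℕ} {f : Finset (Finset (Fin s)) → SuperOp s H}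
    (hf : IsLocal f) {X J : Finset (Fin s)} (h : Disjoint X J) (b : Op X.card H) :
    ∑ B ∈ partsOf (clusters X J), blockProd f B (place X b) =
      ∑ J' ∈ J.powerset, f (clusters X J') (place X b) := by
  have key : ∀ (Y : Finset (Fin s)) (c : Op Y.card H), ∀ C ⊆ clusters X J, C.Nonempty → X ∉ C →
      Disjoint (C.sup id) Y → f C (place Y c) = if C.card = 1 then place Y c else 0 := by
    intro Y c C hC hne hX hd
    obtain ⟨x, J', hx, _, rfl⟩ := exists_eq_clusters_of_notMem hC hX hne
    rw [sup_clusters] at hd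
    have h1 := hf.left {x} J' Y (Finset.disjoint_singleton_left.mpr hx) hd c 1
    rw [mul_one, hf.one x J' hx] at h1
    rw [h1]
    split_ifs
    · rw [mul_one]
    · rw [mul_zero]
  rw [← sum_filter_powerset_clusters h fun D => f D (place X b)]
  refine sum_blockProd_apply_of_trivial (Finset.mem_insert_self _ _) ?_ ?_
  · intro C hC hne hX
    refine key X b C hC hne hX ?_
    have := disjoint_sup_of_subset_clusters h hC
      (Finset.singleton_subset_iff.mpr (Finset.mem_insert_self X _))
      (Finset.disjoint_singleton_right.mpr hX)
    rwa [Finset.sup_singleton] at this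
  · intro C hC hne hX D hD hXD hCD
    obtain ⟨J', hJ', rfl⟩ := exists_eq_clusters_of_mem hD hXD
    obtain ⟨c, hc⟩ := hf.range X J' (h.mono_right hJ') b
    rw [hc]
    refine key _ c C hC hne hX ?_
    rw [← sup_clusters]
    exact disjoint_sup_of_subset_clusters h hC hD hCD

section
variable [CompleteSpace H] {K : H →ₗ.[ℂ] H} {Φ : Op 2 H}

theorem sup_subset_of_subset_clusters {s : ℕ} {X J : Finset (Fin s)} {S : Finset (Finset (Fin s))}
    (h : S ⊆ clusters X J) : S.sup id ⊆ X ∪ J := by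
  rw [← sup_clusters]
  exact Finset.sup_mono h

/-- The groups fix the identity, so all cluster sums do; `apply_of_sum_blockProd_apply` then
propagates this from smaller sets of clusters. -/
theorem cumulant_apply_one (hK : IsSelfAdjoint K) (hΦ : IsSelfAdjoint Φ) {s : ℕ} (t : ℝ)
    {X J : Finset (Fin s)} (h : Disjoint X J) :
    cumulant K Φ s t (clusters X J) 1 = if (clusters X J).card = 1 then 1 else 0 := by
  have key : ∀ Q ⊆ clusters X J, Q.Nonempty →
      cumulant K Φ s t Q 1 = if Q.card = 1 then 1 else 0 := by
    intro Q
    induction Q using Finset.strongInduction with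
    | H Q ih =>
      intro hQ hne
      refine apply_of_sum_blockProd_apply hne ?_ fun S hS hSn => ih S hS (hS.subset.trans hQ) hSn
      rw [cumulant_eq, ← LinearMap.sum_apply, sum_blockProd_cum
        (m := fun S : Finset (Finset (Fin s)) => heis K Φ s t (S.sup id)) (heis_empty hK hΦ t)
        fun S hS S' hS' => commute_heis_sup t h S (hS.trans hQ) S' (hS'.trans hQ)]
      exact heis_one hK hΦ t _
  exact key _ subset_rfl (clusters_nonempty X J)

theorem isLocal_cumulant (hK : IsSelfAdjoint K) (hΦ : IsSelfAdjoint Φ) (s : ℕ) (t : ℝ) :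
    IsLocal (cumulant K Φ s t) where
  left X J Y h hY c b := by
    have h1 : Commute (LinearMap.mulLeft ℂ (place Y c)) (cumulant K Φ s t (clusters X J)) := by
      rw [cumulant_eq]
      refine Commute.sum_right _ _ _ fun B hB => Commute.smul_right (commute_blockProd fun S hS => ?_) _
      refine LinearMap.ext fun b => (heis_place_mul t ?_ c b).symm
      exact hY.mono_left (sup_subset_of_subset_clusters (subset_of_mem_partsOf hB hS))
    exact (LinearMap.congr_fun h1.eq b).symm
  range X J h b := by
    have h1 : ∀ L : List (Finset (Finset (Fin s))), (∀ S ∈ L, S ⊆ clusters X J) →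
        ∃ c : Op (X ∪ J).card H,
          (L.map fun S => heis K Φ s t (S.sup id)).prod (place X b) = place (X ∪ J) c := by
      intro L
      induction L with
      | nil => exact fun _ => exists_place_eq Finset.subset_union_left b
      | cons S L ih =>
        intro hL
        obtain ⟨c, hc⟩ := ih fun S' hS' => hL S' (List.mem_cons_of_mem _ hS')
        rw [List.map_cons, List.prod_cons, Module.End.mul_apply, hc]
        exact heis_mem_range_place t (sup_subset_of_subset_clusters (hL S List.mem_cons_self)) c
    have h2 : ∀ B : Finset (Finset (Finset (Fin s))), ∃ c : Op (X ∪ J).card H,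
        B ∈ partsOf (clusters X J) →
          blockProd (fun S : Finset (Finset (Fin s)) => heis K Φ s t (S.sup id)) B (place X b) =
            place (X ∪ J) c := by
      intro B
      by_cases hB : B ∈ partsOf (clusters X J)
      · obtain ⟨c, hc⟩ := h1 B.toList fun S hS => subset_of_mem_partsOf hB (Finset.mem_toList.mp hS)
        exact ⟨c, fun _ => hc⟩
      · exact ⟨0, fun h => absurd h hB⟩
    choose c hc using h2
    refine ⟨∑ B ∈ partsOf (clusters X J), cumCoeff B.card • c B, ?_⟩
    rw [cumulant_eq, cum, LinearMap.sum_apply, place_sum]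
    refine Finset.sum_congr rfl fun B hB => ?_
    rw [LinearMap.smul_apply, hc B hB, place_smul]
  one x J hx := cumulant_apply_one hK hΦ t (Finset.disjoint_singleton_left.mpr hx)

/-- On `b(X) ⊗ 𝟙` the cluster expansion expresses the group of `X ∪ S` as a sum of cumulants over
subsets of `S`. Möbius inversion returns the cumulant as an alternating sum of groups, and
collecting the terms with the same `Y = X ∪ S` assembles `zeta b` on `Y`. -/
theorem expansion_cumulant (hK : IsSelfAdjoint K) (hΦ : IsSelfAdjoint Φ) (b : Obs H) (t : ℝ) :
    expansion (cumulant K Φ) b t = moebius fun n => evol K Φ (zeta b n) t := by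
  funext s
  have h1 : ∀ X : Finset (Fin s), cumulant K Φ s t (clusters X Xᶜ) (place X (b X.card)) =
      ∑ S ∈ Xᶜ.powerset, ((-1 : ℂ) ^ (Xᶜ \ S).card) • heis K Φ s t (X ∪ S) (place X (b X.card)) := by
    intro X
    rw [← sum_powerset_neg_one_pow
      (fun S => cumulant K Φ s t (clusters X S) (place X (b X.card))) Xᶜ]
    refine Finset.sum_congr rfl fun S hS => ?_
    have hd : Disjoint X S := disjoint_compl_right.mono_right (Finset.mem_powerset.mp hS)
    rw [← (isLocal_cumulant hK hΦ s t).sum_blockProd_apply hd, ← clusterSum_cumulant hK hΦ t hd,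
      clusterSum_eq, LinearMap.sum_apply]
  rw [expansion_eq_obsSum, obsSum]
  simp only [h1]
  rw [sum_sum_powerset_compl fun X S =>
    ((-1 : ℂ) ^ (Xᶜ \ S).card) • heis K Φ s t (X ∪ S) (place X (b X.card)), moebius]
  refine Finset.sum_congr rfl fun Y _ => ?_
  rw [← heis_place, place_zeta, map_sum, Finset.smul_sum]
  refine Finset.sum_congr rfl fun X hX => ?_
  rw [Finset.mem_powerset] at hX
  have h2 : Xᶜ \ (Y \ X) = Yᶜ := by
    ext x
    simp only [Finset.mem_sdiff, Finset.mem_compl]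
    have := @hX x
    tauto
  rw [h2, Finset.union_sdiff_of_subset hX]

theorem obsSum_heis (b : Obs H) (s : ℕ) (t : ℝ) :
    obsSum (fun X J => heis K Φ s t (X ∪ J)) b = evol K Φ (zeta b s) t := by
  rw [← heis_univ, zeta, map_sum, obsSum]
  exact Finset.sum_congr rfl fun X _ => by rw [Finset.union_compl]

/-- The analogue of `expansion_cumulant` for general families, without inverting. Compatibility with
embeddings identifies the expansion on `Y`, placed among `s` particles, with the terms of the
cluster sums for which `X ∪ J' = Y`. -/
theorem zeta_expansion {𝔄 : GenOps H} (h𝔄 : IsGeneratingFamily 𝔄) (s : ℕ) (t : ℝ)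
    (hl : IsLocal (𝔄 s t)) (b : Obs H) :
    zeta (expansion 𝔄 b t) s = obsSum (fun X J => clusterSum 𝔄 s t (clusters X J)) b := by
  have h1 : ∀ X : Finset (Fin s), clusterSum 𝔄 s t (clusters X Xᶜ) (place X (b X.card)) =
      ∑ S ∈ Xᶜ.powerset, 𝔄 s t (clusters X S) (place X (b X.card)) := fun X => by
    rw [clusterSum_eq, LinearMap.sum_apply, hl.sum_blockProd_apply disjoint_compl_right]
  rw [obsSum]
  simp only [h1]
  rw [sum_sum_powerset_compl fun X S => 𝔄 s t (clusters X S) (place X (b X.card)), zeta]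
  refine Finset.sum_congr rfl fun Y _ => ?_
  rw [expansion_eq_obsSum, obsSum, place_sum, ← sum_map_orderEmbOfFin Y]
  refine Finset.sum_congr rfl fun X _ => ?_
  rw [← map_compl_orderEmbOfFin, ← place_place]
  exact (h𝔄.relabel _ _ _ t X Xᶜ disjoint_compl_right _).symm

/-- The operator is computed among the particles of `X ∪ J` alone and then embedded. -/
theorem IsGeneratingFamily.exists_range {𝔄 : GenOps H} (h𝔄 : IsGeneratingFamily 𝔄) {s : ℕ} (t : ℝ)
    {X J : Finset (Fin s)} (h : Disjoint X J) (b : Op X.card H) :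
    ∃ c : Op (X ∪ J).card H, 𝔄 s t (clusters X J) (place X b) = place (X ∪ J) c := by
  obtain ⟨X', hX'⟩ := exists_map_eq_of_subset (Finset.subset_union_left (s₁ := X) (s₂ := J))
  obtain ⟨J', hJ'⟩ := exists_map_eq_of_subset (Finset.subset_union_right (s₁ := X) (s₂ := J))
  set e := ((X ∪ J).orderEmbOfFin rfl).toEmbedding with he
  have hd : Disjoint X' J' := by
    rw [← Finset.disjoint_map e, hX', hJ']
    exact h
  obtain ⟨b', rfl⟩ := exists_obs _ b
  refine ⟨𝔄 _ t (clusters X' J') (place X' (b' X'.card)),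
    Eq.trans ?_ (h𝔄.relabel _ _ e t X' J' hd _)⟩
  rw [hX', hJ']
  congr 1
  have := place_place (X ∪ J) X' b'
  rw [← he, hX'] at this
  exact this.symm

theorem IsGeneratingFamily.clusters_singleton_one {𝔄 : GenOps H} (h𝔄 : IsGeneratingFamily 𝔄)
    {s : ℕ} (t : ℝ) {x : Fin s} {J : Finset (Fin s)} (hx : x ∉ J) {k : ℕ} (hk : J.card + 1 = k)
    {z : ℂ} (h : ∀ y : Fin k, 𝔄 k t (clusters {y} {y}ᶜ) 1 = z • 1) :
    𝔄 s t (clusters {x} J) 1 = z • 1 := by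
  have hc : (insert x J).card = k := by rw [Finset.card_insert_of_notMem hx, hk]
  set e := ((insert x J).orderEmbOfFin hc).toEmbedding with he
  obtain ⟨y, hy⟩ : ∃ y, e y = x := by
    have : x ∈ Set.range ((insert x J).orderEmbOfFin hc) := by
      rw [Finset.range_orderEmbOfFin]
      simp
    exact this
  have hJ : ({y}ᶜ : Finset (Fin k)).map e = J := by
    rw [Finset.compl_eq_univ_sdiff, Finset.map_sdiff, Finset.map_singleton, hy]
    have : Finset.univ.map e = insert x J := Finset.map_orderEmbOfFin_univ _ hc
    rw [this, Finset.sdiff_singleton_eq_erase, Finset.erase_insert hx]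
  have h1 := h𝔄.relabel _ _ e t {y} {y}ᶜ disjoint_compl_right 1
  rwa [Finset.map_singleton, hy, hJ, ampl_one, h y, ampl_smul, ampl_one] at h1

/-- With `b_1 = 𝟙` as the only data all terms of the sum coincide, so the sum is a nonzero multiple
of one operator and the value on the identity can be read off. -/
theorem tupleSum_trunc_one {n : ℕ} {𝔗 : Finset (Fin (n + 1)) → Finset (Fin (n + 1)) → SuperOp (n + 1) H}
    {v : Op (n + 1) H} (h : ∀ x, 𝔗 {x} {x}ᶜ 1 = v) :
    tupleSum n 𝔗 (trunc 1 1) = (n.factorial * (n + 1).choose n) • v := by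
  rw [tupleSum_eq, mul_smul]
  congr 1
  rw [Finset.sum_congr rfl (g := fun _ => v), Finset.sum_const, Finset.card_powersetCard,
    Finset.card_fin]
  intro J hJ
  have hJ' : Jᶜ.card = 1 := by
    rw [Finset.card_compl, (Finset.mem_powersetCard.mp hJ).2, Fintype.card_fin]
    omega
  obtain ⟨x, hx⟩ := Finset.card_eq_one.mp hJ'
  have h1 : trunc 1 (1 : Obs H) Jᶜ.card = 1 := by
    rw [trunc, if_pos hJ']
    rfl
  rw [h1, place_one, hx, ← h x, ← hx, compl_compl]

theorem isSymm_one (n : ℕ) : IsSymm (1 : Op n H) := fun _ => ampl_one _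

theorem trunc_one_mem (γ : ℝ) (k : ℕ) : trunc k (1 : Obs H) ∈ obsSpace H γ :=
  trunc_mem γ k (IsSelfAdjoint.one _) (isSymm_one k)

/-- A distinguished cluster with one particle is indistinguishable from the other one-particle
clusters. -/
theorem clusters_singleton_compl {n : ℕ} (x y : Fin n) :
    clusters {x} {x}ᶜ = clusters {y} {y}ᶜ := by
  have h : ∀ z : Fin n, clusters {z} {z}ᶜ = Finset.univ.image fun j : Fin n => ({j} : Finset (Fin n)) := by
    intro z
    rw [clusters, ← Finset.image_insert (fun j : Fin n => ({j} : Finset (Fin n))),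
      Finset.insert_compl_self]
  rw [h, h]

theorem IsGeneratingFamily.isLocal {𝔄 : GenOps H} (h𝔄 : IsGeneratingFamily 𝔄) (t : ℝ)
    (h : ∀ (n : ℕ) (y : Fin (n + 1)),
      𝔄 (n + 1) t (clusters {y} {y}ᶜ) 1 = (if n = 0 then (1 : ℂ) else 0) • 1) (s : ℕ) :
    IsLocal (𝔄 s t) where
  left X J Y hXJ hY c b := h𝔄.local_left s t X J Y hXJ hY c b
  range X J hXJ b := h𝔄.exists_range t hXJ b
  one x J hx := by
    rw [h𝔄.clusters_singleton_one t hx rfl (h J.card),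
      card_clusters (Finset.disjoint_singleton_left.mpr hx)]
    by_cases hJ : J.card = 0 <;> simp [hJ]

theorem factorial_mul_choose_ne_zero (n : ℕ) : n.factorial * (n + 1).choose n ≠ 0 :=
  mul_ne_zero n.factorial_ne_zero (Nat.choose_pos n.le_succ).ne'

theorem nsmul_injective {n : ℕ} {v w : Op n H} {N : ℕ} (hN : N ≠ 0) (h : N • v = N • w) : v = w := by
  rw [← Nat.cast_smul_eq_nsmul ℂ, ← Nat.cast_smul_eq_nsmul ℂ] at h
  exact smul_right_injective _ (Nat.cast_ne_zero.mpr hN) h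

theorem isLocal_of_eqOnObs (hK : IsSelfAdjoint K) (hΦ : IsSelfAdjoint Φ) {𝔄 : GenOps H}
    (h𝔄 : IsGeneratingFamily 𝔄) {γ : ℝ} (h : EqOnObs γ 𝔄 (cumulant K Φ)) (s : ℕ) (t : ℝ) :
    IsLocal (𝔄 s t) := by
  refine h𝔄.isLocal t (fun n y => ?_) s
  have h1 := h _ (trunc_one_mem γ 1) t (n + 1) n
  rw [tupleSum_trunc_one (v := 𝔄 (n + 1) t (clusters {y} {y}ᶜ) 1)
      fun x => by rw [clusters_singleton_compl x y],
    tupleSum_trunc_one (v := cumulant K Φ (n + 1) t (clusters {y} {y}ᶜ) 1)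
      fun x => by rw [clusters_singleton_compl x y]] at h1
  rw [nsmul_injective (factorial_mul_choose_ne_zero n) h1,
    cumulant_apply_one hK hΦ t disjoint_compl_right, card_clusters disjoint_compl_right,
    Finset.card_compl, Fintype.card_fin, Finset.card_singleton]
  by_cases hn : n = 0 <;> simp [hn]

/-- Testing on `b_1 = 𝟙` shows that the full cluster sum fixes the identity. By induction every
proper subset of clusters already acts on the identity like a cumulant, and
`apply_of_clusterSum_apply` settles the full set. -/
theorem isLocal_of_solvesClusterExpansionsOnObs (hK : IsSelfAdjoint K) (hΦ : IsSelfAdjoint Φ)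
    {𝔄 : GenOps H} (h𝔄 : IsGeneratingFamily 𝔄) {γ : ℝ}
    (h : SolvesClusterExpansionsOnObs K Φ γ 𝔄) (s : ℕ) (t : ℝ) : IsLocal (𝔄 s t) := by
  refine h𝔄.isLocal t (fun n => ?_) s
  induction n using Nat.strong_induction_on with
  | _ n ih =>
    intro y
    have h1 := h _ (trunc_one_mem γ 1) t (n + 1) n
    have e1 := tupleSum_trunc_one (𝔗 := fun X J => heis K Φ (n + 1) t (X ∪ J)) (v := 1)
      fun x => heis_one hK hΦ t _
    have e2 := tupleSum_trunc_one (𝔗 := fun X J => clusterSum 𝔄 (n + 1) t (clusters X J))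
      (v := clusterSum 𝔄 (n + 1) t (clusters {y} {y}ᶜ) 1)
      fun x => by rw [clusters_singleton_compl x y]
    have h2 := nsmul_injective (factorial_mul_choose_ne_zero n) (e1.symm.trans (h1.trans e2))
    have hc : (clusters {y} {y}ᶜ : Finset (Finset (Fin (n + 1)))).card = n + 1 := by
      rw [card_clusters disjoint_compl_right, Finset.card_compl, Fintype.card_fin,
        Finset.card_singleton]
      omega
    rw [apply_of_clusterSum_apply (clusters_nonempty _ _) h2.symm, hc]
    · by_cases hn : n = 0 <;> simp [hn]
    · intro S hS hne
      obtain ⟨x, J, hx, rfl⟩ : ∃ x J, x ∉ J ∧ S = clusters {x} J := by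
        by_cases hy : {y} ∈ S
        · obtain ⟨J, hJ, rfl⟩ := exists_eq_clusters_of_mem hS.subset hy
          exact ⟨y, J, fun hyJ => by simpa using hJ hyJ, rfl⟩
        · obtain ⟨x, J, hx, _, rfl⟩ := exists_eq_clusters_of_notMem hS.subset hy hne
          exact ⟨x, J, hx, rfl⟩
      have hlt := Finset.card_lt_card hS
      rw [hc, card_clusters (Finset.disjoint_singleton_left.mpr hx)] at hlt
      rw [h𝔄.clusters_singleton_one t hx rfl (ih J.card (by omega)),
        card_clusters (Finset.disjoint_singleton_left.mpr hx)]
      by_cases hJ : J.card = 0 <;> simp [hJ]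

theorem eqOnObs_iff (γ : ℝ) (𝔄 𝔅 : GenOps H) :
    EqOnObs γ 𝔄 𝔅 ↔ ∀ b ∈ obsSpace H γ, ∀ t : ℝ, expansion 𝔄 b t = expansion 𝔅 b t := by
  rw [EqOnObs, tupleSum_eq_iff_obsSum_eq γ (fun s t X J => 𝔄 s t (clusters X J))
    (fun s t X J => 𝔅 s t (clusters X J))]
  simp only [funext_iff, expansion_eq_obsSum]

/-- Each side separately implies `IsLocal`. Under it the first side says that `zeta` of the
expansion is the evolved `zeta b`, the second that the expansion is `moebius` of it, and these agree
because the two transforms are inverse to each other. -/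
theorem solvesClusterExpansionsOnObs_iff (hK : IsSelfAdjoint K) (hΦ : IsSelfAdjoint Φ)
    {𝔄 : GenOps H} (h𝔄 : IsGeneratingFamily 𝔄) (γ : ℝ) :
    SolvesClusterExpansionsOnObs K Φ γ 𝔄 ↔ EqOnObs γ 𝔄 (cumulant K Φ) := by
  have key : (∀ s t, IsLocal (𝔄 s t)) →
      (SolvesClusterExpansionsOnObs K Φ γ 𝔄 ↔ EqOnObs γ 𝔄 (cumulant K Φ)) := by
    intro hl
    rw [eqOnObs_iff, SolvesClusterExpansionsOnObs, tupleSum_eq_iff_obsSum_eq γ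
      (fun s t X J => heis K Φ s t (X ∪ J)) (fun s t X J => clusterSum 𝔄 s t (clusters X J))]
    refine forall_congr' fun b => forall_congr' fun hb => forall_congr' fun t => ?_
    rw [expansion_cumulant hK hΦ]
    constructor
    · intro h
      have h1 : zeta (expansion 𝔄 b t) = fun n => evol K Φ (zeta b n) t := funext fun s => by
        rw [zeta_expansion h𝔄 s t (hl s t), ← h s, obsSum_heis]
      rw [← h1, moebius_zeta]
    · intro h s
      rw [obsSum_heis, ← zeta_expansion h𝔄 s t (hl s t), h, zeta_moebius]
  exact ⟨fun h => (key (isLocal_of_solvesClusterExpansionsOnObs hK hΦ h𝔄 h)).mp h,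
    fun h => (key (isLocal_of_eqOnObs hK hΦ h𝔄 h)).mpr h⟩

end
end
end QuantumHierarchy

namespace QuantumHierarchy
open scoped ComplexOrder InnerProductSpace ComplexConjugate
noncomputable section

/-! ### Symmetry of the transforms and the source term of the hierarchy. -/

variable {H : Type*} [NormedAddCommGroup H] [InnerProductSpace ℂ H] {s : ℕ}

theorem isSelfAdjoint_place (X : Finset (Fin s)) {b : Op X.card H} (hb : IsSelfAdjoint b) :
    IsSelfAdjoint (place X b) := by
  rw [isSelfAdjoint_iff, place, ← ampl_star, hb.star_eq]

theorem isSymm_sum_place {a : Obs H} (ha : ∀ n, IsSymm (a n)) (c : ℕ → ℂ) (n : ℕ) :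
    IsSymm (∑ Y : Finset (Fin n), c Yᶜ.card • place Y (a Y.card)) := by
  intro σ
  have h : ∀ Y : Finset (Fin n), ampl σ.toEmbedding (c Yᶜ.card • place Y (a Y.card)) =
      c (Y.map σ.toEmbedding)ᶜ.card •
        place (Y.map σ.toEmbedding) (a (Y.map σ.toEmbedding).card) := fun Y => by
    have hc : (Y.map σ.toEmbedding)ᶜ.card = Yᶜ.card := by
      rw [Finset.card_compl, Finset.card_compl, Finset.card_map]
    rw [ampl_smul, ampl_place _ _ ha, hc]
  rw [ampl_sum, Finset.sum_congr rfl fun Y _ => h Y]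
  exact Equiv.sum_comp σ.finsetCongr fun Y => c Yᶜ.card • place Y (a Y.card)

theorem isSymm_zeta {b : Obs H} (hb : ∀ n, IsSymm (b n)) (n : ℕ) : IsSymm (zeta b n) := by
  have := isSymm_sum_place hb (fun _ => 1) n
  simp only [one_smul] at this
  exact this

theorem isSymm_moebius {b : Obs H} (hb : ∀ n, IsSymm (b n)) (n : ℕ) : IsSymm (moebius b n) :=
  isSymm_sum_place hb (fun k => (-1) ^ k) n

theorem isSelfAdjoint_zeta {b : Obs H} (hb : ∀ n, IsSelfAdjoint (b n)) (n : ℕ) :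
    IsSelfAdjoint (zeta b n) :=
  isSelfAdjoint_sum _ fun Y _ => isSelfAdjoint_place Y (hb _)

theorem isSelfAdjoint_moebius {b : Obs H} (hb : ∀ n, IsSelfAdjoint (b n)) (n : ℕ) :
    IsSelfAdjoint (moebius b n) := by
  refine isSelfAdjoint_sum _ fun Y _ => ?_
  refine IsSelfAdjoint.smul ?_ (isSelfAdjoint_place Y (hb _))
  exact ((IsSelfAdjoint.one ℂ).neg).pow _

/-- Relative to the full set, the complement of `Y` loses the particle `i`, which flips the sign. -/
theorem place_compl_moebius (a : Obs H) (i : Fin s) :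
    place {i}ᶜ (moebius a ({i}ᶜ : Finset (Fin s)).card) = ∑ Y : Finset (Fin s),
      if i ∉ Y then (-(-1 : ℂ) ^ Yᶜ.card) • place Y (a Y.card) else 0 := by
  have h : ({i}ᶜ : Finset (Fin s)).powerset = Finset.univ.filter fun Y => i ∉ Y := by
    ext Y
    simp
  rw [place_moebius, ← Finset.sum_filter, h]
  refine Finset.sum_congr rfl fun Y hY => ?_
  have hi : i ∈ Yᶜ := Finset.mem_compl.mpr (Finset.mem_filter.mp hY).2
  have h1 : {i}ᶜ \ Y = Yᶜ.erase i := by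
    ext x
    simp
  have h2 := Finset.card_erase_add_one hi
  rw [h1, ← h2, pow_succ, mul_neg_one, neg_neg]

/-- The commutator of `b` with `Φ(i, j)`. -/
def pairComm (Φ : Op 2 H) (b : Op s H) (i j : Fin s) : Op s H := b * pairOp Φ i j - pairOp Φ i j * b

variable [CompleteSpace H]

theorem pairComm_self (Φ : Op 2 H) (b : Op s H) (i : Fin s) : pairComm Φ b i i = 0 := by
  rw [pairComm, pairOp_self, mul_zero, zero_mul, sub_zero]

theorem pairComm_sum {α : Type*} (Φ : Op 2 H) (S : Finset α) (b : α → Op s H) (i j : Fin s) :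
    pairComm Φ (∑ Y ∈ S, b Y) i j = ∑ Y ∈ S, pairComm Φ (b Y) i j := by
  simp only [pairComm, Finset.sum_mul, Finset.mul_sum, Finset.sum_sub_distrib]

theorem pairComm_smul (Φ : Op 2 H) (c : ℂ) (b : Op s H) (i j : Fin s) :
    pairComm Φ (c • b) i j = c • pairComm Φ b i j := by
  simp only [pairComm, smul_mul_assoc, mul_smul_comm, smul_sub]

theorem pairComm_zero (Φ : Op 2 H) (i j : Fin s) : pairComm Φ 0 i j = 0 := by
  rw [pairComm, zero_mul, mul_zero, sub_zero]

theorem pairComm_place_of_notMem (Φ : Op 2 H) {Y : Finset (Fin s)} (b : Op Y.card H) {i j : Fin s}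
    (hi : i ∉ Y) (hj : j ∉ Y) : pairComm Φ (place Y b) i j = 0 := by
  rcases eq_or_ne i j with rfl | hij
  · exact pairComm_self _ _ _
  · rw [pairComm, sub_eq_zero, pairOp, dif_pos hij]
    refine ampl_commute _ _ (fun k l hkl => ?_) b Φ
    have hk : Y.orderEmbOfFin rfl k ∈ Y := Finset.orderEmbOfFin_mem Y rfl k
    change Y.orderEmbOfFin rfl k = ![i, j] l at hkl
    rw [hkl] at hk
    fin_cases l
    · exact hi hk
    · exact hj hk

/-- Doubling replaces pairs by ordered pairs not contained in `Y`. Those entirely outside `Y`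
commute with `place Y b`; every other one has exactly one label outside, and the symmetry of `Φ`
lets that label be the first. -/
theorem comm_restPotential {Φ : Op 2 H} (hΦs : IsSymm Φ) {Y : Finset (Fin s)} (b : Op Y.card H) :
    place Y b * restPotential Φ (Y.orderEmbOfFin rfl).toEmbedding -
        restPotential Φ (Y.orderEmbOfFin rfl).toEmbedding * place Y b =
      ∑ i, ∑ j, if i ∉ Y then pairComm Φ (place Y b) i j else 0 := by
  set e := (Y.orderEmbOfFin rfl).toEmbedding
  have h0 : Finset.univ.map e = Y := Finset.map_orderEmbOfFin_univ Y rfl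
  have h1 : (2 : ℂ) • (place Y b * restPotential Φ e - restPotential Φ e * place Y b) =
      ∑ i, ∑ j, if i ∈ Y ∧ j ∈ Y then 0 else pairComm Φ (place Y b) i j := by
    rw [smul_sub, ← mul_smul_comm, ← smul_mul_assoc, two_smul_restPotential hΦs, h0]
    simp only [Finset.mul_sum, Finset.sum_mul]
    simp only [← Finset.sum_sub_distrib]
    refine Finset.sum_congr rfl fun i _ => Finset.sum_congr rfl fun j _ => ?_
    split_ifs
    · rw [mul_zero, zero_mul, sub_zero]
    · rfl
  have h2 : ∀ i j, (if i ∈ Y ∧ j ∈ Y then 0 else pairComm Φ (place Y b) i j) =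
      (if i ∉ Y then pairComm Φ (place Y b) i j else 0) +
        if j ∉ Y then pairComm Φ (place Y b) j i else 0 := by
    intro i j
    have hs : pairComm Φ (place Y b) j i = pairComm Φ (place Y b) i j := by
      rw [pairComm, pairComm, pairOp_comm hΦs]
    rw [hs]
    by_cases hi : i ∈ Y <;> by_cases hj : j ∈ Y
    · simp [hi, hj]
    · simp [hi, hj]
    · simp [hi, hj]
    · rw [pairComm_place_of_notMem Φ b hi hj]
      simp
  have h3 : (2 : ℂ) • (place Y b * restPotential Φ e - restPotential Φ e * place Y b) =
      (2 : ℂ) • ∑ i, ∑ j, if i ∉ Y then pairComm Φ (place Y b) i j else 0 := by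
    rw [h1]
    simp only [h2, Finset.sum_add_distrib]
    rw [two_smul]
    congr 1
    exact Finset.sum_comm
  exact smul_right_injective _ two_ne_zero h3

theorem nCreationComm_eq (Φ : Op 2 H) (b : Obs H) (s : ℕ) : nCreationComm Φ b s =
    ∑ i : Fin s, ∑ j : Fin s,
      -Complex.I • pairComm Φ (place {i}ᶜ (b ({i}ᶜ : Finset (Fin s)).card)) i j := by
  refine Finset.sum_congr rfl fun i _ => ?_
  rw [Finset.sum_filter]
  refine Finset.sum_congr rfl fun j _ => ?_
  split_ifs with h
  · rfl
  · rw [not_ne_iff] at h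
    rw [← h, pairComm_self, smul_zero]

/-- Both sides are sums over `Y`, `i ∉ Y` and `j` of commutators with `Φ(i,j)`. The sign from
removing `i` turns the factor `-i` of the interaction into the `i` of the Heisenberg source. -/
theorem nCreationComm_moebius {Φ : Op 2 H} (hΦs : IsSymm Φ) (a : Obs H) (s : ℕ) :
    nCreationComm Φ (moebius a) s = ∑ Y : Finset (Fin s), ((-1 : ℂ) ^ Yᶜ.card) • Complex.I •
      (place Y (a Y.card) * restPotential Φ (Y.orderEmbOfFin rfl).toEmbedding -
        restPotential Φ (Y.orderEmbOfFin rfl).toEmbedding * place Y (a Y.card)) := by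
  rw [nCreationComm_eq]
  have h : ∀ i j : Fin s,
      -Complex.I • pairComm Φ (place {i}ᶜ (moebius a ({i}ᶜ : Finset (Fin s)).card)) i j =
        ∑ Y : Finset (Fin s), ((-1 : ℂ) ^ Yᶜ.card) • Complex.I •
          if i ∉ Y then pairComm Φ (place Y (a Y.card)) i j else 0 := by
    intro i j
    rw [place_compl_moebius, pairComm_sum, Finset.smul_sum]
    refine Finset.sum_congr rfl fun Y _ => ?_
    split_ifs
    · rw [pairComm_zero, smul_zero, smul_zero, smul_zero]
    · rw [pairComm_smul, smul_smul, smul_smul]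
      congr 1
      ring
  simp only [h, comm_restPotential hΦs, Finset.smul_sum]
  exact (Finset.sum_congr rfl fun i _ => Finset.sum_comm).trans Finset.sum_comm

/-- The hierarchy is triangular, which permits induction on the number of particles for uniqueness.
-/
theorem nCreationComm_congr (Φ : Op 2 H) {b b' : Obs H} (h : ∀ n < s, b n = b' n) :
    nCreationComm Φ b s = nCreationComm Φ b' s := by
  rw [nCreationComm_eq, nCreationComm_eq]
  refine Finset.sum_congr rfl fun i _ => ?_
  have hlt : ({i}ᶜ : Finset (Fin s)).card < s := by
    have := i.pos
    rw [Finset.card_compl, Fintype.card_fin, Finset.card_singleton]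
    omega
  rw [h _ hlt]

end
end QuantumHierarchy

namespace QuantumHierarchy
open scoped ComplexOrder InnerProductSpace ComplexConjugate
noncomputable section

/-! ### Norm estimates, solution, uniqueness and the equivalences. -/

variable {H : Type*} [NormedAddCommGroup H] [InnerProductSpace ℂ H]

section Bounds
variable {γ : ℝ}

theorem obsNorm_nonneg (hγ : 0 < γ) (b : Obs H) : 0 ≤ obsNorm γ b :=
  Real.iSup_nonneg fun n => by positivity

theorem le_obsNorm {b : Obs H} (hb : b ∈ obsSpace H γ) (n : ℕ) :
    γ ^ n / (n.factorial : ℝ) * ‖b n‖ ≤ obsNorm γ b := le_ciSup hb.2.2 n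

theorem norm_zeta_le (b : Obs H) (n : ℕ) : ‖zeta b n‖ ≤ ∑ X : Finset (Fin n), ‖b X.card‖ :=
  (norm_sum_le _ _).trans (Finset.sum_le_sum fun X _ => norm_place_le X _)

theorem norm_moebius_le (a : Obs H) (n : ℕ) : ‖moebius a n‖ ≤ ∑ Y : Finset (Fin n), ‖a Y.card‖ := by
  refine (norm_sum_le _ _).trans (Finset.sum_le_sum fun Y _ => ?_)
  rw [norm_smul, norm_pow, norm_neg, norm_one, one_pow, one_mul]
  exact norm_place_le Y _

/-- For each `X` there are `2 ^ (s - |X|)` sets `Y` with `X ⊆ Y ⊆ (1,…,s)`. -/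
theorem norm_moebius_le_of_norm_le_zeta {a b : Obs H} (h : ∀ n, ‖a n‖ ≤ ‖zeta b n‖) (s : ℕ) :
    ‖moebius a s‖ ≤ ∑ k ∈ Finset.range (s + 1), (s.choose k : ℝ) * (2 ^ (s - k) * ‖b k‖) := by
  have h1 : ‖moebius a s‖ ≤ ∑ Y : Finset (Fin s), ∑ X ∈ Y.powerset, ‖b X.card‖ := by
    refine (norm_moebius_le a s).trans (Finset.sum_le_sum fun Y _ => ?_)
    refine (h _).trans ((norm_zeta_le b _).trans ?_)
    rw [← sum_map_orderEmbOfFin Y]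
    exact (Finset.sum_congr rfl fun X _ => by rw [Finset.card_map]).le
  refine h1.trans ?_
  rw [← sum_sum_powerset_compl fun X _ => ‖b X.card‖]
  have h2 : ∀ X : Finset (Fin s), ∑ _S ∈ Xᶜ.powerset, ‖b X.card‖ = 2 ^ (s - X.card) * ‖b X.card‖ := by
    intro X
    rw [Finset.sum_const, Finset.card_powerset, Finset.card_compl, Fintype.card_fin, nsmul_eq_mul]
    push_cast
    rfl
  simp only [h2]
  have h3 := Finset.sum_powerset_apply_card (x := (Finset.univ : Finset (Fin s)))
    (fun k => (2 : ℝ) ^ (s - k) * ‖b k‖)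
  rw [Finset.powerset_univ, Finset.card_fin] at h3
  rw [h3]
  simp only [nsmul_eq_mul, le_refl]

theorem weighted_norm_moebius_le (hγ : 0 < γ) {a b : Obs H} (hb : b ∈ obsSpace H γ)
    (h : ∀ n, ‖a n‖ ≤ ‖zeta b n‖) (s : ℕ) :
    γ ^ s / (s.factorial : ℝ) * ‖moebius a s‖ ≤ Real.exp (2 * γ) * obsNorm γ b := by
  have h1 : γ ^ s / (s.factorial : ℝ) * ‖moebius a s‖ ≤
      ∑ k ∈ Finset.range (s + 1), (2 * γ) ^ (s - k) / ((s - k).factorial : ℝ) * obsNorm γ b := by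
    refine (mul_le_mul_of_nonneg_left (norm_moebius_le_of_norm_le_zeta h s) (by positivity)).trans ?_
    rw [Finset.mul_sum]
    refine Finset.sum_le_sum fun k hk => ?_
    have hk : k ≤ s := by
      rw [Finset.mem_range] at hk
      omega
    -- The binomial coefficient splits the weight into that of `b k` and a term of the exponential
    -- series of `2γ`.
    have h2 : γ ^ s / (s.factorial : ℝ) * ((s.choose k : ℝ) * (2 ^ (s - k) * ‖b k‖)) =
        (2 * γ) ^ (s - k) / ((s - k).factorial : ℝ) * (γ ^ k / (k.factorial : ℝ) * ‖b k‖) := by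
      have h3 : γ ^ s = γ ^ k * γ ^ (s - k) := by rw [← pow_add, Nat.add_sub_cancel' hk]
      rw [Nat.cast_choose ℝ hk, h3, mul_pow]
      field_simp
    rw [h2]
    exact mul_le_mul_of_nonneg_left (le_obsNorm hb k) (by positivity)
  refine h1.trans ?_
  rw [← Finset.sum_mul]
  refine mul_le_mul_of_nonneg_right ?_ (obsNorm_nonneg hγ b)
  exact (Finset.sum_range_reflect (fun k => (2 * γ) ^ k / (k.factorial : ℝ)) (s + 1)).trans_le
    (Real.sum_le_exp_of_nonneg (by positivity) _)

end Bounds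

variable [CompleteSpace H] {K : H →ₗ.[ℂ] H} {Φ : Op 2 H} {γ : ℝ}

theorem norm_evol_zeta_le (hK : IsSelfAdjoint K) (hΦ : IsSelfAdjoint Φ) (b : Obs H) (t : ℝ) (n : ℕ) :
    ‖evol K Φ (zeta b n) t‖ ≤ ‖zeta b n‖ := norm_evol_le hK hΦ _ t

/-- The expansion with the cumulants is a solution of the dual BBGKY hierarchy. -/
theorem isSolution_moebius_evol_zeta (hK : IsSelfAdjoint K) (hΦ : IsSelfAdjoint Φ) (hΦs : IsSymm Φ)
    (hγ : 0 < γ) {b : Obs H} (hb : b ∈ obsSpace H γ) :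
    IsSolution K Φ γ b fun t => moebius fun n => evol K Φ (zeta b n) t where
  mem t := by
    refine ⟨isSelfAdjoint_moebius fun n => isSelfAdjoint_evol hK hΦ (isSelfAdjoint_zeta hb.1 n) t,
      isSymm_moebius fun n => isSymm_evol hK hΦ hΦs (isSymm_zeta hb.2.1 n) t,
      Real.exp (2 * γ) * obsNorm γ b, ?_⟩
    rintro _ ⟨s, rfl⟩
    exact weighted_norm_moebius_le hγ hb (norm_evol_zeta_le hK hΦ b t) s
  continuous s := by
    refine WeakCont.sum _ fun Y _ => WeakCont.smul ?_ _
    exact weakCont_ampl (norm_evol_le hK hΦ _) (weakCont_evol hK hΦ _) _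
  equation s := by
    have h1 : WeakSol K Φ (fun t => moebius (fun n => evol K Φ (zeta b n) t) s) (fun t =>
        nCreationComm Φ (moebius fun n => evol K Φ (zeta b n) t) s) := by
      simp only [nCreationComm_moebius hΦs]
      refine WeakSol.sum _ fun Y _ => WeakSol.smul ?_ _
      exact (weakSol_evol hK hΦ _).ampl hK hΦ (norm_evol_le hK hΦ _) _
    exact h1
  initial := by
    simp only [evol_zero hK hΦ]
    exact moebius_zeta b

theorem expansionSolves_cumulant (hK : IsSelfAdjoint K) (hΦ : IsSelfAdjoint Φ) (hΦs : IsSymm Φ)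
    (hγ : 0 < γ) : ExpansionSolves K Φ γ (cumulant K Φ) := fun b hb => by
  have h : expansion (cumulant K Φ) b = fun t => moebius fun n => evol K Φ (zeta b n) t :=
    funext fun t => expansion_cumulant hK hΦ b t
  rw [h]
  exact isSolution_moebius_evol_zeta hK hΦ hΦs hγ hb

theorem IsSolution.unique (hK : IsSelfAdjoint K) (hΦ : IsSelfAdjoint Φ) {b : Obs H}
    {B B' : ℝ → Obs H} (h : IsSolution K Φ γ b B) (h' : IsSolution K Φ γ b B') (t : ℝ) : B t = B' t := by
  have key : ∀ s t, B t s = B' t s := by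
    intro s
    induction s using Nat.strong_induction_on with
    | _ s ih =>
      have h1 : WeakSol K Φ (fun t => B t s) (fun t => nCreationComm Φ (B t) s) := h.equation s
      have h2 : WeakSol K Φ (fun t => B' t s) (fun t => nCreationComm Φ (B' t) s) := h'.equation s
      have c1 : WeakCont fun t => B t s := h.continuous s
      have c2 : WeakCont fun t => B' t s := h'.continuous s
      intro t
      refine sub_eq_zero.mp ((h1.sub h2).eq_zero hK hΦ (fun t => ?_) (c1.sub c2) ?_ t)
      · rw [nCreationComm_congr Φ fun n hn => ih n hn t, sub_self]
      · rw [h.initial, h'.initial, sub_self]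
  exact funext fun s => key s t

/-- The cumulant expansion is a solution and solutions are unique, so solving means agreeing with
it. -/
theorem expansionSolves_iff (hK : IsSelfAdjoint K) (hΦ : IsSelfAdjoint Φ) (hΦs : IsSymm Φ)
    (hγ : 0 < γ) (𝔄 : GenOps H) : ExpansionSolves K Φ γ 𝔄 ↔
      ∀ b ∈ obsSpace H γ, ∀ t : ℝ, expansion 𝔄 b t = expansion (cumulant K Φ) b t := by
  have hc := expansionSolves_cumulant hK hΦ hΦs hγ
  constructor
  · exact fun h b hb t => (h b hb).unique hK hΦ (hc b hb) t
  · intro h b hb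
    rw [show expansion 𝔄 b = expansion (cumulant K Φ) b from funext fun t => h b hb t]
    exact hc b hb

theorem expansionSolves_of_solvesClusterExpansions (hK : IsSelfAdjoint K) (hΦ : IsSelfAdjoint Φ)
    (hΦs : IsSymm Φ) (hγ : 0 < γ) {𝔄 : GenOps H} (h : SolvesClusterExpansions K Φ 𝔄) :
    ExpansionSolves K Φ γ 𝔄 := by
  rw [solvesClusterExpansions_iff hK hΦ] at h
  rw [expansionSolves_iff hK hΦ hΦs hγ]
  intro b _ t
  funext s
  rw [expansion_eq_obsSum, expansion_eq_obsSum]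
  exact Finset.sum_congr rfl fun X _ => by simp only [h s t X Xᶜ disjoint_compl_right]

theorem obsNorm_expansion_le (hK : IsSelfAdjoint K) (hΦ : IsSelfAdjoint Φ) (hΦs : IsSymm Φ)
    (hγ : 0 < γ) {𝔄 : GenOps H} (h : ExpansionSolves K Φ γ 𝔄) {b : Obs H} (hb : b ∈ obsSpace H γ)
    (t : ℝ) : obsNorm γ (expansion 𝔄 b t) ≤ Real.exp (2 * γ) * obsNorm γ b := by
  rw [(expansionSolves_iff hK hΦ hΦs hγ 𝔄).mp h b hb t, expansion_cumulant hK hΦ]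
  exact ciSup_le fun s => weighted_norm_moebius_le hγ hb (norm_evol_zeta_le hK hΦ b t) s

theorem groupExpansion_apply_one (hK : IsSelfAdjoint K) (hΦ : IsSelfAdjoint Φ) (c : ℝ → ℕ → ℂ)
    {s : ℕ} (t : ℝ) (Q : Finset (Finset (Fin s))) :
    groupExpansion K Φ c s t Q 1 = (∑ B ∈ partsOf Q, c t B.card) • 1 := by
  have h : ∀ L : List (Finset (Finset (Fin s))),
      (L.map fun S => heis K Φ s t (S.sup id)).prod 1 = 1 := by
    intro L
    induction L with
    | nil => rfl
    | cons S L ih =>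
      rw [List.map_cons, List.prod_cons, Module.End.mul_apply, ih]
      exact heis_one hK hΦ t _
  rw [groupExpansion_eq, LinearMap.sum_apply, Finset.sum_smul]
  refine Finset.sum_congr rfl fun B _ => ?_
  rw [LinearMap.smul_apply]
  exact congrArg _ (h _)

theorem expansion_trunc_zero_one (𝔄 : GenOps H) (t : ℝ) (s : ℕ) :
    expansion 𝔄 (trunc 0 1) t s = 𝔄 s t (clusters ∅ Finset.univ) 1 := by
  rw [expansion_eq_obsSum, obsSum, Finset.sum_eq_single ∅]
  · have h : trunc 0 (1 : Obs H) (∅ : Finset (Fin s)).card = 1 := rfl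
    rw [h, place_one, Finset.compl_empty]
  · intro X _ hX
    have h : trunc 0 (1 : Obs H) X.card = 0 := by
      rw [trunc, if_neg (Finset.card_ne_zero.mpr (Finset.nonempty_iff_ne_empty.mpr hX))]
    have h0 : place X (0 : Op X.card H) = 0 := ampl_zero _
    rw [h, h0, map_zero]
  · exact fun h => absurd (Finset.mem_univ _) h

theorem one_ne_zero_of_le {r s : ℕ} (h : r ≤ s) (h1 : (1 : Op s H) ≠ 0) : (1 : Op r H) ≠ 0 := by
  intro h0
  refine h1 ?_
  rw [← ampl_one (Fin.castLEEmb h), h0, ampl_zero]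

/-- With `b_0 = 1` as the only data, the `r`-particle term contains the empty cluster and `r` single
particles, that is `r + 1` clusters. The groups fix the identity, so only sums of coefficients over
partitions of these clusters are compared; this is the origin of the bound `k ≤ s + 1`. -/
theorem coeff_eq_cumCoeff (hK : IsSelfAdjoint K) (hΦ : IsSelfAdjoint Φ) {c : ℝ → ℕ → ℂ} {t : ℝ}
    (h : ∀ s, expansion (groupExpansion K Φ c) (trunc 0 1) t s =
      expansion (cumulant K Φ) (trunc 0 1) t s) {s : ℕ} (h1 : (1 : Op s H) ≠ 0) {k : ℕ} (hk : 0 < k)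
    (hks : k ≤ s + 1) : c t k = cumCoeff k := by
  refine sub_eq_zero.mp (eq_zero_of_sum_partsOf_card (d := fun k => c t k - cumCoeff k) hk
    fun j hj hjk => ?_)
  obtain ⟨r, rfl⟩ : ∃ r, j = r + 1 := ⟨j - 1, by omega⟩
  refine ⟨Finset (Fin r), inferInstance, clusters ∅ Finset.univ, ?_, ?_⟩
  · rw [card_clusters (Finset.disjoint_empty_left _), Finset.card_fin]
  · have h2 := h r
    rw [expansion_trunc_zero_one, expansion_trunc_zero_one, groupExpansion_apply_one hK hΦ,
      cumulant, groupExpansion_apply_one hK hΦ] at h2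
    rw [Finset.sum_sub_distrib, sub_eq_zero]
    exact smul_left_injective ℂ (one_ne_zero_of_le (by omega) h1) h2

theorem groupExpansion_solves_iff (hK : IsSelfAdjoint K) (hΦ : IsSelfAdjoint Φ) (hΦs : IsSymm Φ)
    (hγ : 0 < γ) (c : ℝ → ℕ → ℂ) : ExpansionSolves K Φ γ (groupExpansion K Φ c) ↔
      SolvesClusterExpansions K Φ (groupExpansion K Φ c) := by
  refine ⟨fun h => ?_, expansionSolves_of_solvesClusterExpansions hK hΦ hΦs hγ⟩
  rw [expansionSolves_iff hK hΦ hΦs hγ] at h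
  rw [solvesClusterExpansions_iff hK hΦ]
  intro s t X J hXJ
  -- If the `s`-particle space is trivial, nothing can be learned about the coefficients, but every
  -- operator identity holds.
  by_cases h1 : (1 : Op s H) = 0
  · have : ∀ a : Op s H, a = 0 := fun a => by rw [← mul_one a, h1, mul_zero]
    exact LinearMap.ext fun a => (this _).trans (this _).symm
  · rw [cumulant, groupExpansion_eq, groupExpansion_eq]
    refine Finset.sum_congr rfl fun B hB => ?_
    have hB1 := card_pos_of_mem_partsOf (clusters_nonempty X J) hB
    have hB2 := card_le_of_mem_partsOf hB
    have hJ := Finset.card_le_univ J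
    rw [card_clusters hXJ] at hB2
    rw [Fintype.card_fin] at hJ
    have hc : c t B.card = cumCoeff B.card :=
      coeff_eq_cumCoeff hK hΦ (fun r => by rw [h _ (trunc_one_mem γ 0) t]) h1 hB1 (by omega)
    rw [hc]
    rfl

/-- `γ < 1` gives `e^{2γ} ≤ e²`, and the remaining factor is at least `1`; the condition `γ < e⁻¹`
serves only to keep that factor positive. -/
theorem exp_two_mul_le (hγ0 : 0 < γ) (hγ1 : γ < 1) (hγ : γ < (Real.exp 1)⁻¹) :
    Real.exp (2 * γ) ≤ Real.exp 1 ^ 2 * (1 - γ * Real.exp 1)⁻¹ := by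
  have h0 : 0 < Real.exp 1 := Real.exp_pos 1
  have h1 : γ * Real.exp 1 < 1 := by rwa [lt_inv_comm₀ hγ0 h0, lt_inv_comm₀ h0 hγ0, ← one_div, lt_div_iff₀ h0] at hγ
  have h2 : Real.exp (2 * γ) ≤ Real.exp 1 ^ 2 := by
    rw [← Real.exp_nat_mul, Real.exp_le_exp]
    push_cast
    linarith
  refine h2.trans (le_mul_of_one_le_right (by positivity) ?_)
  exact (one_le_inv₀ (by linarith)).mpr (by linarith [mul_pos hγ0 h0])

end
end QuantumHierarchy
open QuantumHierarchy

theorem mainTheorem2 {H : Type*} [NormedAddCommGroup H] [InnerProductSpace ℂ H] [CompleteSpace H]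
    (K : H →ₗ.[ℂ] H) (hK : IsSelfAdjoint K)
    (Φ : Op 2 H) (hΦ : IsSelfAdjoint Φ) (hΦs : IsSymm Φ)
    (γ : ℝ) (hγ0 : 0 < γ) (hγ1 : γ < 1) :
    -- arbitrary generating operators
    (∀ 𝔄 : GenOps H, IsGeneratingFamily 𝔄 →
      (ExpansionSolves K Φ γ 𝔄 ↔ SolvesClusterExpansionsOnObs K Φ γ 𝔄) ∧
      (ExpansionSolves K Φ γ 𝔄 ↔ EqOnObs γ 𝔄 (cumulant K Φ))) ∧
    -- generating operators that are expansions over the groups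
    (∀ c : ℝ → ℕ → ℂ,
      ExpansionSolves K Φ γ (groupExpansion K Φ c) ↔
        SolvesClusterExpansions K Φ (groupExpansion K Φ c)) ∧
    -- solutions of the cluster expansions are exactly the cumulants, and they give solutions
    (∀ 𝔄 : GenOps H,
      (SolvesClusterExpansions K Φ 𝔄 ↔
        ∀ (s : ℕ) (t : ℝ) (X J : Finset (Fin s)), Disjoint X J →
          𝔄 s t (clusters X J) = cumulant K Φ s t (clusters X J)) ∧
      (SolvesClusterExpansions K Φ 𝔄 → ExpansionSolves K Φ γ 𝔄)) ∧
    -- the bound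
    (∀ 𝔄 : GenOps H, ExpansionSolves K Φ γ 𝔄 → γ < (Real.exp 1)⁻¹ →
      ∀ b ∈ obsSpace H γ, ∀ t : ℝ,
        obsNorm γ (expansion 𝔄 b t) ≤
          Real.exp 1 ^ 2 * (1 - γ * Real.exp 1)⁻¹ * obsNorm γ b) := by
  refine ⟨fun 𝔄 h𝔄 => ?_, groupExpansion_solves_iff hK hΦ hΦs hγ0, fun 𝔄 =>
    ⟨solvesClusterExpansions_iff hK hΦ 𝔄, expansionSolves_of_solvesClusterExpansions hK hΦ hΦs hγ0⟩,
    fun 𝔄 h hγ b hb t => ?_⟩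
  · have h1 : ExpansionSolves K Φ γ 𝔄 ↔ EqOnObs γ 𝔄 (cumulant K Φ) := by
      rw [expansionSolves_iff hK hΦ hΦs hγ0, eqOnObs_iff]
    exact ⟨h1.trans (solvesClusterExpansionsOnObs_iff hK hΦ h𝔄 γ).symm, h1⟩
  · exact (obsNorm_expansion_le hK hΦ hΦs hγ0 h hb t).trans
      (mul_le_mul_of_nonneg_right (exp_two_mul_le hγ0 hγ1 hγ) (obsNorm_nonneg hγ0 b))
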